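/- **Conventions.** Let $M$ be a smooth finite-dimensional manifold (Hausdorff, without boundary) with a Poisson bivector $\pi$; write $\pi(\alpha,\beta)=\beta(\pi^\sharp\alpha)$, $\{f,g\}=\pi(df,dg)$ and $$[\alpha,\beta]_\pi=\mathcal L_{\pi^\sharp\alpha}\beta-\mathcal L_{\pi^\sharp\beta}\alpha-d(\pi(\alpha,\beta))\qquad(\alpha,\beta\in\Omega^1(M)).$$ Let $G$ be a finite-dimensional real Lie group with Lie algebra $\mathfrak g$, equipped with the zero Poisson structure. Its dual Poisson Lie group is the vector group $\mathfrak g^*$, whose left-invariant one-form $\theta_\xi$ ($\xi\in\mathfrak g$) is the constant form $\xi$. An *infinitesimal momentum map* is a morphism of differential Gerstenhaber algebras $(\wedge^\bullet\mathfrak g,0,[\cdot,\cdot])\to(\Omega^\bullet(M),d,[\cdot,\cdot]_\pi)$; equivalently, a linear map $\alpha:\mathfrak g\to\Omega^1(M)$, $\xi\mapsto\alpha_\xi$, with $d\alpha_\xi=0$ and $\alpha_{[\xi,\eta]}=[\alpha_\xi,\alpha_\eta]_\pi$ for all $\xi,\eta\in\mathfrak g$. For a smooth left action $\Phi$ of $G$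 on $M$ put $\xi_M(m)=\frac{d}{dt}\big|_{t=0}\Phi_{\exp(-t\xi)}(m)$. The action is *Poisson* if every $\Phi_g$ preserves $\{\cdot,\cdot\}$. A smooth map $\boldsymbol\mu:M\to\mathfrak g^*$ is a *$G$-equivariant momentum map generating $\alpha$* if $\xi_M=\pi^\sharp(\boldsymbol\mu^*\theta_\xi)$ and $\boldsymbol\mu^*\theta_\xi=\alpha_\xi$ for all $\xi\in\mathfrak g$, and $\langle\boldsymbol\mu(\Phi_g(m)),\xi\rangle=\langle\boldsymbol\mu(m),\mathrm{Ad}_{g^{-1}}\xi\rangle$ for all $g\in G$, $m\in M$, $\xi\in\mathfrak g$. Write $\boldsymbol\mu^\xi(m)=\langle\boldsymbol\mu(m),\xi\rangle$. **Theorem.** Let $G$ be connected and simply connected with zero Poisson structure, and let $M$ be a compact, connected and simply connected Poisson manifold. 1. A linear map $\alpha:\mathfrak g\to\{\text{one-forms on }M\}$ is an infinitesimal momentum map if and only if there is a linear map $\mathfrak g\to C^\infty(M)$, $\xi\mapsto H_\xi$, with $\alpha_\xi=dH_\xi$ and $d\{H_\xi,H_\eta\}=dH_{[\xi,\eta]}$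 for all $\xi,\eta\in\mathfrak g$. 2. Let $\alpha$ be an infinitesimal momentum map and $\xi\mapsto H_\xi$ any linear map with $\alpha_\xi=dH_\xi$. Then $c(\xi,\eta)=\{H_\xi,H_\eta\}-H_{[\xi,\eta]}$ is constant on $M$, and $c$ is a 2-cocycle on $\mathfrak g$ with values in $\mathbb R$. There is a unique smooth left action $\Phi$ of $G$ on $M$ with $\xi_M=\pi^\sharp(\alpha_\xi)$ for all $\xi\in\mathfrak g$, and it is a Poisson action. For this action: * if $c=0$, there is a unique $G$-equivariant momentum map $\boldsymbol\mu$ generating $\alpha$ with $\boldsymbol\mu^\xi=H_\xi$ for all $\xi\in\mathfrak g$; * a $G$-equivariant momentum map generating $\alpha$ exists if and only if there is $z_0\in\mathfrak g^*$ with $c(\xi,\eta)=z_0([\xi,\eta])$ for all $\xi,\eta$, that is, $[c]=0$ in $H^2(\mathfrak g,\mathbb R)$; * if $\boldsymbol\mu$ is a $G$-equivariant momentum map generating $\alpha$, then all of them are exactly the maps $\boldsymbol\mu+z$ with $z\in\mathfrak g^*$, $z|_{[\mathfrak g,\mathfrak g]}=0$; hence, when one exists, it is unique if and only if $[\mathfrak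 g,\mathfrak g]=\mathfrak g$; * a smooth map $\boldsymbol\mu:M\to\mathfrak g^*$ with $\boldsymbol\mu^*\theta_\xi=\alpha_\xi$ for all $\xi$ is $G$-equivariant if and only if $\{\boldsymbol\mu^\xi,\boldsymbol\mu^\eta\}=\boldsymbol\mu^{[\xi,\eta]}$ for all $\xi,\eta\in\mathfrak g$. -/

import Mathlib

open Set VectorField Bundle
open scoped Manifold ContDiff

noncomputable section

namespace PoissonMomentum

section Manifold

variable {E : Type*} [NormedAddCommGroup E] [NormedSpace ℝ E]
  {M : Type*} [TopologicalSpace M] [ChartedSpace E M]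

variable (E M) in
/-- (Not necessarily smooth) one-forms on `M`. -/
abbrev OneForm : Type _ := ∀ m : M, TangentSpace 𝓘(ℝ, E) m →L[ℝ] ℝ

variable (E M) in
/-- (Not necessarily smooth) vector fields on `M`. -/
abbrev VField : Type _ := ∀ m : M, TangentSpace 𝓘(ℝ, E) m

variable (E) in
/-- Smooth real-valued functions. -/
def SmoothFun (f : M → ℝ) : Prop := ContMDiff 𝓘(ℝ, E) 𝓘(ℝ, ℝ) ∞ f

/-- Smooth vector fields: smooth sections of the tangent bundle. -/
def SmoothVField [IsManifold 𝓘(ℝ, E) ∞ M] (X : VField E M) : Prop :=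
  ContMDiff 𝓘(ℝ, E) (𝓘(ℝ, E).prod 𝓘(ℝ, E)) ∞
    (fun m => (⟨m, X m⟩ : TangentBundle 𝓘(ℝ, E) M))

/-- Smooth one-forms: smooth sections of the cotangent bundle `Hom(TM, ℝ)`. -/
def SmoothOneForm [IsManifold 𝓘(ℝ, E) ∞ M] (α : OneForm E M) : Prop :=
  ContMDiff 𝓘(ℝ, E) (𝓘(ℝ, E).prod 𝓘(ℝ, E →L[ℝ] ℝ)) ∞
    (fun m => TotalSpace.mk' (E →L[ℝ] ℝ)
      (E := fun m : M => TangentSpace 𝓘(ℝ, E) m →L[ℝ] Bundle.Trivial M ℝ m) m (α m))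

variable (E) in
/-- The differential `df` of a real-valued function, as a one-form. -/
def differential (f : M → ℝ) : OneForm E M := fun m => mvfderiv 𝓘(ℝ, E) f m

/-- The one-form `α` is closed: `dα(Y, Z) = Y(α(Z)) - Z(α(Y)) - α([Y, Z]) = 0` for all smooth
vector fields `Y`, `Z`. -/
def IsClosedForm [IsManifold 𝓘(ℝ, E) ∞ M] (α : OneForm E M) : Prop :=
  ∀ Y Z : VField E M, SmoothVField Y → SmoothVField Z → ∀ m : M,
    differential E (fun p => α p (Z p)) m (Y m) - differential E (fun p => α p (Y p)) m (Z m)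
      - α m (mlieBracket 𝓘(ℝ, E) Y Z m) = 0

/-- `(L_X β)(Y) = X(β(Y)) - β([X, Y])`, the Lie derivative of a one-form `β` along `X`,
evaluated on the vector field `Y`. -/
def lieDerivOneForm (X : VField E M) (β : OneForm E M) (Y : VField E M) (m : M) : ℝ :=
  differential E (fun p => β p (Y p)) m (X m) - β m (mlieBracket 𝓘(ℝ, E) X Y m)

variable (E M) in
/-- A Poisson structure on `M`: a smooth bivector field `π`, encoded by the skew bundle map
`π♯ : T*M → TM` with `π(α, β) = β(π♯ α)`, such that the bracket `{f, g} = π(df, dg)` of smooth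
functions satisfies the Jacobi identity. -/
structure PoissonStructure [IsManifold 𝓘(ℝ, E) ∞ M] where
  /-- The bundle map `π♯ : T*M → TM`. -/
  sharp : ∀ m : M, (TangentSpace 𝓘(ℝ, E) m →L[ℝ] ℝ) →ₗ[ℝ] TangentSpace 𝓘(ℝ, E) m
  skew : ∀ (m : M) (a b : TangentSpace 𝓘(ℝ, E) m →L[ℝ] ℝ), b (sharp m a) = - a (sharp m b)
  smooth : ∀ α : OneForm E M, SmoothOneForm α → SmoothVField (fun m => sharp m (α m))
  jacobi : ∀ f g h : M → ℝ, SmoothFun E f → SmoothFun E g → SmoothFun E h →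
    let br : (M → ℝ) → (M → ℝ) → M → ℝ :=
      fun u v m => differential E v m (sharp m (differential E u m))
    ∀ m, br (br f g) h m + br (br g h) f m + br (br h f) g m = 0

namespace PoissonStructure

variable [IsManifold 𝓘(ℝ, E) ∞ M] (P : PoissonStructure E M)

/-- The vector field `π♯(α)`. -/
def sharpField (α : OneForm E M) : VField E M := fun m => P.sharp m (α m)

/-- The function `π(α, β) = β(π♯ α)`. -/
def pair (α β : OneForm E M) (m : M) : ℝ := β m (P.sharp m (α m))

/-- The Poisson bracket `{f, g} = π(df, dg)`. -/
def bracket (f g : M → ℝ) : M → ℝ := P.pair (differential E f) (differential E g)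

/-- The bracket of one-forms `[α, β]_π = L_{π♯α} β - L_{π♯β} α - d(π(α, β))`, evaluated on the
vector field `Y`. -/
def formBracket (α β : OneForm E M) (Y : VField E M) (m : M) : ℝ :=
  lieDerivOneForm (P.sharpField α) β Y m - lieDerivOneForm (P.sharpField β) α Y m
    - differential E (P.pair α β) m (Y m)

end PoissonStructure

end Manifold

section Group

variable {EG : Type*} [NormedAddCommGroup EG] [NormedSpace ℝ EG]
  {G : Type*} [TopologicalSpace G] [ChartedSpace EG G] [Group G]
  {E : Type*} [NormedAddCommGroup E] [NormedSpace ℝ E]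
  {M : Type*} [TopologicalSpace M] [ChartedSpace E M]

variable (EG G) in
/-- The Lie algebra `𝔤` of `G`: the tangent space at the identity with the bracket of
left-invariant vector fields. -/
abbrev LieAlg : Type _ := GroupLieAlgebra 𝓘(ℝ, EG) G

variable (EG) in
/-- The dual `𝔤*`; the vector space underlying `𝔤 = T_e G` is the model space `EG`. This is the
dual Poisson Lie group of `G` with its zero Poisson structure. -/
abbrev LieDual : Type _ := EG →L[ℝ] ℝ

/-- The canonical identification of `𝔤 = T_e G` with the model space. -/
def toModel (ξ : LieAlg EG G) : EG := ξ

/-- The pairing `⟨z, ξ⟩` of `𝔤*` with `𝔤`. -/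
def pairing (z : LieDual EG) (ξ : LieAlg EG G) : ℝ := z (toModel ξ)

/-- The adjoint action `Ad_g : 𝔤 → 𝔤`, the derivative at the identity of `h ↦ g h g⁻¹`. -/
def Ad (g : G) (ξ : LieAlg EG G) : LieAlg EG G :=
  (mfderiv 𝓘(ℝ, EG) 𝓘(ℝ, EG) (fun h : G => g * h * g⁻¹) 1 ξ : EG)

/-- Infinitesimal momentum map of `G` with zero Poisson structure (so zero cobracket `δ` on `𝔤`)
on a Poisson manifold: a morphism of differential Gerstenhaber algebras
`(⋀𝔤, δ = 0, [·,·]) → (Ω(M), d, [·,·]_π)`. As `⋀𝔤` is freely generated by `𝔤` in degree one as a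
graded commutative algebra, and both brackets are biderivations, such a morphism is the same as a
linear map `𝔤 → Ω¹(M)`, `ξ ↦ α_ξ`, with `dα_ξ = 0` and `α_{[ξ, η]} = [α_ξ, α_η]_π`
(equality of one-forms is tested on all smooth vector fields). -/
structure IsInfinitesimalMomentumMap [IsManifold 𝓘(ℝ, E) ∞ M] (P : PoissonStructure E M)
    (α : LieAlg EG G →ₗ[ℝ] OneForm E M) : Prop where
  smooth : ∀ ξ, SmoothOneForm (α ξ)
  closed : ∀ ξ, IsClosedForm (α ξ)
  map_bracket : ∀ ξ η : LieAlg EG G, ∀ Y : VField E M, SmoothVField Y →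
    ∀ m, α ⁅ξ, η⁆ m (Y m) = P.formBracket (α ξ) (α η) Y m

/-- A smooth left action of `G` on `M`. -/
structure IsSmoothAction (EG E : Type*) [NormedAddCommGroup EG] [NormedSpace ℝ EG]
    [NormedAddCommGroup E] [NormedSpace ℝ E]
    {G : Type*} [TopologicalSpace G] [ChartedSpace EG G] [Group G]
    {M : Type*} [TopologicalSpace M] [ChartedSpace E M] (Φ : G → M → M) : Prop where
  one : ∀ m, Φ 1 m = m
  mul : ∀ g h m, Φ (g * h) m = Φ g (Φ h m)
  smooth : ContMDiff (𝓘(ℝ, EG).prod 𝓘(ℝ, E)) 𝓘(ℝ, E) ∞ (fun p : G × M => Φ p.1 p.2)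

/-- The infinitesimal generator `ξ_M(m) = d/dt|_{t=0} Φ(exp(-tξ), m) = -T_e(g ↦ Φ(g, m)) ξ`. -/
def generator (Φ : G → M → M) (ξ : LieAlg EG G) : VField E M := fun m =>
  (-(mfderiv 𝓘(ℝ, EG) 𝓘(ℝ, E) (fun g : G => Φ g m) 1 ξ) : E)

/-- For `G` with zero Poisson structure, `Φ : G × M → M` is a Poisson map iff every `Φ_g`
preserves the Poisson bracket of `M`. -/
def IsPoissonAction [IsManifold 𝓘(ℝ, E) ∞ M] (P : PoissonStructure E M) (Φ : G → M → M) : Prop :=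
  ∀ (g : G) (u v : M → ℝ), SmoothFun E u → SmoothFun E v → ∀ m,
    P.bracket (fun p => u (Φ g p)) (fun p => v (Φ g p)) m = P.bracket u v (Φ g m)

/-- The pullback `μ^*(θ_ξ)` of the left-invariant (i.e. constant) one-form `θ_ξ = ξ` on `𝔤*`. -/
def pullbackTheta (μ : M → LieDual EG) (ξ : LieAlg EG G) : OneForm E M := fun m =>
  (ContinuousLinearMap.apply ℝ ℝ (toModel ξ)).comp (mvfderiv 𝓘(ℝ, E) μ m)

/-- `μ : M → 𝔤*` is a momentum map for the action `Φ`: it is smooth and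
`ξ_M = π♯(μ^*(θ_ξ))` for all `ξ`. -/
structure IsMomentumMap [IsManifold 𝓘(ℝ, E) ∞ M] (P : PoissonStructure E M) (Φ : G → M → M)
    (μ : M → LieDual EG) : Prop where
  smooth : ContMDiff 𝓘(ℝ, E) 𝓘(ℝ, LieDual EG) ∞ μ
  generator_eq : ∀ ξ : LieAlg EG G, (generator Φ ξ : VField E M) = P.sharpField (pullbackTheta μ ξ)

/-- `G`-equivariance of `μ` for the coadjoint action on `𝔤*`:
`⟨μ(Φ_g m), ξ⟩ = ⟨μ(m), Ad_{g⁻¹} ξ⟩`. -/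
def IsEquivariant (Φ : G → M → M) (μ : M → LieDual EG) : Prop :=
  ∀ (g : G) (m : M) (ξ : LieAlg EG G), pairing (μ (Φ g m)) ξ = pairing (μ m) (Ad g⁻¹ ξ)

/-- `μ` is a `G`-equivariant momentum map for `Φ` generating `α`, i.e. `α_ξ = μ^*(θ_ξ)`. -/
structure Generates [IsManifold 𝓘(ℝ, E) ∞ M] (P : PoissonStructure E M) (Φ : G → M → M)
    (α : LieAlg EG G →ₗ[ℝ] OneForm E M) (μ : M → LieDual EG) : Prop where
  momentum : IsMomentumMap P Φ μ
  equivariant : IsEquivariant Φ μ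
  pullback_eq : ∀ ξ, pullbackTheta μ ξ = α ξ

/-- Lie algebra 2-cocycles on `𝔤` with values in the trivial module `ℝ`. -/
structure IsTwoCocycle (c : LieAlg EG G →ₗ[ℝ] LieAlg EG G →ₗ[ℝ] ℝ) : Prop where
  alt : ∀ ξ, c ξ ξ = 0
  cocycle : ∀ ξ η ζ : LieAlg EG G, c ⁅ξ, η⁆ ζ + c ⁅η, ζ⁆ ξ + c ⁅ζ, ξ⁆ η = 0

end Group

end PoissonMomentum

end

/-! Everything analytic reduces to one tool: existence and uniqueness for total differential
equations `df = Z(·, f)`. Under the integrability condition `IsFlatAt`, a solution is found by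
integrating along rays from the base point: the implicit function theorem in `C([0, 1], F)` makes
the curves depend smoothly on endpoint and initial value, and integrability shows that the endpoint
map has the prescribed differential (`exists_local_solution`). Solutions on a connected open set are
determined by one value (`eqOn_of_solvesAt`), and on a simply connected space local solutions glue,
being flat sections of a covering (`exists_flat_section`).

Applied to `dH = α`, this gives primitives of closed one-forms; normalising them at one point makes
`H` linear in `ξ`. As `[df, dg]_π = d{f, g}`, the bracket condition on `α` says that `{H_ξ, H_η}`
and `H_{[ξ, η]}` have the same differential, so they differ by a constant `c(ξ, η)`. The cocycle
identity is the difference of the two Jacobi identities.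

Applied to maps `f : G → M` with `df(ξ^L) = X_ξ ∘ f`, where `X_ξ = π♯(α_ξ)`, it gives the action
(Lie–Palais). The equation is integrable because the left-invariant frame and the hamiltonian fields
`X_ξ` have the same structure constants. Compactness of `M` gives a neighbourhood of the identity on
which solutions exist for all initial values, simple connectedness of `G` extends them, and
uniqueness yields the action law (`exists_smoothAction`). The action is Poisson because the
derivative of `{u ∘ Φ_h, v ∘ Φ_h}(Φ_{h⁻¹} m)` in `h` vanishes by the Jacobi identity.

Equivariance is a third instance. The map `g ↦ μ(m) ∘ Ad_g` solves the invariant equation of the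
linear fields `z ↦ z ∘ ad_η` on the dual, and `g ↦ μ(Φ_{g⁻¹} m)` solves it for all `m` exactly when
`{μ^ξ, μ^η} = μ^{[ξ, η]}`; the two maps agree at the identity. Hence the equivariant momentum maps
generating `α` are the maps `H + z` with `c(ξ, η) = z([ξ, η])` (`generates_iff_exists`), and the
remaining claims are linear algebra in `z`. -/

noncomputable section

namespace PoissonMomentum

set_option linter.unusedSectionVars false
set_option synthInstance.maxHeartbeats 200000

/-! ### Superposition operators on spaces of continuous functions -/

section Superposition

open ContinuousMap Filter Topology

variable {K : Type*} [TopologicalSpace K] [CompactSpace K]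

/-- A continuous bilinear map, applied pointwise to continuous functions. -/
def pointwiseBilin (K : Type*) [TopologicalSpace K] [CompactSpace K]
    {D A B : Type*} [NormedAddCommGroup D] [NormedSpace ℝ D] [NormedAddCommGroup A]
    [NormedSpace ℝ A] [NormedAddCommGroup B] [NormedSpace ℝ B] (β : D →L[ℝ] A →L[ℝ] B) :
    C(K, D) →L[ℝ] C(K, A) →L[ℝ] C(K, B) :=
  LinearMap.mkContinuous₂
    (LinearMap.mk₂ ℝ (fun (L : C(K, D)) (u : C(K, A)) =>
        (⟨fun k => β (L k) (u k), (β.continuous.comp L.continuous).clm_apply u.continuous⟩ :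
          C(K, B)))
      (fun _ _ _ => by ext; simp) (fun _ _ _ => by ext; simp)
      (fun _ _ _ => by ext; simp) (fun _ _ _ => by ext; simp)) ‖β‖ (fun L u => by
    rw [ContinuousMap.norm_le _ (by positivity)]
    intro k
    refine (β.le_opNorm₂ (L k) (u k)).trans ?_
    gcongr
    · exact L.norm_coe_le_norm k
    · exact u.norm_coe_le_norm k)

@[simp]
theorem pointwiseBilin_apply {D A B : Type*} [NormedAddCommGroup D] [NormedSpace ℝ D]
    [NormedAddCommGroup A] [NormedSpace ℝ A] [NormedAddCommGroup B] [NormedSpace ℝ B]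
    (β : D →L[ℝ] A →L[ℝ] B) (L : C(K, D)) (u : C(K, A)) (k : K) :
    pointwiseBilin K β L u k = β (L k) (u k) := rfl

/-- Pointwise evaluation `C(K, A →L B) × C(K, A) → C(K, B)` as a continuous bilinear map. -/
def pointwiseApply (K : Type*) [TopologicalSpace K] [CompactSpace K]
    (A B : Type*) [NormedAddCommGroup A] [NormedSpace ℝ A] [NormedAddCommGroup B]
    [NormedSpace ℝ B] : C(K, A →L[ℝ] B) →L[ℝ] C(K, A) →L[ℝ] C(K, B) :=
  pointwiseBilin K (ContinuousLinearMap.id ℝ (A →L[ℝ] B))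

@[simp]
theorem pointwiseApply_apply {A B : Type*} [NormedAddCommGroup A] [NormedSpace ℝ A]
    [NormedAddCommGroup B] [NormedSpace ℝ B] (L : C(K, A →L[ℝ] B)) (u : C(K, A)) (k : K) :
    pointwiseApply K A B L u k = L k (u k) := rfl

/-- Postcomposition is continuous for the compact-open topology, which on a compact `K` is that of
the supremum norm. This stands in for uniform continuity of `D` near the image of `u`. -/
theorem exists_forall_dist_comp_le {A B : Type*} [NormedAddCommGroup A] [NormedAddCommGroup B]
    (D : C(A, B)) (u : C(K, A)) {c : ℝ} (hc : 0 < c) :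
    ∃ δ > 0, ∀ v : C(K, A), dist v u < δ → ∀ k, dist (D (v k)) (D (u k)) ≤ c := by
  have hcont : Continuous (fun v : C(K, A) => D.comp v) := D.continuous_postcomp
  obtain ⟨δ, hδ, h⟩ := Metric.continuousAt_iff.1 (hcont.continuousAt (x := u)) c hc
  exact ⟨δ, hδ, fun v hv k => (ContinuousMap.dist_apply_le_dist (f := D.comp v)
    (g := D.comp u) k).trans (h hv).le⟩

/-- The mean value inequality on the segment from `u k` to `u k + w k` bounds the error at `k` by `c
‖w k‖`. The bound is uniform in `k` because `fderiv ℝ f` varies by at most `c` along all curves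
close to `u` simultaneously. -/
theorem hasFDerivAt_continuousMap_comp {A B : Type*} [NormedAddCommGroup A] [NormedSpace ℝ A]
    [NormedAddCommGroup B] [NormedSpace ℝ B] {f : A → B} (hf : ContDiff ℝ 1 f) (u : C(K, A)) :
    HasFDerivAt (fun v : C(K, A) => (⟨f, hf.continuous⟩ : C(A, B)).comp v)
      (pointwiseApply K A B ((⟨fderiv ℝ f, hf.continuous_fderiv one_ne_zero⟩ :
        C(A, A →L[ℝ] B)).comp u)) u := by
  set D : C(A, A →L[ℝ] B) := ⟨fderiv ℝ f, hf.continuous_fderiv one_ne_zero⟩ with hD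
  rw [hasFDerivAt_iff_isLittleO_nhds_zero, Asymptotics.isLittleO_iff]
  intro c hc
  obtain ⟨δ, hδ, h⟩ := exists_forall_dist_comp_le D u hc
  filter_upwards [Metric.ball_mem_nhds (0 : C(K, A)) hδ] with w hw
  rw [ContinuousMap.norm_le _ (by positivity)]
  intro k
  have key : ∀ z ∈ segment ℝ (u k) (u k + w k), ‖fderiv ℝ f z - fderiv ℝ f (u k)‖ ≤ c := by
    intro z hz
    rw [segment_eq_image'] at hz
    obtain ⟨t, ht, rfl⟩ := hz
    have h1 : dist (u + t • w) u < δ := by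
      rw [dist_eq_norm, add_sub_cancel_left, norm_smul, Real.norm_of_nonneg ht.1]
      have : ‖w‖ < δ := by simpa using hw
      nlinarith [norm_nonneg w, ht.2]
    have h2 := h _ h1 k
    rw [dist_eq_norm] at h2
    simpa [hD] using h2
  have hmv := (convex_segment (u k) (u k + w k)).norm_image_sub_le_of_norm_hasFDerivWithin_le'
    (f := f) (f' := fderiv ℝ f) (φ := fderiv ℝ f (u k)) (C := c)
    (fun z _ => ((hf.differentiable one_ne_zero) z).hasFDerivAt.hasFDerivWithinAt) key
    (left_mem_segment ℝ _ _) (right_mem_segment ℝ _ _)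
  simp only [add_sub_cancel_left] at hmv
  have h5 : ‖w k‖ ≤ ‖w‖ := w.norm_coe_le_norm k
  calc _ = ‖f (u k + w k) - f (u k) - fderiv ℝ f (u k) (w k)‖ := by simp [hD]
    _ ≤ c * ‖w k‖ := hmv
    _ ≤ c * ‖w‖ := by gcongr

theorem hasFDerivAt_continuousMap_comp_clm {A B W : Type*} [NormedAddCommGroup A]
    [NormedSpace ℝ A] [NormedAddCommGroup B] [NormedSpace ℝ B] [NormedAddCommGroup W]
    [NormedSpace ℝ W] {f : A → B} (hf : ContDiff ℝ 1 f) (T : W →L[ℝ] C(K, A)) (w : W) :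
    HasFDerivAt (fun w => (⟨f, hf.continuous⟩ : C(A, B)).comp (T w))
      ((pointwiseApply K A B ((⟨fderiv ℝ f, hf.continuous_fderiv one_ne_zero⟩ :
        C(A, A →L[ℝ] B)).comp (T w))).comp T) w :=
  (hasFDerivAt_continuousMap_comp hf (T w)).comp w T.hasFDerivAt

theorem fderiv_clm_pointwiseBilin_apply {D A B B' W : Type*} [NormedAddCommGroup D]
    [NormedSpace ℝ D] [NormedAddCommGroup A] [NormedSpace ℝ A] [NormedAddCommGroup B]
    [NormedSpace ℝ B] [NormedAddCommGroup W] [NormedSpace ℝ W] [NormedAddCommGroup B']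
    [NormedSpace ℝ B'] (β : D →L[ℝ] A →L[ℝ] B) (J : C(K, B) →L[ℝ] B')
    {c : W → C(K, D)} {c' : W →L[ℝ] C(K, D)} {d : W → C(K, A)} {d' : W →L[ℝ] C(K, A)} {w : W}
    (hc : HasFDerivAt c c' w) (hd : HasFDerivAt d d' w) (δ : W) :
    fderiv ℝ (fun w => J (pointwiseBilin K β (c w) (d w))) w δ =
      J (pointwiseBilin K β (c w) (d' δ) + pointwiseBilin K β (c' δ) (d w)) := by
  have h1 := (pointwiseBilin K β).hasFDerivAt.comp w hc
  have h3 := J.hasFDerivAt.comp w (h1.clm_apply hd)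
  have h4 : fderiv ℝ (fun w => J (pointwiseBilin K β (c w) (d w))) w = _ := h3.fderiv
  rw [h4]
  rfl

universe u

/-- The derivative is again a superposition operator, that of `fderiv ℝ f`, followed by a continuous
linear map. The induction therefore has to range over all targets `B`, and a common universe for `A`
and `B` keeps `A →L[ℝ] B` within that range. -/
theorem contDiff_continuousMap_comp_nat {A : Type u} [NormedAddCommGroup A] [NormedSpace ℝ A]
    (n : ℕ) : ∀ {B : Type u} [NormedAddCommGroup B] [NormedSpace ℝ B] {f : A → B}
      (hf : ContDiff ℝ n f),
      ContDiff ℝ n (fun v : C(K, A) => (⟨f, hf.continuous⟩ : C(A, B)).comp v) := by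
  induction n with
  | zero =>
    intro B _ _ f hf
    exact contDiff_zero.2 (ContinuousMap.continuous_postcomp _)
  | succ n ih =>
    intro B _ _ f hf
    have h1 : ContDiff ℝ 1 f := hf.of_le (by exact_mod_cast Nat.le_add_left 1 n)
    have hd : ContDiff ℝ n (fderiv ℝ f) := hf.fderiv_right le_rfl
    push_cast
    rw [contDiff_succ_iff_hasFDerivAt]
    refine ⟨_, (pointwiseApply K A B).contDiff.comp (ih hd), ?_⟩
    exact fun u => hasFDerivAt_continuousMap_comp h1 u

/-- Composition with a smooth map is smooth on spaces of continuous functions. -/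
theorem contDiff_continuousMap_comp {A B : Type u} [NormedAddCommGroup A] [NormedSpace ℝ A]
    [NormedAddCommGroup B] [NormedSpace ℝ B] {f : A → B} (hf : ContDiff ℝ ∞ f) :
    ContDiff ℝ ∞ (fun v : C(K, A) => (⟨f, hf.continuous⟩ : C(A, B)).comp v) := by
  rw [contDiff_infty]
  exact fun n => contDiff_continuousMap_comp_nat n (hf.of_le (by exact_mod_cast le_top))

end Superposition

/-! ### The Volterra operator on the unit interval -/

section Volterra

open unitInterval MeasureTheory

variable {F : Type*} [NormedAddCommGroup F] [NormedSpace ℝ F] [CompleteSpace F]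

/-- Extension of a continuous function on the unit interval by constants. -/
def extendUnit (u : C(I, F)) : ℝ → F := fun t => u (projIcc 0 1 zero_le_one t)

theorem continuous_extendUnit (u : C(I, F)) : Continuous (extendUnit u) :=
  u.continuous.comp continuous_projIcc

theorem extendUnit_coe (u : C(I, F)) (s : I) : extendUnit u s = u s := by
  simp [extendUnit]

theorem norm_extendUnit_le (u : C(I, F)) (t : ℝ) : ‖extendUnit u t‖ ≤ ‖u‖ :=
  u.norm_coe_le_norm _

/-- The primitive vanishing at `0` of (the extension of) a continuous function. -/
def primitiveFun (u : C(I, F)) (t : ℝ) : F := ∫ τ in (0 : ℝ)..t, extendUnit u τ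

theorem hasDerivAt_primitiveFun (u : C(I, F)) (t : ℝ) :
    HasDerivAt (primitiveFun u) (extendUnit u t) t :=
  intervalIntegral.integral_hasDerivAt_right ((continuous_extendUnit u).intervalIntegrable _ _)
    ((continuous_extendUnit u).stronglyMeasurableAtFilter _ _)  (continuous_extendUnit u).continuousAt

theorem continuous_primitiveFun (u : C(I, F)) : Continuous (primitiveFun u) :=
  continuous_iff_continuousAt.2 fun t => (hasDerivAt_primitiveFun u t).continuousAt

variable (F) in
/-- The Volterra operator `u ↦ (s ↦ ∫₀ˢ u)` on `C([0, 1], F)`. -/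
def volterra : C(I, F) →L[ℝ] C(I, F) :=
  LinearMap.mkContinuous
    { toFun := fun u => ⟨fun s => primitiveFun u s,
        (continuous_primitiveFun u).comp continuous_subtype_val⟩
      map_add' := fun u v => by
        ext s
        exact intervalIntegral.integral_add ((continuous_extendUnit u).intervalIntegrable _ _)
          ((continuous_extendUnit v).intervalIntegrable _ _)
      map_smul' := fun c u => by
        ext s
        exact intervalIntegral.integral_smul c (extendUnit u) } 1 (fun u => by
    rw [one_mul, ContinuousMap.norm_le _ (norm_nonneg _)]
    intro s
    have := intervalIntegral.norm_integral_le_of_norm_le_const (a := 0) (b := (s : ℝ))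
      (f := extendUnit u) (C := ‖u‖) (fun t _ => norm_extendUnit_le u t)
    refine this.trans ?_
    rw [sub_zero, abs_of_nonneg s.2.1]
    exact mul_le_of_le_one_right (norm_nonneg _) s.2.2)

theorem volterra_apply (u : C(I, F)) (s : I) : volterra F u s = primitiveFun u s := rfl

/-- A `C¹` function on the unit interval vanishing at zero is the primitive of its derivative. -/
theorem eq_volterra {y : ℝ → F} {y' : C(I, F)} (h0 : y 0 = 0) (hc : Continuous y)
    (hd : ∀ s : I, (s : ℝ) ∈ Ioo (0 : ℝ) 1 → HasDerivAt y (y' s) s) (s : I) :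
    y s = volterra F y' s := by
  have h := intervalIntegral.integral_eq_sub_of_hasDerivAt_of_le (a := 0) (b := (s : ℝ))
    (f := y) (f' := extendUnit y') s.2.1 hc.continuousOn (fun t ht => by
      have ht' : t ∈ Icc (0 : ℝ) 1 := ⟨ht.1.le, ht.2.le.trans s.2.2⟩
      have := hd ⟨t, ht'⟩ ⟨ht.1, ht.2.trans_le s.2.2⟩
      rwa [← extendUnit_coe] at this)
    ((continuous_extendUnit y').intervalIntegrable _ _)
  rw [volterra_apply, primitiveFun, h, h0, sub_zero]

end Volterra

/-! ### The Picard map of a total differential equation along rays -/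

section TotalEquation

open unitInterval Filter Topology

variable {V F : Type*} [NormedAddCommGroup V] [NormedSpace ℝ V]
  [NormedAddCommGroup F] [NormedSpace ℝ F]

variable (V) in
/-- Constant curves. -/
def constCurve : V →L[ℝ] C(I, V) :=
  LinearMap.mkContinuous
    { toFun := fun v => ContinuousMap.const I v
      map_add' := fun _ _ => by ext; simp
      map_smul' := fun _ _ => by ext; simp } 1 (fun v => by
    rw [one_mul, ContinuousMap.norm_le _ (norm_nonneg _)]
    intro; simp)

@[simp]
theorem constCurve_apply (v : V) (s : I) : constCurve V v s = v := rfl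

variable (V F) in
/-- The curve `s ↦ (s h, x + u(s))` in `V × F`. -/
def curveMap : (V × F) × C(I, F) →L[ℝ] C(I, V × F) :=
  LinearMap.mkContinuous
    { toFun := fun w => ⟨fun s => ((s : ℝ) • w.1.1, w.1.2 + w.2 s), by fun_prop⟩
      map_add' := fun _ _ => by ext <;> simp [add_add_add_comm]
      map_smul' := fun c w => by ext <;> simp [smul_comm (_ : ℝ) c] } 2 (fun w => by
    rw [ContinuousMap.norm_le _ (by positivity)]
    intro s
    have h1 : ‖w.1.1‖ ≤ ‖w‖ := (norm_fst_le w.1).trans (norm_fst_le w)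
    have h2 : ‖w.1.2‖ ≤ ‖w‖ := (norm_snd_le w.1).trans (norm_fst_le w)
    have h3 : ‖w.2 s‖ ≤ ‖w‖ := (w.2.norm_coe_le_norm s).trans (norm_snd_le w)
    refine max_le ?_ ((norm_add_le _ _).trans (by linarith))
    change ‖(s : ℝ) • w.1.1‖ ≤ _
    rw [norm_smul, Real.norm_of_nonneg s.2.1]
    nlinarith [s.2.2, norm_nonneg w.1.1, s.2.1])

@[simp]
theorem curveMap_apply (w : (V × F) × C(I, F)) (s : I) :
    curveMap V F w s = ((s : ℝ) • w.1.1, w.1.2 + w.2 s) := rfl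

variable {Z : V × F → V →L[ℝ] F} (hZ : ContDiff ℝ ∞ Z)

/-- The coefficient `Z` along the curve of `w`. -/
def coeffAlong (w : (V × F) × C(I, F)) : C(I, V →L[ℝ] F) :=
  (⟨Z, hZ.continuous⟩ : C(V × F, V →L[ℝ] F)).comp (curveMap V F w)

/-- The derivative of `Z` along the curve of `w`. -/
def fderivAlong (w : (V × F) × C(I, F)) : C(I, V × F →L[ℝ] V →L[ℝ] F) :=
  (⟨fderiv ℝ Z, hZ.continuous_fderiv (by simp)⟩ :
    C(V × F, V × F →L[ℝ] V →L[ℝ] F)).comp (curveMap V F w)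

theorem contDiff_coeffAlong : ContDiff ℝ ∞ (coeffAlong hZ) :=
  (contDiff_continuousMap_comp hZ).comp (curveMap V F).contDiff

theorem hasFDerivAt_coeffAlong (w : (V × F) × C(I, F)) :
    HasFDerivAt (coeffAlong hZ)
      ((pointwiseApply I (V × F) (V →L[ℝ] F) (fderivAlong hZ w)).comp (curveMap V F)) w :=
  hasFDerivAt_continuousMap_comp_clm (hZ.of_le (by simp)) (curveMap V F) w

variable [CompleteSpace F]

/-- The integrand of the Picard map. -/
def picardIntegrand (w : (V × F) × C(I, F)) : C(I, F) :=
  pointwiseApply I V F (coeffAlong hZ w) (constCurve V w.1.1)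

/-- The map `((h, x), u) ↦ (s ↦ ∫₀ˢ Z(τ h, x + u(τ)) h dτ)`. -/
def picardMap (w : (V × F) × C(I, F)) : C(I, F) := volterra F (picardIntegrand hZ w)

theorem contDiff_picardMap : ContDiff ℝ ∞ (picardMap hZ) := by
  unfold picardMap picardIntegrand
  refine (volterra F).contDiff.comp ?_
  exact ((pointwiseApply I V F).contDiff.comp (contDiff_coeffAlong hZ)).clm_apply
    ((constCurve V).contDiff.comp (contDiff_fst.comp contDiff_fst))

/-- The derivative of the integrand of the Picard map. -/
def picardIntegrandDeriv (w δ : (V × F) × C(I, F)) : C(I, F) :=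
  pointwiseApply I V F (coeffAlong hZ w) (constCurve V δ.1.1) +
    pointwiseApply I V F (pointwiseApply I (V × F) (V →L[ℝ] F) (fderivAlong hZ w)
      (curveMap V F δ)) (constCurve V w.1.1)

theorem fderiv_picardMap_apply (w δ : (V × F) × C(I, F)) :
    fderiv ℝ (picardMap hZ) w δ = volterra F (picardIntegrandDeriv hZ w δ) := by
  have h2 : HasFDerivAt (fun w : (V × F) × C(I, F) => constCurve V w.1.1)
      ((constCurve V).comp ((ContinuousLinearMap.fst ℝ V F).comp
        (ContinuousLinearMap.fst ℝ (V × F) C(I, F)))) w :=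
    ((constCurve V).comp ((ContinuousLinearMap.fst ℝ V F).comp
        (ContinuousLinearMap.fst ℝ (V × F) C(I, F)))).hasFDerivAt
  exact fderiv_clm_pointwiseBilin_apply (ContinuousLinearMap.id ℝ (V →L[ℝ] F)) (volterra F)
    (hasFDerivAt_coeffAlong hZ w) h2 δ

/-- Here `p.2 + u` is the solution along the ray towards `p.1`, and `U` is its variation when the
endpoint moves in direction `a`. The defect `U(s) - s Z(s p.1, p.2 + u(s)) a` vanishes at `0` and,
by integrability, satisfies the linearised equation; injectivity makes it vanish, and `s = 1` gives
the differential of the endpoint map. -/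
theorem eq_coeff_of_eq_picardMap {p : V × F} {u U : C(I, F)} {a : V}
    (hu : u = picardMap hZ (p, u)) (hU : U = fderiv ℝ (picardMap hZ) (p, u) ((a, 0), U))
    (hflat : ∀ s : I, ∀ b c : V, fderiv ℝ Z (curveMap V F (p, u) s)
        (b, Z (curveMap V F (p, u) s) b) c =
      fderiv ℝ Z (curveMap V F (p, u) s) (c, Z (curveMap V F (p, u) s) c) b)
    (hinj : ∀ y : C(I, F), y = fderiv ℝ (picardMap hZ) (p, u) (0, y) → y = 0) :
    U 1 = Z (p.1, p.2 + u 1) a := by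
  set g₀ := picardIntegrand hZ (p, u) with hg₀
  set g₁ := picardIntegrandDeriv hZ (p, u) ((a, 0), U) with hg₁
  rw [fderiv_picardMap_apply] at hU
  -- The defect is written with primitives instead of `u` and `U`, so that it lives on all of `ℝ`
  -- and has two-sided derivatives at the ends of the interval.
  let Y : ℝ → F := fun s => primitiveFun g₁ s - s • Z (s • p.1, p.2 + primitiveFun g₀ s) a
  have hu' : ∀ s : I, primitiveFun g₀ s = u s := fun s => by
    rw [← volterra_apply, hg₀]; exact (DFunLike.congr_fun hu s).symm
  have hU' : ∀ s : I, primitiveFun g₁ s = U s := fun s => by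
    rw [← volterra_apply, hg₁]; exact (DFunLike.congr_fun hU s).symm
  have hYc : Continuous Y := by
    have := continuous_primitiveFun g₁
    have := continuous_primitiveFun g₀
    have := hZ.continuous
    fun_prop
  let y : C(I, F) := ⟨fun s => Y s, hYc.comp continuous_subtype_val⟩
  have hy : ∀ s : I, y s = U s - (s : ℝ) • Z (curveMap V F (p, u) s) a := fun s => by
    change primitiveFun g₁ s - (s : ℝ) • Z ((s : ℝ) • p.1, p.2 + primitiveFun g₀ s) a = _
    rw [hu', hU', curveMap_apply]
  have hder : ∀ s : I, HasDerivAt Y (picardIntegrandDeriv hZ (p, u) (0, y) s) s := by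
    intro s
    have d0 : HasDerivAt (fun t : ℝ => (t • p.1, p.2 + primitiveFun g₀ t))
        (p.1, g₀ s) s := by
      refine HasDerivAt.prodMk ?_ ?_
      · simpa using (hasDerivAt_id (s : ℝ)).smul_const p.1
      · simpa [extendUnit_coe] using (hasDerivAt_primitiveFun g₀ s).const_add p.2
    have hpt : ((s : ℝ) • p.1, p.2 + primitiveFun g₀ s) = curveMap V F (p, u) s := by
      rw [hu', curveMap_apply]
    have dZ : HasFDerivAt Z (fderiv ℝ Z (curveMap V F (p, u) s))
        ((s : ℝ) • p.1, p.2 + primitiveFun g₀ s) := by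
      rw [hpt]; exact (hZ.differentiable (by simp) _).hasFDerivAt
    have d1 := dZ.comp_hasDerivAt (s : ℝ) d0
    have d2 : HasDerivAt (fun t : ℝ => Z (t • p.1, p.2 + primitiveFun g₀ t) a)
        (fderiv ℝ Z (curveMap V F (p, u) s) (p.1, g₀ s) a) s := by
      simpa using d1.clm_apply (hasDerivAt_const (s : ℝ) a)
    have d3 := (hasDerivAt_id (s : ℝ)).smul d2
    have d4 := (hasDerivAt_primitiveFun g₁ s).sub d3
    refine HasDerivAt.congr_deriv d4 ?_
    have hg₀s : g₀ s = Z (curveMap V F (p, u) s) p.1 := rfl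
    have e1 : g₁ s = Z (curveMap V F (p, u) s) a +
      fderiv ℝ Z (curveMap V F (p, u) s) ((s : ℝ) • a, 0 + U s) p.1 := rfl
    have e2 : picardIntegrandDeriv hZ (p, u) (0, y) s = Z (curveMap V F (p, u) s) 0 +
      fderiv ℝ Z (curveMap V F (p, u) s) ((s : ℝ) • 0, 0 + y s) p.1 := rfl
    -- The variation `(s a, U)` splits into the horizontal lift of `s a` and the vertical vector
    -- `(0, y)`. Integrability exchanges `a` and `p.1` in the horizontal part, which then cancels
    -- the derivative of `s Z a`.
    have e3 : ((s : ℝ) • (0 : V), (0 : F) + y s) = ((s : ℝ) • a, 0 + U s) -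
        (s : ℝ) • (a, Z (curveMap V F (p, u) s) a) := by
      rw [hy]; ext <;> simp
    rw [extendUnit_coe, e1, e2, e3, map_sub, map_smul]
    simp only [sub_apply, smul_apply, id, map_zero,
      hpt, hflat s a p.1, hg₀s, one_smul]
    abel
  have hy0 : y = 0 := by
    refine hinj y ?_
    rw [fderiv_picardMap_apply]
    ext s
    refine eq_volterra (y := Y) ?_ hYc (fun s _ => hder s) s
    simp [Y, primitiveFun]
  have := hy 1
  rw [hy0, curveMap_apply] at this
  simpa [sub_eq_zero] using this.symm

end TotalEquation

/-! ### The local Frobenius theorem -/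

section LocalSolution

open unitInterval Filter Topology

variable {V F : Type*} [NormedAddCommGroup V] [NormedSpace ℝ V] [CompleteSpace V]
  [NormedAddCommGroup F] [NormedSpace ℝ F] [CompleteSpace F]

/-- The coefficient `Z` of the total differential equation `dφ(v) = Z(v, φ(v))` satisfies the
integrability condition at `q`. -/
def IsFlatAt (Z : V × F → V →L[ℝ] F) (q : V × F) : Prop :=
  ∀ b c : V, fderiv ℝ Z q (b, Z q b) c = fderiv ℝ Z q (c, Z q c) b

/-- The curves are the solutions of `u = N(p, u)`, obtained by inverting `Ξ(p, u) = (p, u - N(p,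
u))` near `((0, x₀), 0)`. For `h = 0` the Picard integrand and its derivative in `u` vanish, so the
derivative of `Ξ` at that point is a shear. -/
theorem exists_local_solution_of_contDiff {Z : V × F → V →L[ℝ] F} (hZ : ContDiff ℝ ∞ Z) {x₀ : F}
    (hflat : ∀ᶠ q in 𝓝 ((0 : V), x₀), IsFlatAt Z q) :
    ∃ φ : V × F → F, (∀ᶠ x in 𝓝 x₀, φ (0, x) = x) ∧
      ∀ᶠ p in 𝓝 ((0 : V), x₀), ContDiffAt ℝ ∞ φ p ∧
        HasFDerivAt (fun v => φ (v, p.2)) (Z (p.1, φ p)) p.1 := by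
  set N := picardMap hZ with hN
  have hNs : ContDiff ℝ ∞ N := contDiff_picardMap hZ
  have hNd : Differentiable ℝ N := hNs.differentiable (by simp)
  let Ξ : (V × F) × C(I, F) → (V × F) × C(I, F) := fun w => (w.1, w.2 - N w)
  have hΞs : ContDiff ℝ ∞ Ξ := contDiff_fst.prodMk (contDiff_snd.sub hNs)
  have hΞd : ∀ w δ, fderiv ℝ Ξ w δ = (δ.1, δ.2 - fderiv ℝ N w δ) := by
    intro w δ
    have h := (hasFDerivAt_fst (𝕜 := ℝ) (p := w)).prodMk
      ((hasFDerivAt_snd (𝕜 := ℝ) (p := w)).sub (hNd w).hasFDerivAt)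
    have h' : fderiv ℝ Ξ w = _ := h.fderiv
    rw [h']; rfl
  have hN0 : ∀ x : F, N ((0, x), 0) = 0 := by
    intro x
    have : picardIntegrand hZ (((0 : V), x), 0) = 0 := by
      ext s; simp [picardIntegrand]
    simp [hN, picardMap, this]
  let w₀ : (V × F) × C(I, F) := ((0, x₀), 0)
  have hNw0 : ∀ y : C(I, F), fderiv ℝ N w₀ (0, y) = 0 := by
    intro y
    have : picardIntegrandDeriv hZ w₀ (0, y) = 0 := by
      ext s; simp [picardIntegrandDeriv, w₀]
    rw [hN, fderiv_picardMap_apply, this, map_zero]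
  -- `(p, u) ↦ (p, u - ∂₁N p)`: the partial derivative of `N` in `u` is zero at `w₀`.
  let e : ((V × F) × C(I, F)) ≃L[ℝ] ((V × F) × C(I, F)) :=
    ContinuousLinearEquiv.skewProd (ContinuousLinearEquiv.refl ℝ _)
      (ContinuousLinearEquiv.refl ℝ _)
      (-((fderiv ℝ N w₀).comp (ContinuousLinearMap.inl ℝ (V × F) C(I, F))))
  have he : fderiv ℝ Ξ w₀ = (e : ((V × F) × C(I, F)) →L[ℝ] ((V × F) × C(I, F))) := by
    refine ContinuousLinearMap.ext fun δ => ?_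
    rw [hΞd]
    have h1 : e δ = (δ.1, δ.2 + -(fderiv ℝ N w₀ (δ.1, 0))) := rfl
    have h2 : fderiv ℝ N w₀ δ = fderiv ℝ N w₀ (δ.1, 0) + fderiv ℝ N w₀ (0, δ.2) := by
      rw [← map_add]; simp
    change _ = e δ
    rw [h1, h2, hNw0, add_zero, sub_eq_add_neg]
  have hstrict : HasStrictFDerivAt Ξ
      (e : ((V × F) × C(I, F)) →L[ℝ] ((V × F) × C(I, F))) w₀ := by
    rw [← he]
    exact hΞs.contDiffAt.hasStrictFDerivAt (by simp)
  let f := hstrict.toOpenPartialHomeomorph Ξ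
  have hf : ∀ w, f w = Ξ w := fun w => rfl
  have hw₀s : w₀ ∈ f.source := hstrict.mem_toOpenPartialHomeomorph_source
  have hΞ0 : ∀ x : F, Ξ ((0, x), 0) = ((0, x), 0) := fun x => by simp [Ξ, hN0]
  have hw₀t : w₀ ∈ f.target := by
    have := f.map_source hw₀s
    rwa [hf, hΞ0] at this
  have hfs : f.symm w₀ = w₀ := by
    have := f.left_inv hw₀s
    rwa [hf, hΞ0] at this
  let G : V × F → (V × F) × C(I, F) := fun p => f.symm (p, 0)
  have hGc : ContinuousAt G (0, x₀) := by
    have h1 : ContinuousAt f.symm w₀ := f.continuousAt_symm hw₀t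
    exact ContinuousAt.comp (f := fun p : V × F => (p, (0 : C(I, F)))) h1 (by fun_prop)
  have hG0 : G (0, x₀) = w₀ := hfs
  have hmem : ∀ᶠ p in 𝓝 ((0 : V), x₀), (p, (0 : C(I, F))) ∈ f.target := by
    have : ContinuousAt (fun p : V × F => (p, (0 : C(I, F)))) (0, x₀) := by fun_prop
    exact this (f.open_target.mem_nhds hw₀t)
  -- Invertible operators form an open set. Invertibility at `G p`, not only at `w₀`, is used twice:
  -- for smoothness of the inverse at `(p, 0)`, and for the injectivity required by
  -- `eq_coeff_of_eq_picardMap`.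
  have hequiv : ∀ᶠ p in 𝓝 ((0 : V), x₀), fderiv ℝ Ξ (G p) ∈ range
      ((↑) : (((V × F) × C(I, F)) ≃L[ℝ] ((V × F) × C(I, F))) → _) := by
    have h1 : ContinuousAt (fun p => fderiv ℝ Ξ (G p)) (0, x₀) :=
      (hΞs.continuous_fderiv (by simp)).continuousAt.comp hGc
    refine h1 ?_
    change _ ∈ 𝓝 (fderiv ℝ Ξ (G (0, x₀)))
    rw [hG0, he]
    exact ContinuousLinearEquiv.nhds e
  have hGspec : ∀ p, (p, (0 : C(I, F))) ∈ f.target → G p = (p, (G p).2) ∧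
      (G p).2 = N (p, (G p).2) := by
    intro p hp
    have h1 : Ξ (G p) = (p, 0) := f.right_inv hp
    have h2 : (G p).1 = p := congrArg Prod.fst h1
    have h3 : (G p).2 - N (G p) = 0 := congrArg Prod.snd h1
    have h4 : G p = (p, (G p).2) := Prod.ext h2 rfl
    refine ⟨h4, ?_⟩
    rw [← h4]
    exact sub_eq_zero.1 h3
  -- Integrability is known only near `(0, x₀)`. The curve of `G p` is uniformly close to the
  -- constant curve there, so it stays in that region for all times.
  have hcurve : ∀ᶠ p in 𝓝 ((0 : V), x₀), ∀ s : I, IsFlatAt Z (curveMap V F (G p) s) := by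
    obtain ⟨r, hr, hball⟩ := Metric.eventually_nhds_iff.1 hflat
    have h1 : ContinuousAt (fun p => curveMap V F (G p)) (0, x₀) :=
      (curveMap V F).continuous.continuousAt.comp hGc
    filter_upwards [Metric.continuousAt_iff'.1 h1 r hr] with p hp s
    refine hball ?_
    have h2 := (ContinuousMap.dist_apply_le_dist (f := curveMap V F (G p))
      (g := curveMap V F (G (0, x₀))) s).trans_lt hp
    rw [hG0] at h2
    simpa [w₀] using h2
  let u : V × F → C(I, F) := fun p => (G p).2
  let ev : C(I, F) →L[ℝ] F := ContinuousMap.evalCLM ℝ (1 : I)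
  -- The solution at `v` is the endpoint of the curve over the ray from `0` to `v`.
  refine ⟨fun p => p.2 + u p 1, ?_, ?_⟩
  · have h1 : ContinuousAt (fun x : F => (((0 : V), x), (0 : C(I, F)))) x₀ := by fun_prop
    filter_upwards [h1 (f.open_source.mem_nhds hw₀s)] with x hx
    have h2 : G (0, x) = ((0, x), 0) := by
      have := f.left_inv hx
      rwa [hf, hΞ0] at this
    simp [u, h2]
  · filter_upwards [hmem.eventually_nhds, hequiv, hcurve] with p hp₁ hp₂ hp₃
    have hp₀ := hp₁.self_of_nhds
    obtain ⟨e', he'⟩ := hp₂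
    have hGs : ContDiffAt ℝ ∞ G p := by
      have h1 : ContDiffAt ℝ ∞ f.symm (p, 0) :=
        f.contDiffAt_symm (f₀' := e') hp₀ (by
          rw [he']; exact (hΞs.differentiable (by simp) _).hasFDerivAt) hΞs.contDiffAt
      exact ContDiffAt.comp (f := fun p : V × F => (p, (0 : C(I, F)))) p h1 (by fun_prop)
    have hus : ContDiffAt ℝ ∞ u p := contDiffAt_snd.comp p hGs
    have hud : HasFDerivAt u (fderiv ℝ u p) p := (hus.differentiableAt (by simp)).hasFDerivAt
    have hφs : ContDiffAt ℝ ∞ (fun p : V × F => p.2 + u p 1) p :=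
      contDiffAt_snd.add (ev.contDiff.contDiffAt.comp p hus)
    refine ⟨hφs, ?_⟩
    have hGp := (hGspec p hp₀).1
    have hU : ∀ δ, fderiv ℝ u p δ = fderiv ℝ N (p, u p) (δ, fderiv ℝ u p δ) := by
      intro δ
      have h1 : u =ᶠ[𝓝 p] fun q => N (q, u q) := by
        filter_upwards [hp₁] with q hq using (hGspec q hq).2
      have h2 : HasFDerivAt (fun q => N (q, u q))
          ((fderiv ℝ N (p, u p)).comp ((ContinuousLinearMap.id ℝ (V × F)).prod
            (fderiv ℝ u p))) p :=
        HasFDerivAt.comp (f := fun q => (q, u q)) p (hNd (p, u p)).hasFDerivAt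
          ((hasFDerivAt_id p).prodMk hud)
      have h3 := h1.fderiv_eq (𝕜 := ℝ)
      rw [h2.fderiv] at h3
      exact DFunLike.congr_fun h3 δ
    have hinj : ∀ y : C(I, F), y = fderiv ℝ N (p, u p) (0, y) → y = 0 := by
      intro y hy
      have h1 : fderiv ℝ Ξ (G p) (0, y) = 0 := by
        rw [hΞd, hGp]
        change ((0 : V × F), y - fderiv ℝ N (p, u p) (0, y)) = 0
        rw [← hy, sub_self]; rfl
      rw [← he'] at h1
      have h2 : ((0 : V × F), y) = 0 := e'.map_eq_zero_iff.1 h1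
      exact congrArg Prod.snd h2
    have hfin : ∀ a : V, fderiv ℝ u p (a, 0) 1 = Z (p.1, p.2 + u p 1) a := fun a =>
      eq_coeff_of_eq_picardMap hZ (hGspec p hp₀).2 (hU (a, 0))
        (fun s b c => by have := hp₃ s b c; rwa [hGp] at this) hinj
    have h5 : HasFDerivAt (fun v : V => p.2 + u (v, p.2) 1)
        (ev.comp ((fderiv ℝ u p).comp (ContinuousLinearMap.inl ℝ V F))) p.1 := by
      have h6 : HasFDerivAt (fun v : V => (v, p.2)) (ContinuousLinearMap.inl ℝ V F) p.1 :=
        hasFDerivAt_prodMk_left p.1 p.2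
      have h7 : HasFDerivAt u (fderiv ℝ u p) (p.1, p.2) := hud
      exact (ev.hasFDerivAt.comp p.1 (h7.comp p.1 h6)).const_add p.2
    convert h5 using 1
    ext a
    exact (hfin a).symm

/-- **Frobenius theorem** for total differential equations: if `Z` is smooth and satisfies the
integrability condition near `(v₀, x₀)`, then `dφ(·, x) = Z(·, φ(·, x))`, `φ(v₀, x) = x` has a
smooth local solution. -/
theorem exists_local_solution [FiniteDimensional ℝ V] [FiniteDimensional ℝ F]
    {Z : V × F → V →L[ℝ] F} {v₀ : V} {x₀ : F}
    (hZ : ∀ᶠ q in 𝓝 (v₀, x₀), ContDiffAt ℝ ∞ Z q) (hflat : ∀ᶠ q in 𝓝 (v₀, x₀), IsFlatAt Z q) :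
    ∃ φ : V × F → F, (∀ᶠ x in 𝓝 x₀, φ (v₀, x) = x) ∧
      ∀ᶠ p in 𝓝 (v₀, x₀), ContDiffAt ℝ ∞ φ p ∧
        HasFDerivAt (fun v => φ (v, p.2)) (Z (p.1, φ p)) p.1 := by
  obtain ⟨r, hr, hball⟩ := Metric.eventually_nhds_iff_ball.1 hZ
  -- The outer radius `r / 2` keeps the support inside the ball where `Z` is smooth. The cut-off
  -- coefficient is integrable only near the base point, which is all that is required above.
  let χ : ContDiffBump (v₀, x₀) := ⟨r / 4, r / 2, by linarith, by linarith⟩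
  let Z₁ : V × F → V →L[ℝ] F := fun q => χ q • Z q
  have hZ₁ : ContDiff ℝ ∞ Z₁ := by
    rw [contDiff_iff_contDiffAt]
    intro q
    by_cases hq : q ∈ Metric.ball (v₀, x₀) r
    · exact χ.contDiff.contDiffAt.smul (hball q hq)
    · have h1 : q ∉ tsupport χ := by
        rw [χ.tsupport_eq]
        intro h
        refine hq (Metric.closedBall_subset_ball ?_ h)
        change r / 2 < r
        linarith
      have h2 : Z₁ =ᶠ[𝓝 q] fun _ => 0 := by
        filter_upwards [notMem_tsupport_iff_eventuallyEq.1 h1] with y hy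
        simp [Z₁, hy]
      exact contDiffAt_const.congr_of_eventuallyEq h2
  have heq : Z₁ =ᶠ[𝓝 (v₀, x₀)] Z := by
    filter_upwards [χ.eventuallyEq_one] with q hq
    simp [Z₁, hq]
  -- Only the variable in `V` needs to be centred, since the rays start at `0 : V`.
  let τ : V × F → V × F := fun q => (v₀ + q.1, q.2)
  have hτ : ContDiff ℝ ∞ τ := by fun_prop
  have hτ0 : Tendsto τ (𝓝 (0, x₀)) (𝓝 (v₀, x₀)) := by
    have := hτ.continuous.tendsto (0, x₀)
    simpa [τ] using this
  have hZ₂ : ContDiff ℝ ∞ (fun q => Z₁ (τ q)) := hZ₁.comp hτ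
  have hτd : ∀ q, HasFDerivAt τ (ContinuousLinearMap.id ℝ (V × F)) q := fun q =>
    (((hasFDerivAt_fst (𝕜 := ℝ) (p := q)).const_add v₀).prodMk
      (hasFDerivAt_snd (𝕜 := ℝ) (p := q)))
  have hflat₂ : ∀ᶠ q in 𝓝 ((0 : V), x₀), IsFlatAt (fun q => Z₁ (τ q)) q := by
    filter_upwards [hτ0.eventually hflat, hτ0.eventually heq.eventually_nhds] with q h1 h2 b c
    have h3 : fderiv ℝ (fun q => Z₁ (τ q)) q = fderiv ℝ Z (τ q) := by
      rw [← Filter.EventuallyEq.fderiv_eq h2]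
      have := ((hZ₁.differentiable (by simp) (τ q)).hasFDerivAt.comp q (hτd q)).fderiv
      rwa [ContinuousLinearMap.comp_id] at this
    have h4 : Z₁ (τ q) = Z (τ q) := h2.self_of_nhds
    have h5 := h1 b c
    rw [← h4] at h5
    rw [h3]
    exact h5
  obtain ⟨φ, hφ0, hφ⟩ := exists_local_solution_of_contDiff hZ₂ hflat₂
  let θ : V × F → V × F := fun q => (q.1 - v₀, q.2)
  have hθ : ContDiff ℝ ∞ θ := by fun_prop
  have hθ0 : Tendsto θ (𝓝 (v₀, x₀)) (𝓝 (0, x₀)) := by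
    have := hθ.continuous.tendsto (v₀, x₀)
    simpa [θ] using this
  refine ⟨fun p => φ (θ p), ?_, ?_⟩
  · filter_upwards [hφ0] with x hx
    simpa [θ] using hx
  · have hc : Tendsto (fun p : V × F => (p.1, φ (θ p))) (𝓝 (v₀, x₀)) (𝓝 (v₀, x₀)) := by
      have h1 : ContinuousAt φ (0, x₀) := hφ.self_of_nhds.1.continuousAt
      have h2 : Tendsto φ (𝓝 (0, x₀)) (𝓝 x₀) := by
        have := h1.tendsto
        rwa [hφ0.self_of_nhds] at this
      exact (continuous_fst.tendsto' (v₀, x₀) v₀ rfl).prodMk_nhds (h2.comp hθ0)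
    filter_upwards [hθ0.eventually hφ, hc.eventually heq] with p h1 h2
    refine ⟨ContDiffAt.comp p h1.1 hθ.contDiffAt, ?_⟩
    have h3 : HasFDerivAt (fun v : V => v - v₀) (ContinuousLinearMap.id ℝ V) p.1 :=
      (hasFDerivAt_id p.1).sub_const v₀
    have h4 := HasFDerivAt.comp p.1 h1.2 h3
    have h5 : Z₁ (τ ((θ p).1, φ (θ p))) = Z (p.1, φ (θ p)) := by
      rw [← h2]; simp [τ, θ]
    rw [h5] at h4
    exact h4

end LocalSolution

/-! ### Functions, vector fields and brackets in charts -/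

section Chart

theorem minSmoothness_le_infty (n : ℕ) : minSmoothness ℝ n ≤ ∞ := by
  rw [minSmoothness_of_isRCLikeNormedField]
  exact_mod_cast le_top

open Filter Topology

variable {E : Type*} [NormedAddCommGroup E] [NormedSpace ℝ E]
  {M : Type*} [TopologicalSpace M] [ChartedSpace E M] [IsManifold 𝓘(ℝ, E) ∞ M]
  {F : Type*} [NormedAddCommGroup F] [NormedSpace ℝ F]

/-- The derivative of the chart at `x₀`, through the trivialization of the tangent bundle. -/
def chartDeriv (x₀ m : M) : TangentSpace 𝓘(ℝ, E) m →L[ℝ] E :=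
  (trivializationAt E (TangentSpace 𝓘(ℝ, E)) x₀).continuousLinearMapAt ℝ m

/-- The derivative of the inverse of the chart at `x₀`. -/
def chartInv (x₀ m : M) : E →L[ℝ] TangentSpace 𝓘(ℝ, E) m :=
  (trivializationAt E (TangentSpace 𝓘(ℝ, E)) x₀).symmL ℝ m

variable {x₀ m : M}

theorem chartDeriv_chartInv (hm : m ∈ (chartAt E x₀).source) (v : E) :
    chartDeriv x₀ m (chartInv x₀ m v) = v :=
  Trivialization.continuousLinearMapAt_symmL _ (by simpa using hm) v

theorem chartInv_chartDeriv (hm : m ∈ (chartAt E x₀).source) (v : TangentSpace 𝓘(ℝ, E) m) :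
    chartInv x₀ m (chartDeriv x₀ m v) = v :=
  Trivialization.symmL_continuousLinearMapAt _ (by simpa using hm) v

theorem chartDeriv_eq_mfderiv (hm : m ∈ (chartAt E x₀).source) :
    chartDeriv x₀ m = mfderiv 𝓘(ℝ, E) 𝓘(ℝ, E) (extChartAt 𝓘(ℝ, E) x₀) m :=
  TangentBundle.continuousLinearMapAt_trivializationAt hm

theorem chartInv_eq_mfderiv (hm : m ∈ (chartAt E x₀).source) :
    (chartInv (E := E) x₀ m : E →L[ℝ] E) =
      (mfderiv 𝓘(ℝ, E) 𝓘(ℝ, E) (extChartAt 𝓘(ℝ, E) x₀).symm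
        (extChartAt 𝓘(ℝ, E) x₀ m) : E →L[ℝ] E) := by
  have := TangentBundle.symmL_trivializationAt (I := 𝓘(ℝ, E)) hm
  simp only [modelWithCornersSelf_coe, range_id, mfderivWithin_univ] at this
  exact this

theorem chartDeriv_self (x₀ : M) : chartDeriv x₀ x₀ = ContinuousLinearMap.id ℝ E := by
  rw [chartDeriv_eq_mfderiv (mem_chart_source E x₀)]
  exact mfderiv_extChartAt_self

theorem chart_symm_mem (hm : m ∈ (chartAt E x₀).source) :
    (extChartAt 𝓘(ℝ, E) x₀).symm (extChartAt 𝓘(ℝ, E) x₀ m) = m :=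
  (extChartAt 𝓘(ℝ, E) x₀).left_inv (by simpa using hm)

theorem isOpen_chart_target (x₀ : M) : IsOpen (extChartAt 𝓘(ℝ, E) x₀).target :=
  isOpen_extChartAt_target x₀

theorem chart_mem_target (hm : m ∈ (chartAt E x₀).source) :
    extChartAt 𝓘(ℝ, E) x₀ m ∈ (extChartAt 𝓘(ℝ, E) x₀).target :=
  (extChartAt 𝓘(ℝ, E) x₀).map_source (by simpa using hm)

theorem symm_mem_source {v : E} (hv : v ∈ (extChartAt 𝓘(ℝ, E) x₀).target) :
    (extChartAt 𝓘(ℝ, E) x₀).symm v ∈ (chartAt E x₀).source := by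
  simpa using (extChartAt 𝓘(ℝ, E) x₀).map_target hv

theorem contMDiffAt_chart_symm {v : E} (hv : v ∈ (extChartAt 𝓘(ℝ, E) x₀).target) :
    ContMDiffAt 𝓘(ℝ, E) 𝓘(ℝ, E) ∞ (extChartAt 𝓘(ℝ, E) x₀).symm v :=
  (contMDiffOn_extChartAt_symm x₀).contMDiffAt ((isOpen_chart_target x₀).mem_nhds hv)

theorem contMDiffAt_chart (hm : m ∈ (chartAt E x₀).source) :
    ContMDiffAt 𝓘(ℝ, E) 𝓘(ℝ, E) ∞ (extChartAt 𝓘(ℝ, E) x₀) m :=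
  contMDiffAt_extChartAt' hm

/-- The expression of a function in the chart at `x₀`. -/
abbrev inChart (E : Type*) [NormedAddCommGroup E] [NormedSpace ℝ E]
    {M : Type*} [TopologicalSpace M] [ChartedSpace E M] {F : Type*} (x₀ : M) (f : M → F) : E → F :=
  fun v => f ((extChartAt 𝓘(ℝ, E) x₀).symm v)

theorem contMDiffAt_iff_inChart {f : M → F} (hm : m ∈ (chartAt E x₀).source) :
    ContMDiffAt 𝓘(ℝ, E) 𝓘(ℝ, F) ∞ f m ↔
      ContDiffAt ℝ ∞ (inChart E x₀ f) (extChartAt 𝓘(ℝ, E) x₀ m) := by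
  rw [← contMDiffAt_iff_contDiffAt]
  constructor
  · intro h
    exact ContMDiffAt.comp_of_eq (f := (extChartAt 𝓘(ℝ, E) x₀).symm) h
      (contMDiffAt_chart_symm (chart_mem_target hm)) (chart_symm_mem hm)
  · intro h
    have h1 := h.comp m (contMDiffAt_chart hm)
    refine h1.congr_of_eventuallyEq ?_
    filter_upwards [(chartAt E x₀).open_source.mem_nhds hm] with y hy
    simp only [Function.comp, inChart, chart_symm_mem hy]

theorem chart_right_inv {v : E} (hv : v ∈ (extChartAt 𝓘(ℝ, E) x₀).target) :
    extChartAt 𝓘(ℝ, E) x₀ ((extChartAt 𝓘(ℝ, E) x₀).symm v) = v :=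
  (extChartAt 𝓘(ℝ, E) x₀).right_inv hv

theorem chartInv_symm_eq_mfderiv {v : E} (hv : v ∈ (extChartAt 𝓘(ℝ, E) x₀).target) :
    (chartInv (E := E) x₀ ((extChartAt 𝓘(ℝ, E) x₀).symm v) : E →L[ℝ] E) =
      (mfderiv 𝓘(ℝ, E) 𝓘(ℝ, E) (extChartAt 𝓘(ℝ, E) x₀).symm v : E →L[ℝ] E) := by
  have h := chartInv_eq_mfderiv (E := E) (x₀ := x₀) (symm_mem_source hv)
  -- The base points are only propositionally equal, so the tangent spaces cannot be rewritten
  -- directly; the statement is generalised over the base point and closed by substitution. The same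
  -- device recurs whenever a base point simplifies.
  have h' : ∀ u, u = v → (chartInv (E := E) x₀ ((extChartAt 𝓘(ℝ, E) x₀).symm v) : E →L[ℝ] E) =
      (mfderiv 𝓘(ℝ, E) 𝓘(ℝ, E) (extChartAt 𝓘(ℝ, E) x₀).symm u : E →L[ℝ] E) →
      (chartInv (E := E) x₀ ((extChartAt 𝓘(ℝ, E) x₀).symm v) : E →L[ℝ] E) =
      (mfderiv 𝓘(ℝ, E) 𝓘(ℝ, E) (extChartAt 𝓘(ℝ, E) x₀).symm v : E →L[ℝ] E) := by
    rintro u rfl h; exact h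
  exact h' _ (chart_right_inv hv) h

theorem fderiv_inChart {f : M → F} {v : E} (hv : v ∈ (extChartAt 𝓘(ℝ, E) x₀).target)
    (hf : MDifferentiableAt 𝓘(ℝ, E) 𝓘(ℝ, F) f ((extChartAt 𝓘(ℝ, E) x₀).symm v)) (w : E) :
    fderiv ℝ (inChart E x₀ f) v w = mvfderiv 𝓘(ℝ, E) f ((extChartAt 𝓘(ℝ, E) x₀).symm v)
      (chartInv x₀ ((extChartAt 𝓘(ℝ, E) x₀).symm v) w) := by
  have hs : MDifferentiableAt 𝓘(ℝ, E) 𝓘(ℝ, E) (extChartAt 𝓘(ℝ, E) x₀).symm v :=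
    (contMDiffAt_chart_symm hv).mdifferentiableAt (by simp)
  have h1 : mfderiv 𝓘(ℝ, E) 𝓘(ℝ, F) (inChart E x₀ f) v =
      (mfderiv 𝓘(ℝ, E) 𝓘(ℝ, F) f ((extChartAt 𝓘(ℝ, E) x₀).symm v)).comp
        (mfderiv 𝓘(ℝ, E) 𝓘(ℝ, E) (extChartAt 𝓘(ℝ, E) x₀).symm v) :=
    mfderiv_comp v hf hs
  have h2 : fderiv ℝ (inChart E x₀ f) v =
      mfderiv 𝓘(ℝ, E) 𝓘(ℝ, F) (inChart E x₀ f) v := mfderiv_eq_fderiv.symm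
  rw [h2, h1]
  have h3 := DFunLike.congr_fun (chartInv_symm_eq_mfderiv hv) w
  change mfderiv 𝓘(ℝ, E) 𝓘(ℝ, F) f ((extChartAt 𝓘(ℝ, E) x₀).symm v)
    ((mfderiv 𝓘(ℝ, E) 𝓘(ℝ, E) (extChartAt 𝓘(ℝ, E) x₀).symm v : E →L[ℝ] E) w) = _
  exact congrArg (fun u : E => (mfderiv 𝓘(ℝ, E) 𝓘(ℝ, F) f
    ((extChartAt 𝓘(ℝ, E) x₀).symm v) : E →L[ℝ] F) u) h3.symm

theorem mvfderiv_eq_fderiv_inChart {f : M → F} (hm : m ∈ (chartAt E x₀).source)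
    (hf : MDifferentiableAt 𝓘(ℝ, E) 𝓘(ℝ, F) f m) (w : TangentSpace 𝓘(ℝ, E) m) :
    mvfderiv 𝓘(ℝ, E) f m w =
      fderiv ℝ (inChart E x₀ f) (extChartAt 𝓘(ℝ, E) x₀ m) (chartDeriv x₀ m w) := by
  obtain ⟨v, hv, rfl⟩ : ∃ v ∈ (extChartAt 𝓘(ℝ, E) x₀).target,
      (extChartAt 𝓘(ℝ, E) x₀).symm v = m := ⟨_, chart_mem_target hm, chart_symm_mem hm⟩
  rw [chart_right_inv hv, fderiv_inChart hv hf, chartInv_chartDeriv hm]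

/-- The expression of a vector field in the chart at `x₀`. -/
def fieldInChart (x₀ : M) (X : VField E M) : E → E := fun v =>
  chartDeriv x₀ ((extChartAt 𝓘(ℝ, E) x₀).symm v) (X ((extChartAt 𝓘(ℝ, E) x₀).symm v))

theorem fieldInChart_chart (X : VField E M) (hm : m ∈ (chartAt E x₀).source) :
    fieldInChart x₀ X (extChartAt 𝓘(ℝ, E) x₀ m) = chartDeriv x₀ m (X m) := by
  rw [fieldInChart, chart_symm_mem hm]

/-- Smoothness at a point of a vector field. -/
abbrev SmoothVFieldAt (X : VField E M) (m : M) : Prop :=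
  ContMDiffAt 𝓘(ℝ, E) (𝓘(ℝ, E).prod 𝓘(ℝ, E)) ∞
    (fun m => (⟨m, X m⟩ : TangentBundle 𝓘(ℝ, E) M)) m

theorem SmoothVField.smoothVFieldAt {X : VField E M} (hX : SmoothVField X) (m : M) :
    SmoothVFieldAt X m := hX m

theorem smoothVFieldAt_iff {X : VField E M} (hm : m ∈ (chartAt E x₀).source) :
    SmoothVFieldAt X m ↔
      ContDiffAt ℝ ∞ (fieldInChart x₀ X) (extChartAt 𝓘(ℝ, E) x₀ m) := by
  have h1 := (trivializationAt E (TangentSpace 𝓘(ℝ, E)) x₀).contMDiffAt_section_iff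
    (IB := 𝓘(ℝ, E)) (n := ∞) (s := X) (x₀ := m) (by simpa using hm)
  rw [SmoothVFieldAt, h1]
  have h2 : ContMDiffAt 𝓘(ℝ, E) 𝓘(ℝ, E) ∞
      (fun x => (trivializationAt E (TangentSpace 𝓘(ℝ, E)) x₀ ⟨x, X x⟩).2) m ↔
      ContMDiffAt 𝓘(ℝ, E) 𝓘(ℝ, E) ∞ (fun x => chartDeriv x₀ x (X x)) m := by
    refine Filter.EventuallyEq.contMDiffAt_iff ?_
    filter_upwards [(chartAt E x₀).open_source.mem_nhds hm] with y hy
    have hy' : y ∈ (trivializationAt E (TangentSpace 𝓘(ℝ, E)) x₀).baseSet := by simpa using hy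
    rw [chartDeriv, Trivialization.continuousLinearMapAt_apply,
      Trivialization.coe_linearMapAt_of_mem _ hy']
  rw [h2, contMDiffAt_iff_inChart hm]
  rfl


theorem mlieBracket_eq_lieBracket {V W : ∀ x : E, TangentSpace 𝓘(ℝ, E) x} {x : E} :
    mlieBracket 𝓘(ℝ, E) V W x = lieBracket ℝ V W x := by
  rw [← mlieBracketWithin_univ, mlieBracketWithin_eq_lieBracketWithin]
  exact congrFun lieBracketWithin_univ x

/-- The chart expression of a field is its pullback by the inverse chart, and pullback commutes with
the Lie bracket. -/
theorem fieldInChart_mlieBracket [CompleteSpace E] {X Y : VField E M} {v : E}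
    (hv : v ∈ (extChartAt 𝓘(ℝ, E) x₀).target)
    (hX : SmoothVFieldAt X ((extChartAt 𝓘(ℝ, E) x₀).symm v))
    (hY : SmoothVFieldAt Y ((extChartAt 𝓘(ℝ, E) x₀).symm v)) :
    fieldInChart x₀ (mlieBracket 𝓘(ℝ, E) X Y) v =
      lieBracket ℝ (fieldInChart x₀ X) (fieldInChart x₀ Y) v := by
  have key : ∀ Z : VField E M, ∀ u ∈ (extChartAt 𝓘(ℝ, E) x₀).target,
      mpullback 𝓘(ℝ, E) 𝓘(ℝ, E) (extChartAt 𝓘(ℝ, E) x₀).symm Z u = fieldInChart x₀ Z u := by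
    intro Z u hu
    have hs := symm_mem_source hu
    have h1 : (mfderiv 𝓘(ℝ, E) 𝓘(ℝ, E) (extChartAt 𝓘(ℝ, E) x₀).symm u : E →L[ℝ] E).inverse =
        (chartDeriv x₀ ((extChartAt 𝓘(ℝ, E) x₀).symm u) : E →L[ℝ] E) := by
      rw [← chartInv_symm_eq_mfderiv hu]
      refine ContinuousLinearMap.inverse_eq ?_ ?_
      · exact ContinuousLinearMap.ext fun w => chartInv_chartDeriv hs w
      · exact ContinuousLinearMap.ext fun w => chartDeriv_chartInv hs w
    exact DFunLike.congr_fun h1 (Z ((extChartAt 𝓘(ℝ, E) x₀).symm u) : E)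
  have : IsManifold 𝓘(ℝ, E) (minSmoothness ℝ 2) M :=
    IsManifold.of_le (n := ∞) (minSmoothness_le_infty 2)
  have : IsManifold 𝓘(ℝ, E) (minSmoothness ℝ 3) M :=
    IsManifold.of_le (n := ∞) (minSmoothness_le_infty 3)
  have h2 := mpullback_mlieBracket (I := 𝓘(ℝ, E)) (I' := 𝓘(ℝ, E)) (n := ∞)
    (hX.mdifferentiableAt (by simp)) (hY.mdifferentiableAt (by simp))
    (contMDiffAt_chart_symm hv) (minSmoothness_le_infty 2)
  have hev : ∀ Z : VField E M, mpullback 𝓘(ℝ, E) 𝓘(ℝ, E) (extChartAt 𝓘(ℝ, E) x₀).symm Z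
      =ᶠ[𝓝 v] fieldInChart x₀ Z := fun Z => by
    filter_upwards [(isOpen_chart_target x₀).mem_nhds hv] with u hu using key Z u hu
  have h5 : mlieBracket 𝓘(ℝ, E) (fieldInChart x₀ X) (fieldInChart x₀ Y) v =
      lieBracket ℝ (fieldInChart x₀ X) (fieldInChart x₀ Y) v :=
    mlieBracket_eq_lieBracket
  exact (key _ v hv).symm.trans (h2.trans
    ((Filter.EventuallyEq.mlieBracket_vectorField_eq (hev X) (hev Y)).trans h5))

/-- The Lie bracket as a commutator of derivations. -/
theorem mvfderiv_mlieBracket [CompleteSpace E] {X Y : VField E M} {f : M → F} {m : M}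
    (hX : SmoothVFieldAt X m) (hY : SmoothVFieldAt Y m) (hf : ContMDiffAt 𝓘(ℝ, E) 𝓘(ℝ, F) ∞ f m) :
    mvfderiv 𝓘(ℝ, E) f m (mlieBracket 𝓘(ℝ, E) X Y m) =
      mvfderiv 𝓘(ℝ, E) (fun p => mvfderiv 𝓘(ℝ, E) f p (Y p)) m (X m) -
        mvfderiv 𝓘(ℝ, E) (fun p => mvfderiv 𝓘(ℝ, E) f p (X p)) m (Y m) := by
  have hm := mem_chart_source E m
  set e := extChartAt 𝓘(ℝ, E) m with he
  have ht : e m ∈ e.target := chart_mem_target hm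
  have hsm : e.symm (e m) = m := chart_symm_mem hm
  set x := fieldInChart m X with hx
  set y := fieldInChart m Y with hy
  set g := inChart E m f with hg
  have hg' : ContDiffAt ℝ ∞ g (e m) := (contMDiffAt_iff_inChart hm).1 hf
  have hx' : ContDiffAt ℝ ∞ x (e m) := (smoothVFieldAt_iff hm).1 hX
  have hy' : ContDiffAt ℝ ∞ y (e m) := (smoothVFieldAt_iff hm).1 hY
  have hfd : ∀ᶠ p in 𝓝 m, MDifferentiableAt 𝓘(ℝ, E) 𝓘(ℝ, F) f p := by
    have h1 : ContMDiffAt 𝓘(ℝ, E) 𝓘(ℝ, F) 1 f m := hf.of_le (by simp)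
    filter_upwards [(contMDiffAt_iff_contMDiffAt_nhds (by simp)).1 h1] with p hp
    exact hp.mdifferentiableAt (by simp)
  have key : ∀ Z : VField E M, SmoothVFieldAt Z m → ∀ w : TangentSpace 𝓘(ℝ, E) m,
      mvfderiv 𝓘(ℝ, E) (fun p => mvfderiv 𝓘(ℝ, E) f p (Z p)) m w =
      fderiv ℝ (fun v => fderiv ℝ g v (fieldInChart m Z v)) (e m) (chartDeriv m m w) := by
    intro Z hZ w
    have hz' : ContDiffAt ℝ ∞ (fieldInChart m Z) (e m) := (smoothVFieldAt_iff hm).1 hZ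
    have hc : ContDiffAt ℝ ∞ (fun v => fderiv ℝ g v (fieldInChart m Z v)) (e m) :=
      (hg'.fderiv_right (by simp)).clm_apply hz'
    have heq : inChart E m (fun p => mvfderiv 𝓘(ℝ, E) f p (Z p)) =ᶠ[𝓝 (e m)]
        fun v => fderiv ℝ g v (fieldInChart m Z v) := by
      have h1 : Tendsto e.symm (𝓝 (e m)) (𝓝 m) := by
        have := (contMDiffAt_chart_symm ht).continuousAt.tendsto
        rwa [hsm] at this
      filter_upwards [h1.eventually hfd, (isOpen_chart_target m).mem_nhds ht] with v hv1 hv2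
      rw [fderiv_inChart hv2 hv1, fieldInChart, chartInv_chartDeriv (symm_mem_source hv2)]
    have hd : MDifferentiableAt 𝓘(ℝ, E) 𝓘(ℝ, F) (fun p => mvfderiv 𝓘(ℝ, E) f p (Z p)) m :=
      ((contMDiffAt_iff_inChart hm).2 (hc.congr_of_eventuallyEq heq)).mdifferentiableAt (by simp)
    rw [mvfderiv_eq_fderiv_inChart hm hd, heq.fderiv_eq]
  have hfm : MDifferentiableAt 𝓘(ℝ, E) 𝓘(ℝ, F) f m := hf.mdifferentiableAt (by simp)
  rw [key X hX, key Y hY, mvfderiv_eq_fderiv_inChart hm hfm]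
  have hb := fieldInChart_mlieBracket (x₀ := m) (X := X) (Y := Y) ht
    (by rwa [← he, hsm]) (by rwa [← he, hsm])
  rw [← fieldInChart_chart _ hm, ← fieldInChart_chart _ hm, ← fieldInChart_chart _ hm, hb]
  have hgd : DifferentiableAt ℝ (fderiv ℝ g) (e m) :=
    (hg'.fderiv_right (m := ∞) (by simp)).differentiableAt (by simp)
  have hd : ∀ z : E → E, ContDiffAt ℝ ∞ z (e m) → ∀ w,
      fderiv ℝ (fun v => fderiv ℝ g v (z v)) (e m) w =
        fderiv ℝ (fderiv ℝ g) (e m) w (z (e m)) + fderiv ℝ g (e m) (fderiv ℝ z (e m) w) := by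
    intro z hz w
    rw [fderiv_clm_apply hgd (hz.differentiableAt (by simp))]
    simp [add_comm]
  -- In the chart both iterated derivatives expand by the product rule; their second-order terms
  -- cancel by symmetry, leaving `dg` applied to the bracket.
  have hsym : IsSymmSndFDerivAt ℝ g (e m) := hg'.isSymmSndFDerivAt (minSmoothness_le_infty 2)
  rw [hd _ hx', hd _ hy', lieBracket, map_sub]
  change _ = fderiv ℝ (fderiv ℝ g) (e m) (x (e m)) (y (e m)) + _ -
    (fderiv ℝ (fderiv ℝ g) (e m) (y (e m)) (x (e m)) + _)
  rw [hsym.eq (x (e m)) (y (e m))]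
  abel

end Chart

/-! ### Local uniqueness for total differential equations -/

section EuclideanUniqueness

open Filter Topology

/-- On each segment from `v₀` with direction `h` both functions solve the same ordinary differential
equation. If `K` is a Lipschitz constant of `Z` near the base point, the right-hand side has
constant `K ‖h‖`, and the graphs stay in the Lipschitz region by continuity. No integrability is
needed. -/
theorem eventuallyEq_of_hasFDerivAt {V F : Type*} [NormedAddCommGroup V] [NormedSpace ℝ V]
    [NormedAddCommGroup F] [NormedSpace ℝ F] {Z : V × F → V →L[ℝ] F} {f₁ f₂ : V → F} {v₀ : V}
    (hZ : ContDiffAt ℝ 1 Z (v₀, f₁ v₀))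
    (h₁ : ∀ᶠ v in 𝓝 v₀, HasFDerivAt f₁ (Z (v, f₁ v)) v)
    (h₂ : ∀ᶠ v in 𝓝 v₀, HasFDerivAt f₂ (Z (v, f₂ v)) v) (h₀ : f₁ v₀ = f₂ v₀) :
    f₁ =ᶠ[𝓝 v₀] f₂ := by
  obtain ⟨K, s, hs, hK⟩ := hZ.exists_lipschitzOnWith
  have c₁ : Tendsto (fun v => (v, f₁ v)) (𝓝 v₀) (𝓝 (v₀, f₁ v₀)) :=
    tendsto_id.prodMk_nhds h₁.self_of_nhds.continuousAt.tendsto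
  have c₂ : Tendsto (fun v => (v, f₂ v)) (𝓝 v₀) (𝓝 (v₀, f₁ v₀)) := by
    rw [h₀]
    exact tendsto_id.prodMk_nhds h₂.self_of_nhds.continuousAt.tendsto
  obtain ⟨r, hr, hball⟩ := Metric.eventually_nhds_iff_ball.1
    ((h₁.and h₂).and ((c₁.eventually hs).and (c₂.eventually hs)))
  filter_upwards [Metric.ball_mem_nhds v₀ hr] with v hv
  set h := v - v₀ with hh
  have hseg : ∀ t ∈ Icc (0 : ℝ) 1, v₀ + t • h ∈ Metric.ball v₀ r := by
    intro t ht
    rw [mem_ball_iff_norm, add_sub_cancel_left, norm_smul, Real.norm_of_nonneg ht.1]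
    rw [mem_ball_iff_norm] at hv
    nlinarith [norm_nonneg h, ht.2]
  have hcurve : ∀ t : ℝ, HasDerivAt (fun t : ℝ => v₀ + t • h) h t := fun t => by
    simpa using ((hasDerivAt_id t).smul_const h).const_add v₀
  have hd₁ : ∀ t ∈ Icc (0 : ℝ) 1, HasDerivAt (fun t : ℝ => f₁ (v₀ + t • h))
      (Z (v₀ + t • h, f₁ (v₀ + t • h)) h) t := fun t ht =>
    (hball _ (hseg t ht)).1.1.comp_hasDerivAt t (hcurve t)
  have hd₂ : ∀ t ∈ Icc (0 : ℝ) 1, HasDerivAt (fun t : ℝ => f₂ (v₀ + t • h))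
      (Z (v₀ + t • h, f₂ (v₀ + t • h)) h) t := fun t ht =>
    (hball _ (hseg t ht)).1.2.comp_hasDerivAt t (hcurve t)
  have hu := ODE_solution_unique_of_mem_Icc_right (a := 0) (b := 1) (K := K * ‖h‖₊)
    (v := fun t x => Z (v₀ + t • h, x) h) (s := fun t => {x | (v₀ + t • h, x) ∈ s})
    (f := fun t : ℝ => f₁ (v₀ + t • h)) (g := fun t : ℝ => f₂ (v₀ + t • h))
    (fun t ht => by
      refine LipschitzOnWith.of_dist_le_mul fun x hx y hy => ?_
      have h3 := hK.dist_le_mul _ hx _ hy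
      rw [dist_eq_norm] at h3 ⊢
      have h4 := ((Z (v₀ + t • h, x) - Z (v₀ + t • h, y)).le_opNorm h)
      have h5 : dist (v₀ + t • h, x) (v₀ + t • h, y) = dist x y := by simp [Prod.dist_eq]
      rw [h5] at h3
      calc _ = ‖(Z (v₀ + t • h, x) - Z (v₀ + t • h, y)) h‖ := by rw [sub_apply]
        _ ≤ _ := h4
        _ ≤ (K * dist x y) * ‖h‖ := by gcongr
        _ = _ := by push_cast; ring)
    (fun t ht => (hd₁ t ht).continuousAt.continuousWithinAt)
    (fun t ht => (hd₁ t ⟨ht.1, ht.2.le⟩).hasDerivWithinAt)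
    (fun t ht => (hball _ (hseg t ⟨ht.1, ht.2.le⟩)).2.1)
    (fun t ht => (hd₂ t ht).continuousAt.continuousWithinAt)
    (fun t ht => (hd₂ t ⟨ht.1, ht.2.le⟩).hasDerivWithinAt)
    (fun t ht => (hball _ (hseg t ⟨ht.1, ht.2.le⟩)).2.2)
    (by simpa using h₀)
  have := hu (right_mem_Icc.2 zero_le_one)
  simpa [hh] using this

end EuclideanUniqueness

/-! ### Total differential equations on manifolds -/

section ManifoldEquation

open Filter Topology

variable {V : Type*} [NormedAddCommGroup V] [NormedSpace ℝ V]
  {B : Type*} [TopologicalSpace B] [ChartedSpace V B] [IsManifold 𝓘(ℝ, V) ∞ B]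
  {F : Type*} [NormedAddCommGroup F] [NormedSpace ℝ F]
  {N : Type*} [TopologicalSpace N] [ChartedSpace F N] [IsManifold 𝓘(ℝ, F) ∞ N]

variable (V B F N) in
/-- Right-hand sides of total differential equations `df_b = Z(b, f(b))`. -/
abbrev TotalEquation : Type _ :=
  ∀ (b : B) (y : N), TangentSpace 𝓘(ℝ, V) b →L[ℝ] TangentSpace 𝓘(ℝ, F) y

variable (Z : TotalEquation V B F N)

/-- `f` solves `df = Z(·, f)` at `b`. -/
def SolvesAt (f : B → N) (b : B) : Prop :=
  MDifferentiableAt 𝓘(ℝ, V) 𝓘(ℝ, F) f b ∧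
    ∀ w, mfderiv 𝓘(ℝ, V) 𝓘(ℝ, F) f b w = Z b (f b) w

/-- The expression of a total differential equation in charts. -/
def equationInChart (b₀ : B) (y₀ : N) : V × F → V →L[ℝ] F := fun p =>
  (chartDeriv y₀ ((extChartAt 𝓘(ℝ, F) y₀).symm p.2)).comp
    ((Z ((extChartAt 𝓘(ℝ, V) b₀).symm p.1) ((extChartAt 𝓘(ℝ, F) y₀).symm p.2)).comp
      (chartInv b₀ ((extChartAt 𝓘(ℝ, V) b₀).symm p.1)))

variable {Z} {b₀ : B} {y₀ : N}

theorem SolvesAt.congr {f g : B → N} {b : B} (hf : SolvesAt Z f b) (h : f =ᶠ[𝓝 b] g) :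
    SolvesAt Z g b := by
  refine ⟨hf.1.congr_of_eventuallyEq h.symm, fun w => ?_⟩
  have h1 : (mfderiv 𝓘(ℝ, V) 𝓘(ℝ, F) f b : V →L[ℝ] F) = mfderiv 𝓘(ℝ, V) 𝓘(ℝ, F) g b :=
    h.mfderiv_eq
  have h2 := hf.2 w
  have h3 : ∀ y y', y = y' → (Z b y w : F) = (Z b y' w : F) := by rintro y _ rfl; rfl
  exact (DFunLike.congr_fun h1 w).symm.trans (h2.trans (h3 _ _ h.self_of_nhds))

theorem SolvesAt.hasFDerivAt_inChart {f : B → N} {v : V}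
    (hv : v ∈ (extChartAt 𝓘(ℝ, V) b₀).target)
    (hf : SolvesAt Z f ((extChartAt 𝓘(ℝ, V) b₀).symm v))
    (hy : f ((extChartAt 𝓘(ℝ, V) b₀).symm v) ∈ (chartAt F y₀).source) :
    HasFDerivAt (fun v => extChartAt 𝓘(ℝ, F) y₀ (f ((extChartAt 𝓘(ℝ, V) b₀).symm v)))
      (equationInChart Z b₀ y₀
        (v, extChartAt 𝓘(ℝ, F) y₀ (f ((extChartAt 𝓘(ℝ, V) b₀).symm v)))) v := by
  set b := (extChartAt 𝓘(ℝ, V) b₀).symm v with hb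
  have h1 : HasMFDerivAt 𝓘(ℝ, V) 𝓘(ℝ, V) (extChartAt 𝓘(ℝ, V) b₀).symm v
      (mfderiv 𝓘(ℝ, V) 𝓘(ℝ, V) (extChartAt 𝓘(ℝ, V) b₀).symm v) :=
    ((contMDiffAt_chart_symm hv).mdifferentiableAt (by simp)).hasMFDerivAt
  have h2 := hf.1.hasMFDerivAt
  have h3 : HasMFDerivAt 𝓘(ℝ, F) 𝓘(ℝ, F) (extChartAt 𝓘(ℝ, F) y₀) (f b)
      (mfderiv 𝓘(ℝ, F) 𝓘(ℝ, F) (extChartAt 𝓘(ℝ, F) y₀) (f b)) :=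
    ((contMDiffAt_chart hy).mdifferentiableAt (by simp)).hasMFDerivAt
  have h4 := (h3.comp b h2).comp v h1
  refine HasFDerivAt.congr_fderiv (hasMFDerivAt_iff_hasFDerivAt.1 h4) ?_
  refine ContinuousLinearMap.ext fun w => ?_
  have e1 := DFunLike.congr_fun (chartInv_symm_eq_mfderiv hv) w
  have e2 := hf.2 (chartInv b₀ b w)
  have e3 : ∀ y, y = f b → (equationInChart Z b₀ y₀ (v, extChartAt 𝓘(ℝ, F) y₀ (f b)) w : F) =
      chartDeriv y₀ ((extChartAt 𝓘(ℝ, F) y₀).symm (extChartAt 𝓘(ℝ, F) y₀ (f b)))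
        (Z b ((extChartAt 𝓘(ℝ, F) y₀).symm (extChartAt 𝓘(ℝ, F) y₀ (f b))) (chartInv b₀ b w)) :=
    fun _ _ => rfl
  have e4 : ∀ y, y = f b → chartDeriv y₀ y (Z b y (chartInv b₀ b w)) =
      chartDeriv y₀ (f b) (Z b (f b) (chartInv b₀ b w)) := by rintro y rfl; rfl
  refine Eq.trans ?_ ((e3 _ rfl).trans (e4 _ (chart_symm_mem hy))).symm
  refine Eq.trans ?_ (congrArg (fun u : F => (chartDeriv y₀ (f b) : F →L[ℝ] F) u) e2)
  refine Eq.trans ?_ (DFunLike.congr_fun (chartDeriv_eq_mfderiv hy)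
    (mfderiv 𝓘(ℝ, V) 𝓘(ℝ, F) f b (chartInv b₀ b w))).symm
  exact congrArg (fun u : V => (mfderiv 𝓘(ℝ, F) 𝓘(ℝ, F) (extChartAt 𝓘(ℝ, F) y₀) (f b) : F →L[ℝ] F)
    ((mfderiv 𝓘(ℝ, V) 𝓘(ℝ, F) f b : V →L[ℝ] F) u)) e1.symm

theorem solvesAt_of_hasFDerivAt {g : V → F} {b : B} (hb : b ∈ (chartAt V b₀).source)
    (ht : g (extChartAt 𝓘(ℝ, V) b₀ b) ∈ (extChartAt 𝓘(ℝ, F) y₀).target)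
    (hg : HasFDerivAt g (equationInChart Z b₀ y₀ (extChartAt 𝓘(ℝ, V) b₀ b,
      g (extChartAt 𝓘(ℝ, V) b₀ b))) (extChartAt 𝓘(ℝ, V) b₀ b)) :
    SolvesAt Z (fun b => (extChartAt 𝓘(ℝ, F) y₀).symm (g (extChartAt 𝓘(ℝ, V) b₀ b))) b := by
  set v := extChartAt 𝓘(ℝ, V) b₀ b with hv
  have h1 : HasMFDerivAt 𝓘(ℝ, V) 𝓘(ℝ, V) (extChartAt 𝓘(ℝ, V) b₀) b
      (mfderiv 𝓘(ℝ, V) 𝓘(ℝ, V) (extChartAt 𝓘(ℝ, V) b₀) b) :=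
    ((contMDiffAt_chart hb).mdifferentiableAt (by simp)).hasMFDerivAt
  have h2 := hasMFDerivAt_iff_hasFDerivAt.2 hg
  have h3 : HasMFDerivAt 𝓘(ℝ, F) 𝓘(ℝ, F) (extChartAt 𝓘(ℝ, F) y₀).symm (g v)
      (mfderiv 𝓘(ℝ, F) 𝓘(ℝ, F) (extChartAt 𝓘(ℝ, F) y₀).symm (g v)) :=
    ((contMDiffAt_chart_symm ht).mdifferentiableAt (by simp)).hasMFDerivAt
  have h4 := h3.comp b (h2.comp b h1)
  refine ⟨h4.mdifferentiableAt, fun w => ?_⟩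
  have h5 := DFunLike.congr_fun h4.mfderiv w
  refine h5.trans ?_
  have e1 := chartInv_symm_eq_mfderiv (E := F) ht
  have e2 : (mfderiv 𝓘(ℝ, V) 𝓘(ℝ, V) (extChartAt 𝓘(ℝ, V) b₀) b w : V) = chartDeriv b₀ b w := by
    exact (DFunLike.congr_fun (chartDeriv_eq_mfderiv hb) w).symm
  have e4 : ∀ b', b' = b → (Z b' ((extChartAt 𝓘(ℝ, F) y₀).symm (g v))
      (chartInv b₀ b' (chartDeriv b₀ b w)) : F) = Z b ((extChartAt 𝓘(ℝ, F) y₀).symm (g v)) w := by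
    rintro b' rfl
    exact congrArg (Z b' ((extChartAt 𝓘(ℝ, F) y₀).symm (g v))) (chartInv_chartDeriv hb w)
  calc (mfderiv 𝓘(ℝ, F) 𝓘(ℝ, F) (extChartAt 𝓘(ℝ, F) y₀).symm (g v) : F →L[ℝ] F)
        (equationInChart Z b₀ y₀ (v, g v)
          (mfderiv 𝓘(ℝ, V) 𝓘(ℝ, V) (extChartAt 𝓘(ℝ, V) b₀) b w : V))
      = (chartInv y₀ ((extChartAt 𝓘(ℝ, F) y₀).symm (g v)) : F →L[ℝ] F)
        (equationInChart Z b₀ y₀ (v, g v) (chartDeriv b₀ b w)) :=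
          congr (congrArg _ e1.symm) (congrArg _ e2)
    _ = Z ((extChartAt 𝓘(ℝ, V) b₀).symm v) ((extChartAt 𝓘(ℝ, F) y₀).symm (g v))
      (chartInv b₀ ((extChartAt 𝓘(ℝ, V) b₀).symm v) (chartDeriv b₀ b w)) :=
        chartInv_chartDeriv (symm_mem_source ht) _
    _ = _ := e4 _ (chart_symm_mem hb)

end ManifoldEquation

/-! ### Uniqueness and local flows on manifolds -/

section ManifoldSolutions

open Filter Topology

variable {V : Type*} [NormedAddCommGroup V] [NormedSpace ℝ V]
  {B : Type*} [TopologicalSpace B] [ChartedSpace V B] [IsManifold 𝓘(ℝ, V) ∞ B]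
  {F : Type*} [NormedAddCommGroup F] [NormedSpace ℝ F]
  {N : Type*} [TopologicalSpace N] [ChartedSpace F N] [IsManifold 𝓘(ℝ, F) ∞ N]
  {Z : TotalEquation V B F N}

theorem tendsto_chart_symm {b₀ b : B} (hb : b ∈ (chartAt V b₀).source) :
    Tendsto (extChartAt 𝓘(ℝ, V) b₀).symm (𝓝 (extChartAt 𝓘(ℝ, V) b₀ b)) (𝓝 b) := by
  have := (contMDiffAt_chart_symm (chart_mem_target hb)).continuousAt.tendsto
  rwa [chart_symm_mem hb] at this

/-- Reading both solutions in the charts at `b` and at their common value reduces the claim to the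
vector space case. Continuity at `b` keeps both of them in the target chart. -/
theorem eventuallyEq_of_solvesAt {f₁ f₂ : B → N} {b : B}
    (hZ : ContDiffAt ℝ 1 (equationInChart Z b (f₁ b))
      (extChartAt 𝓘(ℝ, V) b b, extChartAt 𝓘(ℝ, F) (f₁ b) (f₁ b)))
    (h₁ : ∀ᶠ b' in 𝓝 b, SolvesAt Z f₁ b') (h₂ : ∀ᶠ b' in 𝓝 b, SolvesAt Z f₂ b')
    (h₀ : f₁ b = f₂ b) : f₁ =ᶠ[𝓝 b] f₂ := by
  have hb := mem_chart_source V b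
  have hs := tendsto_chart_symm hb
  have ht : ∀ᶠ v in 𝓝 (extChartAt 𝓘(ℝ, V) b b), v ∈ (extChartAt 𝓘(ℝ, V) b).target :=
    (isOpen_chart_target b).mem_nhds (chart_mem_target hb)
  have hsrc : ∀ f : B → N, (∀ᶠ b' in 𝓝 b, SolvesAt Z f b') → f₁ b = f b →
      ∀ᶠ b' in 𝓝 b, f b' ∈ (chartAt F (f₁ b)).source := fun f hf h => by
    refine hf.self_of_nhds.1.continuousAt.eventually_mem
      ((chartAt F (f₁ b)).open_source.mem_nhds ?_)
    rw [← h]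
    exact mem_chart_source F _
  have key : ∀ f : B → N, (∀ᶠ b' in 𝓝 b, SolvesAt Z f b') → f₁ b = f b →
      ∀ᶠ v in 𝓝 (extChartAt 𝓘(ℝ, V) b b),
        HasFDerivAt (fun v => extChartAt 𝓘(ℝ, F) (f₁ b) (f ((extChartAt 𝓘(ℝ, V) b).symm v)))
      (equationInChart Z b (f₁ b)
        (v, extChartAt 𝓘(ℝ, F) (f₁ b) (f ((extChartAt 𝓘(ℝ, V) b).symm v)))) v := fun f hf h => by
    filter_upwards [ht, hs.eventually hf, hs.eventually (hsrc f hf h)] with v h1 h2 h3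
    exact h2.hasFDerivAt_inChart h1 h3
  have h := eventuallyEq_of_hasFDerivAt (f₁ := fun v =>
    extChartAt 𝓘(ℝ, F) (f₁ b) (f₁ ((extChartAt 𝓘(ℝ, V) b).symm v))) (by simpa using hZ)
    (key f₁ h₁ rfl) (key f₂ h₂ h₀) (by simp [h₀])
  have hc : Tendsto (extChartAt 𝓘(ℝ, V) b) (𝓝 b) (𝓝 (extChartAt 𝓘(ℝ, V) b b)) :=
    (contMDiffAt_chart hb).continuousAt.tendsto
  filter_upwards [hc.eventually h, hsrc f₁ h₁ rfl, hsrc f₂ h₂ h₀,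
    (chartAt V b).open_source.mem_nhds hb] with b' e1 e2 e3 e4
  rw [chart_symm_mem e4] at e1
  rw [← chart_symm_mem e2, e1, chart_symm_mem e3]

/-- Solutions of a total differential equation on a connected set are determined by their value
at one point. -/
theorem eqOn_of_solvesAt [T2Space N] {f₁ f₂ : B → N} {S : Set B} (hS : IsOpen S)
    (hc : IsPreconnected S)
    (hZ : ∀ b ∈ S, ∀ y, ContDiffAt ℝ 1 (equationInChart Z b y)
      (extChartAt 𝓘(ℝ, V) b b, extChartAt 𝓘(ℝ, F) y y))
    (h₁ : ∀ b ∈ S, SolvesAt Z f₁ b) (h₂ : ∀ b ∈ S, SolvesAt Z f₂ b)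
    {b : B} (hb : b ∈ S) (h₀ : f₁ b = f₂ b) : EqOn f₁ f₂ S := by
  have key : ∀ b ∈ S, f₁ b = f₂ b → f₁ =ᶠ[𝓝 b] f₂ := fun b hb h =>
    eventuallyEq_of_solvesAt (hZ b hb _) (eventually_of_mem (hS.mem_nhds hb) h₁)
      (eventually_of_mem (hS.mem_nhds hb) h₂) h
  -- The set of points where the germs agree is open by construction. It is relatively closed
  -- because distinct values at a limit point would, in a Hausdorff space, stay distinct nearby;
  -- agreement of values then gives agreement of germs.
  have hsub := hc.subset_of_closure_inter_subset (u := {b | f₁ =ᶠ[𝓝 b] f₂})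
    isOpen_setOfPred_eventually_nhds ⟨b, hb, key b hb h₀⟩ (by
      rintro a ⟨ha, haS⟩
      refine key a haS (by_contra fun hne => ?_)
      have hev := ((h₁ a haS).1.continuousAt.ne_iff_eventually_ne
        (h₂ a haS).1.continuousAt).1 hne
      obtain ⟨c, h3, h4⟩ := ((mem_closure_iff_frequently.1 ha).and_eventually hev).exists
      exact h4 h3.self_of_nhds)
  exact fun a ha => (hsub ha).self_of_nhds

/-- Local existence for total differential equations on manifolds, with smooth dependence on the
initial value. -/
theorem exists_local_flow [CompleteSpace V] [CompleteSpace F] [FiniteDimensional ℝ V]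
    [FiniteDimensional ℝ F]
    {b₀ : B} {y₀ : N}
    (hZ : ∀ᶠ q in 𝓝 (extChartAt 𝓘(ℝ, V) b₀ b₀, extChartAt 𝓘(ℝ, F) y₀ y₀),
      ContDiffAt ℝ ∞ (equationInChart Z b₀ y₀) q)
    (hflat : ∀ᶠ q in 𝓝 (extChartAt 𝓘(ℝ, V) b₀ b₀, extChartAt 𝓘(ℝ, F) y₀ y₀),
      IsFlatAt (equationInChart Z b₀ y₀) q) :
    ∃ ψ : B → N → N, (∀ᶠ y in 𝓝 y₀, ψ b₀ y = y) ∧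
      ∀ᶠ p in 𝓝 (b₀, y₀),
        ContMDiffAt (𝓘(ℝ, V).prod 𝓘(ℝ, F)) 𝓘(ℝ, F) ∞ (fun p : B × N => ψ p.1 p.2) p ∧
        SolvesAt Z (fun b => ψ b p.2) p.1 := by
  obtain ⟨φ, hφ₀, hφ⟩ := exists_local_solution hZ hflat
  have hb := mem_chart_source V b₀
  have hy := mem_chart_source F y₀
  have hcb : Tendsto (extChartAt 𝓘(ℝ, V) b₀) (𝓝 b₀) (𝓝 (extChartAt 𝓘(ℝ, V) b₀ b₀)) :=
    (contMDiffAt_chart hb).continuousAt.tendsto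
  have hcy : Tendsto (extChartAt 𝓘(ℝ, F) y₀) (𝓝 y₀) (𝓝 (extChartAt 𝓘(ℝ, F) y₀ y₀)) :=
    (contMDiffAt_chart hy).continuousAt.tendsto
  refine ⟨fun b y => (extChartAt 𝓘(ℝ, F) y₀).symm
    (φ (extChartAt 𝓘(ℝ, V) b₀ b, extChartAt 𝓘(ℝ, F) y₀ y)), ?_, ?_⟩
  · filter_upwards [hcy.eventually hφ₀, (chartAt F y₀).open_source.mem_nhds hy] with y h1 h2
    rw [h1, chart_symm_mem h2]
  · have hc : Tendsto (fun p : B × N => (extChartAt 𝓘(ℝ, V) b₀ p.1, extChartAt 𝓘(ℝ, F) y₀ p.2))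
        (𝓝 (b₀, y₀)) (𝓝 (extChartAt 𝓘(ℝ, V) b₀ b₀, extChartAt 𝓘(ℝ, F) y₀ y₀)) := by
      rw [nhds_prod_eq, nhds_prod_eq]
      exact hcb.prodMap hcy
    have hφt : ∀ᶠ q in 𝓝 (extChartAt 𝓘(ℝ, V) b₀ b₀, extChartAt 𝓘(ℝ, F) y₀ y₀),
        φ q ∈ (extChartAt 𝓘(ℝ, F) y₀).target := by
      refine hφ.self_of_nhds.1.continuousAt.eventually_mem
        ((isOpen_chart_target y₀).mem_nhds ?_)
      rw [hφ₀.self_of_nhds]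
      exact chart_mem_target hy
    have hsb : ∀ᶠ p : B × N in 𝓝 (b₀, y₀), p.1 ∈ (chartAt V b₀).source :=
      continuousAt_fst.eventually_mem ((chartAt V b₀).open_source.mem_nhds hb)
    have hsy : ∀ᶠ p : B × N in 𝓝 (b₀, y₀), p.2 ∈ (chartAt F y₀).source :=
      continuousAt_snd.eventually_mem ((chartAt F y₀).open_source.mem_nhds hy)
    filter_upwards [hc.eventually hφ, hc.eventually hφt, hsb, hsy] with p h1 h2 h3 h4
    constructor
    · have h5 : ContMDiffAt (𝓘(ℝ, V).prod 𝓘(ℝ, F)) 𝓘(ℝ, V × F) ∞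
          (fun p : B × N => (extChartAt 𝓘(ℝ, V) b₀ p.1, extChartAt 𝓘(ℝ, F) y₀ p.2)) p :=
        ((contMDiffAt_chart h3).comp p contMDiffAt_fst).prodMk_space
          ((contMDiffAt_chart h4).comp p contMDiffAt_snd)
      exact ContMDiffAt.comp p (contMDiffAt_chart_symm h2)
        (ContMDiffAt.comp p (contMDiffAt_iff_contDiffAt.2 h1.1) h5)
    · exact solvesAt_of_hasFDerivAt (g := fun v => φ (v, extChartAt 𝓘(ℝ, F) y₀ p.2)) h3 h2 h1.2

end ManifoldSolutions

/-! ### Extension of flat sections over simply connected spaces -/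

section Monodromy

open Filter Topology

variable {X : Type*} [TopologicalSpace X] {F : Type*}

/-- The fibre bundle with discrete fibre whose local flat sections over `U i` are
`y ↦ τ i y v`. -/
def flatBundleCore [TopologicalSpace F] [DiscreteTopology F]
    (U : X → Set X) (hU : ∀ i, IsOpen (U i)) (hmem : ∀ x, x ∈ U x)
    (τ : X → X → Equiv.Perm F)
    (hloc : ∀ i j v, ∀ x ∈ U i ∩ U j,
      ∀ᶠ y in 𝓝 x, (τ j y).symm (τ i y v) = (τ j x).symm (τ i x v)) :
    FiberBundleCore X X F where
  baseSet := U
  isOpen_baseSet := hU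
  indexAt := id
  mem_baseSet_at := hmem
  coordChange i j x v := (τ j x).symm (τ i x v)
  coordChange_self i x _ v := by simp
  continuousOn_coordChange i j := by
    rintro ⟨x, v⟩ ⟨hx, -⟩
    -- In a discrete fibre `v` may be frozen near the point; what remains is local constancy of the
    -- transition in the base variable.
    refine ContinuousAt.continuousWithinAt ?_
    have h1 : ∀ᶠ p : X × F in 𝓝 (x, v), p.2 = v :=
      (continuousAt_snd (p := (x, v))).eventually_mem
        ((isOpen_discrete {v}).mem_nhds (mem_singleton v))
    have h2 : ∀ᶠ p : X × F in 𝓝 (x, v),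
        (τ j p.1).symm (τ i p.1 v) = (τ j x).symm (τ i x v) :=
      (continuousAt_fst (p := (x, v))).tendsto.eventually (hloc i j v x hx)
    refine (continuousAt_const (y := (τ j x).symm (τ i x v))).congr ?_
    filter_upwards [h1, h2] with p e1 e2
    rw [e1, e2]
  coordChange_comp i j k x _ v := by simp

/-- Flat sections extend over simply connected spaces. -/
theorem exists_flat_section [SimplyConnectedSpace X] [LocallyPathConnectedSpace X]
    (U : X → Set X) (hU : ∀ i, IsOpen (U i)) (hmem : ∀ x, x ∈ U x)
    (τ : X → X → Equiv.Perm F)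
    (hloc : ∀ i j v, ∀ x ∈ U i ∩ U j,
      ∀ᶠ y in 𝓝 x, (τ j y).symm (τ i y v) = (τ j x).symm (τ i x v)) (x₀ : X) (v₀ : F) :
    ∃ s : X → F, s x₀ = v₀ ∧
      ∀ i, ∀ x ∈ U i, ∀ᶠ y in 𝓝 x, (τ i y).symm (s y) = (τ i x).symm (s x) := by
  -- The fibre gets the discrete topology whatever its own, so that the bundle of germs of solutions
  -- is a covering.
  let _ : TopologicalSpace F := ⊥
  have : DiscreteTopology F := ⟨rfl⟩
  let Z := flatBundleCore U hU hmem τ hloc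
  have hcov : IsCoveringMap (TotalSpace.proj : Z.TotalSpace → X) :=
    FiberBundle.isCoveringMap (F := F) (E := Z.Fiber)
  -- Lifting the identity through the covering gives a global section; continuity into a discrete
  -- fibre means that it is locally constant in each trivialization.
  obtain ⟨σ, ⟨hσ₀, hσ⟩, -⟩ := hcov.existsUnique_continuousMap_lifts (ContinuousMap.id X) x₀
    (⟨x₀, (τ x₀ x₀).symm v₀⟩ : Z.TotalSpace) rfl
  have hproj : ∀ x, (σ x).proj = x := fun x => congrFun hσ x
  let w : ∀ x, F := fun x => (σ x).2
  refine ⟨fun x => τ x x (w x), ?_, fun i x hx => ?_⟩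
  · have h1 : ∀ p : Z.TotalSpace, p = ⟨x₀, (τ x₀ x₀).symm v₀⟩ →
        (p.2 : F) = (τ x₀ x₀).symm v₀ := by rintro _ rfl; rfl
    have : w x₀ = (τ x₀ x₀).symm v₀ := h1 _ hσ₀
    simp [this]
  · have hc : ContinuousAt (fun y => (Z.localTriv i (σ y)).2) x := by
      refine continuousAt_snd.comp (ContinuousAt.comp ?_ σ.continuous.continuousAt)
      refine (Z.localTriv i).continuousAt ?_
      rw [Z.mem_localTriv_source, hproj]
      exact hx
    have hval : ∀ y, (Z.localTriv i (σ y)).2 = (τ i y).symm (τ y y (w y)) := by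
      intro y
      change (τ i (σ y).proj).symm (τ (σ y).proj (σ y).proj (w y)) = _
      rw [hproj]
    have := hc.eventually_mem (isOpen_discrete {(Z.localTriv i (σ x)).2} |>.mem_nhds rfl)
    filter_upwards [this] with y hy
    rw [← hval, ← hval]
    exact hy

end Monodromy

/-! ### Left-invariant fields and the Maurer–Cartan form -/

section LeftInvariant

open Filter Topology

variable {EG : Type*} [NormedAddCommGroup EG] [NormedSpace ℝ EG]
  {G : Type*} [TopologicalSpace G] [ChartedSpace EG G] [Group G] [LieGroup 𝓘(ℝ, EG) ∞ G]

theorem lieGroup_minSmoothness (n : ℕ) : LieGroup 𝓘(ℝ, EG) (minSmoothness ℝ n) G :=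
  LieGroup.of_le (minSmoothness_le_infty n)

/-- The left-invariant vector field with value `ξ` at the identity. -/
abbrev leftField (ξ : LieAlg EG G) : VField EG G := mulInvariantVectorField ξ

/-- The field is the image of the smooth section `g ↦ (0_g, ξ)` over `(g, 1)` under the tangent map
of multiplication. -/
theorem smoothVField_leftField (ξ : LieAlg EG G) : SmoothVField (leftField ξ) := by
  let fg : G → TangentBundle 𝓘(ℝ, EG) G := fun g ↦ TotalSpace.mk' EG g 0
  have sfg : ContMDiff 𝓘(ℝ, EG) (𝓘(ℝ, EG).prod 𝓘(ℝ, EG)) ∞ fg := contMDiff_zeroSection _ _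
  let fv : G → TangentBundle 𝓘(ℝ, EG) G := fun _ ↦ TotalSpace.mk' EG 1 ξ
  have sfv : ContMDiff 𝓘(ℝ, EG) (𝓘(ℝ, EG).prod 𝓘(ℝ, EG)) ∞ fv := contMDiff_const
  have S₁ := sfg.prodMk sfv
  have S₂ : ContMDiff _ _ ∞ (equivTangentBundleProd 𝓘(ℝ, EG) G 𝓘(ℝ, EG) G).symm :=
    contMDiff_equivTangentBundleProd_symm
  have S₃ : ContMDiff _ _ ∞ (tangentMap (𝓘(ℝ, EG).prod 𝓘(ℝ, EG)) 𝓘(ℝ, EG)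
      (fun p : G × G ↦ p.1 * p.2)) :=
    ContMDiff.contMDiff_tangentMap (n := ∞) (contMDiff_mul 𝓘(ℝ, EG) ∞) (by simp)
  refine ((S₃.comp S₂).comp S₁).congr fun g => ?_
  have key : ∀ (g' : G) (_ : g' = g) (u : TangentSpace 𝓘(ℝ, EG) g'),
      (u : EG) = (leftField ξ g : EG) →
      (⟨g, leftField ξ g⟩ : TangentBundle 𝓘(ℝ, EG) G) = ⟨g', u⟩ := by
    rintro _ rfl u h
    exact congrArg (TotalSpace.mk (F := EG) (E := TangentSpace 𝓘(ℝ, EG)) _) h.symm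
  refine key _ (mul_one g) _ ?_
  have h := mfderiv_prod_eq_add_apply (I := 𝓘(ℝ, EG)) (I' := 𝓘(ℝ, EG)) (I'' := 𝓘(ℝ, EG))
    (f := fun p : G × G => p.1 * p.2) (p := (g, (1 : G))) (v := ((0 : EG), (ξ : EG)))
    ((contMDiff_mul 𝓘(ℝ, EG) ∞).mdifferentiableAt (x := (g, (1 : G))) (by simp))
  refine Eq.trans h ?_
  refine Eq.trans (congrArg₂ (fun a b : EG => a + b)
    (map_zero (mfderiv 𝓘(ℝ, EG) 𝓘(ℝ, EG) (fun z : G => z * 1) g)) rfl) ?_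
  exact zero_add (leftField ξ g : EG)

/-- The left Maurer–Cartan form. -/
def maurerCartan (g : G) : TangentSpace 𝓘(ℝ, EG) g →L[ℝ] LieAlg EG G :=
  (mfderiv 𝓘(ℝ, EG) 𝓘(ℝ, EG) (fun h : G => g⁻¹ * h) g : EG →L[ℝ] EG)

theorem mfderiv_mul_left_mul_left (g h k : G) (w : TangentSpace 𝓘(ℝ, EG) k) :
    (mfderiv 𝓘(ℝ, EG) 𝓘(ℝ, EG) (fun x : G => g * x) (h * k)
      (mfderiv 𝓘(ℝ, EG) 𝓘(ℝ, EG) (fun x : G => h * x) k w) : EG) =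
    mfderiv 𝓘(ℝ, EG) 𝓘(ℝ, EG) (fun x : G => g * h * x) k w := by
  have h1 : ∀ a b : G, MDifferentiableAt 𝓘(ℝ, EG) 𝓘(ℝ, EG) (fun x : G => a * x) b :=
    fun a b => (contMDiff_mul_left (I := 𝓘(ℝ, EG)) (n := ∞)).contMDiffAt.mdifferentiableAt
      (by simp)
  have h2 := mfderiv_comp k (h1 g (h * k)) (h1 h k)
  have h3 : (fun x : G => g * x) ∘ (fun x : G => h * x) = fun x => g * h * x := by
    funext x; simp [mul_assoc]
  rw [h3] at h2
  exact (DFunLike.congr_fun h2 w).symm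

/-- The hypothesis `g = 1` instead of a literal `1` lets this apply to products such as `g⁻¹ * g`
without rewriting inside the type of a tangent vector. -/
theorem mfderiv_mul_left_of_eq_one {g : G} (hg : g = 1) (k : G) (w : TangentSpace 𝓘(ℝ, EG) k) :
    (mfderiv 𝓘(ℝ, EG) 𝓘(ℝ, EG) (fun x : G => g * x) k w : EG) = w := by
  subst hg
  have h : (fun x : G => 1 * x) = id := by funext x; simp
  have h2 : ∀ f : G → G, f = id → (mfderiv 𝓘(ℝ, EG) 𝓘(ℝ, EG) f k w : EG) = w := by
    rintro _ rfl
    rw [mfderiv_id]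
    rfl
  exact h2 _ h

theorem maurerCartan_leftField (g : G) (ξ : LieAlg EG G) : maurerCartan g (leftField ξ g) = ξ := by
  have h0 : ∀ g' : G, g' = g → (mfderiv 𝓘(ℝ, EG) 𝓘(ℝ, EG) (fun x : G => g⁻¹ * x) g'
      (leftField ξ g) : EG) = mfderiv 𝓘(ℝ, EG) 𝓘(ℝ, EG) (fun x : G => g⁻¹ * x) g
      (leftField ξ g) := by rintro _ rfl; rfl
  exact (h0 _ (mul_one g)).symm.trans ((mfderiv_mul_left_mul_left g⁻¹ g 1 ξ).trans
    (mfderiv_mul_left_of_eq_one (inv_mul_cancel g) 1 ξ))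

theorem leftField_maurerCartan (g : G) (w : TangentSpace 𝓘(ℝ, EG) g) :
    leftField (maurerCartan g w) g = w := by
  have h0 : ∀ g' : G, g' = 1 → (mfderiv 𝓘(ℝ, EG) 𝓘(ℝ, EG) (fun x : G => g * x) g'
      (maurerCartan g w) : EG) = mfderiv 𝓘(ℝ, EG) 𝓘(ℝ, EG) (fun x : G => g * x) 1
      (maurerCartan g w) := by rintro _ rfl; rfl
  exact (h0 _ (inv_mul_cancel g)).symm.trans ((mfderiv_mul_left_mul_left g g⁻¹ g w).trans
    (mfderiv_mul_left_of_eq_one (mul_inv_cancel g) g w))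

theorem leftField_one (ξ : LieAlg EG G) : leftField ξ 1 = ξ :=
  mfderiv_mul_left_of_eq_one rfl 1 ξ

theorem leftField_bracket [CompleteSpace EG] (ξ η : LieAlg EG G) :
    leftField ⁅ξ, η⁆ = mlieBracket 𝓘(ℝ, EG) (leftField ξ) (leftField η) := by
  have := lieGroup_minSmoothness (EG := EG) (G := G) 3
  exact mulInvariantVector_mlieBracket ξ η

/-- The left translate of a left-invariant field. -/
theorem mfderiv_mul_left_leftField (g h : G) (ξ : LieAlg EG G) :
    (mfderiv 𝓘(ℝ, EG) 𝓘(ℝ, EG) (fun x : G => g * x) h (leftField ξ h) : EG) =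
      leftField ξ (g * h) := by
  have h0 : ∀ h' : G, h' = h → (mfderiv 𝓘(ℝ, EG) 𝓘(ℝ, EG) (fun x : G => g * x) h'
      (leftField ξ h) : EG) = mfderiv 𝓘(ℝ, EG) 𝓘(ℝ, EG) (fun x : G => g * x) h
      (leftField ξ h) := by rintro _ rfl; rfl
  exact (h0 _ (mul_one h)).symm.trans (mfderiv_mul_left_mul_left g h 1 ξ)

end LeftInvariant

/-! ### Integrability from equal structure constants -/

section Flatness

open Filter Topology

variable {V : Type*} [NormedAddCommGroup V] [NormedSpace ℝ V]
  {F : Type*} [NormedAddCommGroup F] [NormedSpace ℝ F]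

/-- The integrability condition for `df = b(f) ∘ A` where `A` is inverse to a frame `a`, when `a`
and `b` have the same structure constants. -/
theorem isFlatAt_of_bracket {a A : V → V →L[ℝ] V} {b : F → V →L[ℝ] F} {v : V} {x : F}
    (br : V → V → V) (ha : DifferentiableAt ℝ a v) (hA : DifferentiableAt ℝ A v)
    (hb : DifferentiableAt ℝ b x) (hAa : ∀ᶠ u in 𝓝 v, ∀ ξ, A u (a u ξ) = ξ)
    (haA : ∀ c, a v (A v c) = c)
    (hbr : ∀ ξ η, fderiv ℝ a v (a v ξ) η - fderiv ℝ a v (a v η) ξ = a v (br ξ η))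
    (hbr' : ∀ ξ η, fderiv ℝ b x (b x ξ) η - fderiv ℝ b x (b x η) ξ = b x (br ξ η)) :
    IsFlatAt (fun p : V × F => (b p.2).comp (A p.1)) (v, x) := by
  have hderiv : ∀ (c : V) (k : F) (d : V),
      fderiv ℝ (fun p : V × F => (b p.2).comp (A p.1)) (v, x) (c, k) d =
        fderiv ℝ b x k (A v d) + b x (fderiv ℝ A v c d) := by
    intro c k d
    have h1 : HasFDerivAt (fun p : V × F => b p.2)
        ((fderiv ℝ b x).comp (ContinuousLinearMap.snd ℝ V F)) (v, x) :=
      HasFDerivAt.comp (v, x) (f := Prod.snd) hb.hasFDerivAt hasFDerivAt_snd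
    have h2 : HasFDerivAt (fun p : V × F => A p.1)
        ((fderiv ℝ A v).comp (ContinuousLinearMap.fst ℝ V F)) (v, x) :=
      HasFDerivAt.comp (v, x) (f := Prod.fst) hA.hasFDerivAt hasFDerivAt_fst
    rw [(h1.clm_comp h2).fderiv]
    simp [add_comm]
  -- This is the derivative of the identity `A a ξ = ξ`.
  have hAd : ∀ c ξ, fderiv ℝ A v c (a v ξ) = - A v (fderiv ℝ a v c ξ) := by
    intro c ξ
    have h1 : HasFDerivAt (fun u => A u (a u ξ)) (0 : V →L[ℝ] V) v :=
      (hasFDerivAt_const ξ v).congr_of_eventuallyEq (hAa.mono fun u hu => hu ξ)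
    have h2 := hA.hasFDerivAt.clm_apply
      (ha.hasFDerivAt.clm_apply (hasFDerivAt_const ξ v))
    have h3 := DFunLike.congr_fun (h1.unique h2) c
    simp at h3
    rw [eq_neg_iff_add_eq_zero, add_comm]
    exact h3.symm
  intro c d
  -- With both directions expressed in the frame `a`, integrability says that `Db(bξ)η - Db(bη)ξ`
  -- equals `b A (Da(aξ)η - Da(aη)ξ)`; by hypothesis both are `b [ξ, η]`.
  obtain ⟨ξ, rfl⟩ : ∃ ξ, a v ξ = c := ⟨_, haA c⟩
  obtain ⟨η, rfl⟩ : ∃ η, a v η = d := ⟨_, haA d⟩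
  have hA' := hAa.self_of_nhds
  rw [hderiv, hderiv]
  simp only [ContinuousLinearMap.comp_apply, hA', hAd]
  have h1 := hbr ξ η
  have h2 := hbr' ξ η
  rw [← hA' (br ξ η), ← h1] at h2
  rw [map_sub, map_sub] at h2
  rw [map_neg, map_neg]
  rw [sub_eq_sub_iff_add_eq_add] at h2
  rw [← sub_eq_add_neg, ← sub_eq_add_neg, sub_eq_sub_iff_add_eq_add, h2, add_comm]

end Flatness

/-! ### The invariant equation for maps out of a Lie group -/

section InvariantEquation

open Filter Topology

variable {EG : Type*} [NormedAddCommGroup EG] [NormedSpace ℝ EG] [FiniteDimensional ℝ EG]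
  {G : Type*} [TopologicalSpace G] [ChartedSpace EG G] [Group G] [LieGroup 𝓘(ℝ, EG) ∞ G]
  {F : Type*} [NormedAddCommGroup F] [NormedSpace ℝ F]
  {N : Type*} [TopologicalSpace N] [ChartedSpace F N] [IsManifold 𝓘(ℝ, F) ∞ N]

/-- A linear map out of the Lie algebra, as a continuous linear map on the model space. -/
def fieldAt (X : LieAlg EG G →ₗ[ℝ] VField F N) (y : N) : EG →L[ℝ] TangentSpace 𝓘(ℝ, F) y :=
  (LinearMap.toContinuousLinearMap
    ({ toFun := fun ξ => X ξ y
       map_add' := fun ξ η => congrFun (map_add X (ξ : LieAlg EG G) (η : LieAlg EG G)) y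
       map_smul' := fun c ξ => congrFun (map_smul X c (ξ : LieAlg EG G)) y } : EG →ₗ[ℝ] F) :
    EG →L[ℝ] F)

/-- The equation `df(ξ^L) = X_ξ ∘ f` for maps out of a Lie group. -/
def invariantEquation (X : LieAlg EG G →ₗ[ℝ] VField F N) : TotalEquation EG G F N :=
  fun g y => (fieldAt X y).comp (maurerCartan g)

/-- Left-invariant fields exhaust each tangent space of `G`, so the equation may be tested on them.
-/
theorem solvesAt_invariantEquation_iff {X : LieAlg EG G →ₗ[ℝ] VField F N} {f : G → N} {g : G} :
    SolvesAt (invariantEquation X) f g ↔ MDifferentiableAt 𝓘(ℝ, EG) 𝓘(ℝ, F) f g ∧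
      ∀ ξ : LieAlg EG G, mfderiv 𝓘(ℝ, EG) 𝓘(ℝ, F) f g (leftField ξ g) = X ξ (f g) := by
  refine and_congr_right fun _ => ⟨fun h ξ => ?_, fun h w => ?_⟩
  · refine (h (leftField ξ g)).trans ?_
    exact congrArg (fun ζ : LieAlg EG G => X ζ (f g)) (maurerCartan_leftField g ξ)
  · refine Eq.trans ?_ (h (maurerCartan g w))
    exact congrArg (mfderiv 𝓘(ℝ, EG) 𝓘(ℝ, F) f g) (leftField_maurerCartan g w).symm

/-- Solutions of the invariant equation are stable under left translation. -/
theorem SolvesAt.comp_mul_left {X : LieAlg EG G →ₗ[ℝ] VField F N} {f : G → N} {g h : G}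
    (hf : SolvesAt (invariantEquation X) f (g * h)) :
    SolvesAt (invariantEquation X) (fun k => f (g * k)) h := by
  rw [solvesAt_invariantEquation_iff] at hf ⊢
  have h1 : MDifferentiableAt 𝓘(ℝ, EG) 𝓘(ℝ, EG) (fun x : G => g * x) h :=
    (contMDiff_mul_left (I := 𝓘(ℝ, EG)) (n := ∞)).contMDiffAt.mdifferentiableAt (by simp)
  refine ⟨hf.1.comp h h1, fun ξ => ?_⟩
  refine (DFunLike.congr_fun (mfderiv_comp h hf.1 h1) (leftField ξ h)).trans ?_
  refine Eq.trans ?_ (hf.2 ξ)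
  exact congrArg (fun u : EG => (mfderiv 𝓘(ℝ, EG) 𝓘(ℝ, F) f (g * h) : EG →L[ℝ] F) u)
    (mfderiv_mul_left_leftField g h ξ)

/-- A family of fields in a chart. -/
def frameInChart (X : LieAlg EG G →ₗ[ℝ] VField F N) (y₀ : N) (x : F) : EG →L[ℝ] F :=
  (chartDeriv y₀ ((extChartAt 𝓘(ℝ, F) y₀).symm x)).comp
    (fieldAt X ((extChartAt 𝓘(ℝ, F) y₀).symm x))

theorem contDiffOn_frameInChart {X : LieAlg EG G →ₗ[ℝ] VField F N}
    (hX : ∀ ξ, SmoothVField (X ξ)) (y₀ : N) :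
    ContDiffOn ℝ ∞ (frameInChart X y₀) (extChartAt 𝓘(ℝ, F) y₀).target := by
  refine contDiffOn_clm_apply.2 fun ξ x hx => ?_
  have h := (smoothVFieldAt_iff (symm_mem_source hx)).1 ((hX ξ).smoothVFieldAt
    ((extChartAt 𝓘(ℝ, F) y₀).symm x))
  rw [chart_right_inv hx] at h
  exact h.contDiffWithinAt

variable (EG G) in
/-- The frame of left-invariant fields. -/
def leftFieldLinear : LieAlg EG G →ₗ[ℝ] VField EG G where
  toFun := leftField
  map_add' ξ η := mulInvariantVectorField_add ξ η
  map_smul' c ξ := mulInvariantVectorField_smul c ξ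

/-- The Maurer–Cartan form in a chart. -/
def maurerCartanInChart (g₀ : G) (v : EG) : EG →L[ℝ] EG :=
  (maurerCartan ((extChartAt 𝓘(ℝ, EG) g₀).symm v)).comp
    (chartInv g₀ ((extChartAt 𝓘(ℝ, EG) g₀).symm v))

theorem maurerCartanInChart_frame {g₀ : G} {v : EG} (hv : v ∈ (extChartAt 𝓘(ℝ, EG) g₀).target)
    (ξ : EG) : maurerCartanInChart g₀ v (frameInChart (leftFieldLinear EG G) g₀ v ξ) = ξ :=
  (congrArg (maurerCartan ((extChartAt 𝓘(ℝ, EG) g₀).symm v))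
    (chartInv_chartDeriv (symm_mem_source hv)
      (leftField (ξ : LieAlg EG G) ((extChartAt 𝓘(ℝ, EG) g₀).symm v)))).trans
  (maurerCartan_leftField _ ξ)

theorem frame_maurerCartanInChart {g₀ : G} {v : EG} (hv : v ∈ (extChartAt 𝓘(ℝ, EG) g₀).target)
    (c : EG) : frameInChart (leftFieldLinear EG G) g₀ v (maurerCartanInChart g₀ v c) = c :=
  (congrArg (chartDeriv g₀ ((extChartAt 𝓘(ℝ, EG) g₀).symm v))
    (leftField_maurerCartan ((extChartAt 𝓘(ℝ, EG) g₀).symm v) (chartInv g₀ _ c))).trans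
  (chartDeriv_chartInv (symm_mem_source hv) c)

/-- The form is the pointwise inverse of the left-invariant frame, and inversion of operators is
smooth at invertible ones. -/
theorem contDiffOn_maurerCartanInChart (g₀ : G) :
    ContDiffOn ℝ ∞ (maurerCartanInChart g₀) (extChartAt 𝓘(ℝ, EG) g₀).target := by
  have : CompleteSpace EG := FiniteDimensional.complete ℝ EG
  have ha := contDiffOn_frameInChart (X := leftFieldLinear EG G)
    (fun ξ => smoothVField_leftField ξ) g₀
  have hinv : ∀ v ∈ (extChartAt 𝓘(ℝ, EG) g₀).target, maurerCartanInChart g₀ v =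
      (frameInChart (leftFieldLinear EG G) g₀ v).inverse := fun v hv => by
    rw [ContinuousLinearMap.inverse_eq]
    · exact ContinuousLinearMap.ext fun w => frame_maurerCartanInChart hv w
    · exact ContinuousLinearMap.ext fun w => maurerCartanInChart_frame hv w
  refine ContDiffOn.congr (fun v hv => ?_) hinv
  let e : EG ≃L[ℝ] EG := ContinuousLinearEquiv.equivOfInverse
    (frameInChart (leftFieldLinear EG G) g₀ v) (maurerCartanInChart g₀ v)
    (fun w => maurerCartanInChart_frame hv w) (fun w => frame_maurerCartanInChart hv w)
  have he : ContDiffAt ℝ ∞ ContinuousLinearMap.inverse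
      (frameInChart (leftFieldLinear EG G) g₀ v) := contDiffAt_map_inverse e
  exact he.comp_contDiffWithinAt v (ha v hv)

theorem equationInChart_invariantEquation (X : LieAlg EG G →ₗ[ℝ] VField F N) (g₀ : G) (y₀ : N) :
    equationInChart (invariantEquation X) g₀ y₀ =
      fun p => (frameInChart X y₀ p.2).comp (maurerCartanInChart g₀ p.1) := rfl

theorem contDiffAt_invariantEquation {X : LieAlg EG G →ₗ[ℝ] VField F N}
    (hX : ∀ ξ, SmoothVField (X ξ)) {g₀ : G} {y₀ : N} {p : EG × F}
    (h₁ : p.1 ∈ (extChartAt 𝓘(ℝ, EG) g₀).target) (h₂ : p.2 ∈ (extChartAt 𝓘(ℝ, F) y₀).target) :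
    ContDiffAt ℝ ∞ (equationInChart (invariantEquation X) g₀ y₀) p := by
  rw [equationInChart_invariantEquation]
  have h3 := (contDiffOn_frameInChart hX y₀).contDiffAt ((isOpen_chart_target y₀).mem_nhds h₂)
  have h4 := (contDiffOn_maurerCartanInChart g₀).contDiffAt
    ((isOpen_chart_target g₀).mem_nhds h₁)
  exact (h3.comp p contDiffAt_snd).clm_comp (h4.comp p contDiffAt_fst)

/-- This puts the bracket relations into the form asked for by `isFlatAt_of_bracket`; it serves both
for the left-invariant frame on `G` and for the fields `X` on the target. -/
theorem bracket_frameInChart [CompleteSpace F] {X : LieAlg EG G →ₗ[ℝ] VField F N}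
    (hX : ∀ ξ, SmoothVField (X ξ))
    (hbr : ∀ ξ η : LieAlg EG G, X ⁅ξ, η⁆ = mlieBracket 𝓘(ℝ, F) (X ξ) (X η)) {y₀ : N} {x : F}
    (hx : x ∈ (extChartAt 𝓘(ℝ, F) y₀).target) (ξ η : LieAlg EG G) :
    fderiv ℝ (frameInChart X y₀) x (frameInChart X y₀ x ξ) η -
      fderiv ℝ (frameInChart X y₀) x (frameInChart X y₀ x η) ξ =
        frameInChart X y₀ x (⁅ξ, η⁆ : LieAlg EG G) := by
  have hd : DifferentiableAt ℝ (frameInChart X y₀) x :=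
    ((contDiffOn_frameInChart hX y₀).contDiffAt
      ((isOpen_chart_target y₀).mem_nhds hx)).differentiableAt (by simp)
  have h1 : ∀ (ζ : LieAlg EG G) (k : F), fderiv ℝ (fieldInChart y₀ (X ζ)) x k =
      fderiv ℝ (frameInChart X y₀) x k ζ := by
    intro ζ k
    have h2 : ∀ ζ : EG, fderiv ℝ (fun x => frameInChart X y₀ x ζ) x k =
        fderiv ℝ (frameInChart X y₀) x k ζ := fun ζ => by
      rw [(hd.hasFDerivAt.clm_apply (hasFDerivAt_const ζ x)).fderiv]
      simp
    exact h2 ζ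
  have h2 := fieldInChart_mlieBracket hx ((hX ξ).smoothVFieldAt _) ((hX η).smoothVFieldAt _)
  rw [← hbr, lieBracket, h1, h1] at h2
  exact h2.symm

theorem isFlatAt_invariantEquation [CompleteSpace F] {X : LieAlg EG G →ₗ[ℝ] VField F N}
    (hX : ∀ ξ, SmoothVField (X ξ))
    (hbr : ∀ ξ η : LieAlg EG G, X ⁅ξ, η⁆ = mlieBracket 𝓘(ℝ, F) (X ξ) (X η)) {g₀ : G} {y₀ : N}
    {p : EG × F} (h₁ : p.1 ∈ (extChartAt 𝓘(ℝ, EG) g₀).target)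
    (h₂ : p.2 ∈ (extChartAt 𝓘(ℝ, F) y₀).target) :
    IsFlatAt (equationInChart (invariantEquation X) g₀ y₀) p := by
  have : CompleteSpace EG := FiniteDimensional.complete ℝ EG
  rw [equationInChart_invariantEquation]
  have h3 := (contDiffOn_frameInChart hX y₀).contDiffAt ((isOpen_chart_target y₀).mem_nhds h₂)
  have ht := (isOpen_chart_target (E := EG) g₀).mem_nhds h₁
  have h4 := (contDiffOn_maurerCartanInChart g₀).contDiffAt ht
  have h5 := (contDiffOn_frameInChart (X := leftFieldLinear EG G)
    (fun ξ => smoothVField_leftField ξ) g₀).contDiffAt ht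
  obtain ⟨v, x⟩ := p
  exact isFlatAt_of_bracket (a := frameInChart (leftFieldLinear EG G) g₀)
    (fun ξ η => Bracket.bracket (L := LieAlg EG G) (M := LieAlg EG G) ξ η)
    (h5.differentiableAt (by simp)) (h4.differentiableAt (by simp)) (h3.differentiableAt (by simp))
    (eventually_of_mem ht fun u hu ξ => maurerCartanInChart_frame hu ξ)
    (frame_maurerCartanInChart h₁)
    (bracket_frameInChart (X := leftFieldLinear EG G) (fun ξ => smoothVField_leftField ξ)
      leftField_bracket h₁)
    (bracket_frameInChart hX hbr h₂)

/-- Uniqueness for the invariant equation. -/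
theorem eqOn_of_solvesAt_invariantEquation [T2Space N] {X : LieAlg EG G →ₗ[ℝ] VField F N}
    (hX : ∀ ξ, SmoothVField (X ξ)) {f₁ f₂ : G → N} {S : Set G} (hS : IsOpen S)
    (hc : IsPreconnected S) (h₁ : ∀ g ∈ S, SolvesAt (invariantEquation X) f₁ g)
    (h₂ : ∀ g ∈ S, SolvesAt (invariantEquation X) f₂ g) {g : G} (hg : g ∈ S)
    (h₀ : f₁ g = f₂ g) : EqOn f₁ f₂ S := by
  refine eqOn_of_solvesAt hS hc (fun b _ y => ?_) h₁ h₂ hg h₀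
  exact (contDiffAt_invariantEquation hX (chart_mem_target (mem_chart_source EG b))
    (chart_mem_target (mem_chart_source F y))).of_le (by simp)

theorem exists_local_flow_invariantEquation [FiniteDimensional ℝ F]
    {X : LieAlg EG G →ₗ[ℝ] VField F N} (hX : ∀ ξ, SmoothVField (X ξ))
    (hbr : ∀ ξ η : LieAlg EG G, X ⁅ξ, η⁆ = mlieBracket 𝓘(ℝ, F) (X ξ) (X η)) (g₀ : G) (y₀ : N) :
    ∃ ψ : G → N → N, (∀ᶠ y in 𝓝 y₀, ψ g₀ y = y) ∧
      ∀ᶠ p in 𝓝 (g₀, y₀),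
        ContMDiffAt (𝓘(ℝ, EG).prod 𝓘(ℝ, F)) 𝓘(ℝ, F) ∞ (fun p : G × N => ψ p.1 p.2) p ∧
        SolvesAt (invariantEquation X) (fun g => ψ g p.2) p.1 := by
  have : CompleteSpace EG := FiniteDimensional.complete ℝ EG
  have : CompleteSpace F := FiniteDimensional.complete ℝ F
  have hev : ∀ᶠ q : EG × F in 𝓝 (extChartAt 𝓘(ℝ, EG) g₀ g₀, extChartAt 𝓘(ℝ, F) y₀ y₀),
      q.1 ∈ (extChartAt 𝓘(ℝ, EG) g₀).target ∧ q.2 ∈ (extChartAt 𝓘(ℝ, F) y₀).target := by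
    refine ((isOpen_chart_target g₀).prod (isOpen_chart_target y₀)).mem_nhds ⟨?_, ?_⟩
    · exact chart_mem_target (mem_chart_source EG g₀)
    · exact chart_mem_target (mem_chart_source F y₀)
  exact exists_local_flow (hev.mono fun q hq => contDiffAt_invariantEquation hX hq.1 hq.2)
    (hev.mono fun q hq => isFlatAt_invariantEquation hX hbr hq.1 hq.2)

end InvariantEquation

/-! ### Integration of Lie algebras of vector fields on compact manifolds -/

section Palais

open Filter Topology

variable {EG : Type*} [NormedAddCommGroup EG] [NormedSpace ℝ EG] [FiniteDimensional ℝ EG]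
  {G : Type*} [TopologicalSpace G] [ChartedSpace EG G] [Group G] [LieGroup 𝓘(ℝ, EG) ∞ G]
  {E : Type*} [NormedAddCommGroup E] [NormedSpace ℝ E] [FiniteDimensional ℝ E]
  {M : Type*} [TopologicalSpace M] [ChartedSpace E M] [IsManifold 𝓘(ℝ, E) ∞ M]
  [T2Space M]

theorem exists_isOpen_isPreconnected_subset {G : Type*} [TopologicalSpace G]
    [LocallyConnectedSpace G] {U : Set G} {g : G} (hU : U ∈ 𝓝 g) :
    ∃ V ⊆ U, IsOpen V ∧ IsPreconnected V ∧ g ∈ V := by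
  obtain ⟨V, h1, h2, h3, h4⟩ :=
    locallyConnectedSpace_iff_subsets_isOpen_isConnected.1 ‹_› g U hU
  exact ⟨V, h1, h2, h4.isPreconnected, h3⟩

/-- A local flow of the invariant equation which is uniform in the initial value. -/
theorem exists_uniform_flow [CompactSpace M] {X : LieAlg EG G →ₗ[ℝ] VField E M}
    (hX : ∀ ξ, SmoothVField (X ξ))
    (hbr : ∀ ξ η : LieAlg EG G, X ⁅ξ, η⁆ = mlieBracket 𝓘(ℝ, E) (X ξ) (X η)) :
    ∃ (U : Set G) (ψ : G → M → M), IsOpen U ∧ IsPreconnected U ∧ 1 ∈ U ∧ (∀ m, ψ 1 m = m) ∧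
      (∀ g ∈ U, ∀ m, SolvesAt (invariantEquation X) (fun g => ψ g m) g) ∧
      ∀ g ∈ U, ∀ m, ContMDiffAt (𝓘(ℝ, EG).prod 𝓘(ℝ, E)) 𝓘(ℝ, E) ∞
        (fun p : G × M => ψ p.1 p.2) (g, m) := by
  have : LocallyConnectedSpace G := ChartedSpace.locallyConnectedSpace EG G
  choose ψ hψ₁ hψ using fun m : M => exists_local_flow_invariantEquation hX hbr (1 : G) m
  have hnb : ∀ m : M, ∃ U ∈ 𝓝 (1 : G), ∃ W ∈ 𝓝 m, ∀ g ∈ U, ∀ y ∈ W, (ψ m 1 y = y) ∧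
      ContMDiffAt (𝓘(ℝ, EG).prod 𝓘(ℝ, E)) 𝓘(ℝ, E) ∞ (fun p : G × M => ψ m p.1 p.2) (g, y) ∧
        SolvesAt (invariantEquation X) (fun g => ψ m g y) g := by
    intro m
    have h1 : ∀ᶠ p : G × M in 𝓝 ((1 : G), m), ψ m 1 p.2 = p.2 :=
      (continuousAt_snd (p := ((1 : G), m))).tendsto.eventually (hψ₁ m)
    obtain ⟨U, hU, W, hW, h⟩ := mem_nhds_prod_iff.1 (h1.and (hψ m))
    exact ⟨U, hU, W, hW, fun g hg y hy => h (mk_mem_prod hg hy)⟩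
  choose U hU W hW hgood using hnb
  -- Finitely many initial neighbourhoods cover `M`, so the corresponding neighbourhoods of the
  -- identity have a common one. It is taken connected so that uniqueness applies on it.
  obtain ⟨t, ht⟩ := CompactSpace.elim_nhds_subcover (fun m => interior (W m))
    (fun m => interior_mem_nhds.2 (hW m))
  have hcov : ∀ y : M, ∃ m ∈ t, y ∈ interior (W m) := fun y => by
    have : y ∈ ⋃ m ∈ t, interior (W m) := by rw [ht]; trivial
    simpa using this
  choose i hit hi using hcov
  obtain ⟨V, hVU, hVo, hVc, hV1⟩ := exists_isOpen_isPreconnected_subset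
    ((Filter.biInter_finset_mem t).2 fun m _ => hU m)
  have hVm : ∀ g ∈ V, ∀ m ∈ t, g ∈ U m := fun g hg m hm => mem_iInter₂.1 (hVU hg) m hm
  have hsol : ∀ m ∈ t, ∀ y ∈ interior (W m), ∀ g ∈ V,
      SolvesAt (invariantEquation X) (fun g => ψ m g y) g := fun m hm y hy g hg =>
    (hgood m g (hVm g hg m hm) y (interior_subset hy)).2.2
  have hone : ∀ m ∈ t, ∀ y ∈ interior (W m), ψ m 1 y = y := fun m hm y hy =>
    (hgood m 1 (hVm 1 hV1 m hm) y (interior_subset hy)).1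
  -- The choice `i y` is arbitrary and may jump with `y`; by uniqueness the flow does not depend on
  -- it, so smoothness can be checked with one fixed local flow.
  have hagree : ∀ m ∈ t, ∀ y ∈ interior (W m), ∀ g ∈ V, ψ (i y) g y = ψ m g y := by
    intro m hm y hy
    refine eqOn_of_solvesAt_invariantEquation hX hVo hVc (hsol _ (hit y) y (hi y))
      (hsol m hm y hy) hV1 ?_
    rw [hone _ (hit y) y (hi y), hone m hm y hy]
  refine ⟨V, fun g y => ψ (i y) g y, hVo, hVc, hV1, fun m => hone _ (hit m) m (hi m),
    fun g hg m => hsol _ (hit m) m (hi m) g hg, fun g hg m => ?_⟩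
  refine (hgood (i m) g (hVm g hg _ (hit m)) m (interior_subset (hi m))).2.1.congr_of_eventuallyEq ?_
  filter_upwards [(hVo.prod (isOpen_interior (s := W (i m)))).mem_nhds (mk_mem_prod hg (hi m))]
    with p hp
  exact hagree (i m) (hit m) p.2 hp.2 p.1 hp.1

/-- Global solutions of the invariant equation on a simply connected group. -/
theorem exists_global_solution [CompactSpace M] [SimplyConnectedSpace G]
    {X : LieAlg EG G →ₗ[ℝ] VField E M} (hX : ∀ ξ, SmoothVField (X ξ))
    (hbr : ∀ ξ η : LieAlg EG G, X ⁅ξ, η⁆ = mlieBracket 𝓘(ℝ, E) (X ξ) (X η)) (m : M) :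
    ∃ f : G → M, f 1 = m ∧ ∀ g, SolvesAt (invariantEquation X) f g := by
  have : LocallyPathConnectedSpace G := ChartedSpace.locallyPathConnectedSpace EG G
  have : LocallyConnectedSpace G := ChartedSpace.locallyConnectedSpace EG G
  have : IsTopologicalGroup G := topologicalGroup_of_lieGroup 𝓘(ℝ, EG) ∞
  obtain ⟨U, ψ, hUo, hUc, hU1, hψ1, hψs, -⟩ := exists_uniform_flow hX hbr
  obtain ⟨V₀, hV₀, hV₀o, hV₀U⟩ : ∃ V : Set G, V ∈ 𝓝 1 ∧ IsOpen V ∧ ∀ g ∈ V, ∀ h ∈ V, g * h ∈ U := by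
    obtain ⟨V, h1, h2, h3⟩ := exists_open_nhds_one_split (hUo.mem_nhds hU1)
    exact ⟨V, h1.mem_nhds h2, h1, h3⟩
  obtain ⟨V, hVV, hVo, hVc, hV1⟩ := exists_isOpen_isPreconnected_subset
    (Filter.inter_mem hV₀ (hUo.mem_nhds hU1))
  -- Both sides solve the invariant equation in `k` and agree at `k = 1`: left translation preserves
  -- solutions.
  have hmul : ∀ h ∈ V, ∀ y, ∀ k ∈ V, ψ (h * k) y = ψ k (ψ h y) := by
    intro h hh y
    refine eqOn_of_solvesAt_invariantEquation hX (f₁ := fun k => ψ (h * k) y)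
      (f₂ := fun k => ψ k (ψ h y)) hVo hVc
      (fun k hk => (hψs _ (hV₀U h (hVV hh).1 k (hVV hk).1) y).comp_mul_left)
      (fun k hk => hψs k (hVV hk).2 _) hV1 ?_
    simp only [mul_one, hψ1]
  -- On a symmetric neighbourhood the local flow maps are bijections of `M`, with `ψ h⁻¹` inverse to
  -- `ψ h`.
  set W : Set G := V ∩ V⁻¹ with hW
  have hWo : IsOpen W := hVo.inter hVo.inv
  have hinv : ∀ h ∈ W, ∀ y, ψ h⁻¹ (ψ h y) = y := fun h hh y => by
    rw [← hmul h hh.1 y h⁻¹ hh.2, mul_inv_cancel, hψ1]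
  have hinv' : ∀ h ∈ W, h⁻¹ ∈ W := fun h hh => ⟨hh.2, by simpa using hh.1⟩
  let p : W → Equiv.Perm M := fun h =>
    { toFun := ψ h
      invFun := ψ (h : G)⁻¹
      left_inv := hinv h h.2
      right_inv := fun y => by simpa using hinv (h : G)⁻¹ (hinv' h h.2) y }
  classical
  -- The local solutions based at `i` are `g ↦ ψ (i⁻¹ * g) y`. The value `1` outside the translated
  -- neighbourhood is a dummy.
  let τ : G → G → Equiv.Perm M := fun i g => if h : i⁻¹ * g ∈ W then p ⟨_, h⟩ else 1
  have hτ : ∀ i g, i⁻¹ * g ∈ W → ∀ y, τ i g y = ψ (i⁻¹ * g) y := fun i g h y => by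
    simp only [τ, dif_pos h]; rfl
  have hopen : ∀ i : G, IsOpen {g : G | i⁻¹ * g ∈ W} := fun i =>
    hWo.preimage (continuous_const_mul i⁻¹)
  have hsolve : ∀ i g : G, i⁻¹ * g ∈ W → ∀ y,
      SolvesAt (invariantEquation X) (fun g => τ i g y) g := by
    intro i g hg y
    have h1 : SolvesAt (invariantEquation X) (fun g => ψ (i⁻¹ * g) y) g :=
      (hψs _ (hVV hg.1).2 y).comp_mul_left
    refine h1.congr ?_
    filter_upwards [(hopen i).mem_nhds hg] with k hk
    exact (hτ i k hk y).symm
  have hunique : ∀ {f₁ f₂ : G → M} {g : G}, (∀ᶠ h in 𝓝 g, SolvesAt (invariantEquation X) f₁ h) →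
      (∀ᶠ h in 𝓝 g, SolvesAt (invariantEquation X) f₂ h) → f₁ g = f₂ g → f₁ =ᶠ[𝓝 g] f₂ := by
    intro f₁ f₂ g h1 h2 h3
    exact eventuallyEq_of_solvesAt ((contDiffAt_invariantEquation hX
      (chart_mem_target (mem_chart_source EG g))
      (chart_mem_target (mem_chart_source E _))).of_le (by simp)) h1 h2 h3
  -- By local uniqueness, a solution based at `i` is near each common point a solution based at `j`
  -- with a fixed parameter; this is the local constancy of transitions.
  obtain ⟨f, hf1, hf⟩ := exists_flat_section (fun i : G => {g : G | i⁻¹ * g ∈ W}) hopen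
    (fun x => by simp [hW, hV1]) τ (by
      rintro i j v x ⟨hxi, hxj⟩
      have h1 := hunique (f₁ := fun y => τ i y v)
        (f₂ := fun y => τ j y ((τ j x).symm (τ i x v)))
        (eventually_of_mem ((hopen i).mem_nhds hxi) fun g hg => hsolve i g hg v)
        (eventually_of_mem ((hopen j).mem_nhds hxj) fun g hg => hsolve j g hg _) (by simp)
      filter_upwards [h1] with y hy
      rw [Equiv.symm_apply_eq]
      exact hy) 1 m
  refine ⟨f, hf1, fun g => ?_⟩
  have hg : g⁻¹ * g ∈ W := by simp [hW, hV1]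
  refine (hsolve g g hg ((τ g g).symm (f g))).congr ?_
  filter_upwards [hf g g hg] with k hk
  rw [← hk, Equiv.apply_symm_apply]

/-- The Lie–Palais theorem on compact manifolds: the right action integrating a Lie algebra of
vector fields. -/
theorem exists_right_action [CompactSpace M] [SimplyConnectedSpace G]
    {X : LieAlg EG G →ₗ[ℝ] VField E M} (hX : ∀ ξ, SmoothVField (X ξ))
    (hbr : ∀ ξ η : LieAlg EG G, X ⁅ξ, η⁆ = mlieBracket 𝓘(ℝ, E) (X ξ) (X η)) :
    ∃ Ψ : G → M → M, (∀ m, Ψ 1 m = m) ∧ (∀ g h m, Ψ (g * h) m = Ψ h (Ψ g m)) ∧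
      (∀ g m, SolvesAt (invariantEquation X) (fun g => Ψ g m) g) ∧
      ContMDiff (𝓘(ℝ, EG).prod 𝓘(ℝ, E)) 𝓘(ℝ, E) ∞ (fun p : G × M => Ψ p.1 p.2) := by
  have : IsTopologicalGroup G := topologicalGroup_of_lieGroup 𝓘(ℝ, EG) ∞
  choose f hf1 hf using fun m : M => exists_global_solution hX hbr m
  obtain ⟨U, ψ, hUo, hUc, hU1, hψ1, hψs, hψ⟩ := exists_uniform_flow hX hbr
  let Ψ : G → M → M := fun g m => f m g
  have hmul : ∀ g h m, Ψ (g * h) m = Ψ h (Ψ g m) := by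
    intro g h m
    refine eqOn_of_solvesAt_invariantEquation hX (f₁ := fun k => f m (g * k))
      (f₂ := f (f m g)) isOpen_univ isPreconnected_univ (fun k _ => (hf m _).comp_mul_left)
      (fun k _ => hf _ k) (mem_univ 1) ?_ (mem_univ h)
    rw [mul_one, hf1]
  have hloc : ∀ g ∈ U, ∀ m, Ψ g m = ψ g m := fun g hg m =>
    eqOn_of_solvesAt_invariantEquation hX (f₁ := f m) (f₂ := fun g => ψ g m) hUo hUc
      (fun k _ => hf m k) (fun k hk => hψs k hk m) hU1 (by rw [hf1, hψ1]) hg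
  have hsmooth : ∀ g ∈ U, ∀ m, ContMDiffAt (𝓘(ℝ, EG).prod 𝓘(ℝ, E)) 𝓘(ℝ, E) ∞
      (fun p : G × M => Ψ p.1 p.2) (g, m) := by
    intro g hg m
    refine (hψ g hg m).congr_of_eventuallyEq ?_
    filter_upwards [(hUo.prod isOpen_univ).mem_nhds (mk_mem_prod hg (mem_univ m))] with p hp
    exact hloc p.1 hp.1 p.2
  have hsmooth' : ∀ g ∈ U, ContMDiff 𝓘(ℝ, E) 𝓘(ℝ, E) ∞ (Ψ g) := fun g hg m =>
    ContMDiffAt.comp m (hsmooth g hg m)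
      (contMDiffAt_const.prodMk contMDiffAt_id : ContMDiffAt 𝓘(ℝ, E) (𝓘(ℝ, EG).prod 𝓘(ℝ, E)) ∞
        (fun y : M => (g, y)) m)
  have hstep : ∀ g k : G, ContMDiff 𝓘(ℝ, E) 𝓘(ℝ, E) ∞ (Ψ g) → k ∈ U →
      ContMDiff 𝓘(ℝ, E) 𝓘(ℝ, E) ∞ (Ψ (g * k)) := fun g k hg hk =>
    ((hsmooth' k hk).comp hg).congr fun m => hmul g k m
  -- Since `Ψ (g * k) = Ψ k ∘ Ψ g` and `Ψ k` is smooth for `k ∈ U`, the set of `g` with `Ψ g` smooth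
  -- is open and closed, hence all of the connected group.
  have hall : ∀ g, ContMDiff 𝓘(ℝ, E) 𝓘(ℝ, E) ∞ (Ψ g) := by
    have hcl : IsClopen {g : G | ContMDiff 𝓘(ℝ, E) 𝓘(ℝ, E) ∞ (Ψ g)} := by
      constructor
      · refine isClosed_of_closure_subset fun g hg => ?_
        have h1 : {h : G | h⁻¹ * g ∈ U} ∈ 𝓝 g :=
          (hUo.preimage (continuous_inv.mul continuous_const)).mem_nhds (by simpa using hU1)
        obtain ⟨h, hh1, hh2⟩ := mem_closure_iff_nhds.1 hg _ h1
        have := hstep h _ hh2 hh1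
        rwa [mul_inv_cancel_left] at this
      · refine isOpen_iff_mem_nhds.2 fun g hg => ?_
        have h1 : {h : G | g⁻¹ * h ∈ U} ∈ 𝓝 g :=
          (hUo.preimage (continuous_const_mul g⁻¹)).mem_nhds (by simpa using hU1)
        refine Filter.mem_of_superset h1 fun h hh => ?_
        have := hstep g _ hg hh
        rwa [mul_inv_cancel_left] at this
    have := hcl.eq_univ ⟨1, hsmooth' 1 hU1⟩
    exact fun g => eq_univ_iff_forall.1 this g
  refine ⟨Ψ, hf1, hmul, fun g m => hf m g, fun ⟨g, m⟩ => ?_⟩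
  -- Joint smoothness at `(g, m)` comes from joint smoothness near the identity, via `Ψ g' m' = Ψ
  -- (g⁻¹ * g') (Ψ g m')`.
  have h1 : ContMDiffAt (𝓘(ℝ, EG).prod 𝓘(ℝ, E)) (𝓘(ℝ, EG).prod 𝓘(ℝ, E)) ∞
      (fun p : G × M => (g⁻¹ * p.1, Ψ g p.2)) (g, m) :=
    (((contMDiff_mul_left (I := 𝓘(ℝ, EG)) (n := ∞)).comp contMDiff_fst).prodMk
      ((hall g).comp contMDiff_snd)) (g, m)
  have h2 := ContMDiffAt.comp_of_eq (x := (g, m)) (y := ((1 : G), Ψ g m))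
    (hsmooth 1 hU1 (Ψ g m)) h1 (by simp)
  refine h2.congr_of_eventuallyEq (Filter.Eventually.of_forall fun p => ?_)
  have := hmul g (g⁻¹ * p.1) p.2
  rwa [mul_inv_cancel_left] at this

end Palais

/-! ### Generators of actions and the Lie–Palais theorem -/

section Generator

open Filter Topology

variable {EG : Type*} [NormedAddCommGroup EG] [NormedSpace ℝ EG]
  {G : Type*} [TopologicalSpace G] [ChartedSpace EG G] [Group G] [LieGroup 𝓘(ℝ, EG) ∞ G]
  {E : Type*} [NormedAddCommGroup E] [NormedSpace ℝ E]
  {M : Type*} [TopologicalSpace M] [ChartedSpace E M]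

theorem mfderiv_mul_right_of_eq_one {g : G} (hg : g = 1) (k : G) (w : TangentSpace 𝓘(ℝ, EG) k) :
    (mfderiv 𝓘(ℝ, EG) 𝓘(ℝ, EG) (fun x : G => x * g) k w : EG) = w := by
  subst hg
  have h : (fun x : G => x * 1) = id := by funext x; simp
  have h2 : ∀ f : G → G, f = id → (mfderiv 𝓘(ℝ, EG) 𝓘(ℝ, EG) f k w : EG) = w := by
    rintro _ rfl
    rw [mfderiv_id]
    rfl
  exact h2 _ h

theorem mdifferentiableAt_inv (g : G) :
    MDifferentiableAt 𝓘(ℝ, EG) 𝓘(ℝ, EG) (fun h : G => h⁻¹) g :=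
  (contMDiff_inv 𝓘(ℝ, EG) ∞).mdifferentiableAt (by simp)

/-- Differentiating `h * h⁻¹ = 1` at the identity gives `ξ + ν = 0`. -/
theorem mfderiv_inv_one (ξ : LieAlg EG G) :
    (mfderiv 𝓘(ℝ, EG) 𝓘(ℝ, EG) (fun h : G => h⁻¹) 1 ξ : EG) = -(ξ : EG) := by
  set ν : EG := mfderiv 𝓘(ℝ, EG) 𝓘(ℝ, EG) (fun h : G => h⁻¹) 1 ξ with hν
  have hm : MDifferentiableAt (𝓘(ℝ, EG).prod 𝓘(ℝ, EG)) 𝓘(ℝ, EG) (fun p : G × G => p.1 * p.2)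
      ((1 : G), (1 : G)⁻¹) := (contMDiff_mul 𝓘(ℝ, EG) ∞).mdifferentiableAt (by simp)
  have hp := mdifferentiableAt_id.prodMk (mdifferentiableAt_inv (EG := EG) (1 : G))
  have h1 := mfderiv_comp (1 : G) hm hp
  have h2 := mfderiv_prod_eq_add_apply (I := 𝓘(ℝ, EG)) (I' := 𝓘(ℝ, EG)) (I'' := 𝓘(ℝ, EG))
    (f := fun p : G × G => p.1 * p.2) (v := ((ξ : EG), ν)) hm
  have h3 : (mfderiv (𝓘(ℝ, EG).prod 𝓘(ℝ, EG)) 𝓘(ℝ, EG) (fun p : G × G => p.1 * p.2)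
      ((1 : G), (1 : G)⁻¹) ((ξ : EG), ν) : EG) = toModel ξ + ν :=
    h2.trans (congrArg₂ (fun a b : EG => a + b) (mfderiv_mul_right_of_eq_one inv_one (1 : G) ξ)
      (mfderiv_mul_left_of_eq_one rfl (1 : G)⁻¹ ν))
  have h4 : (fun p : G × G => p.1 * p.2) ∘ (fun h : G => (id h, h⁻¹)) = fun _ => 1 := by
    funext h; simp
  rw [h4, mfderiv_const] at h1
  have h5 := DFunLike.congr_fun h1 ξ
  have h6 : (mfderiv 𝓘(ℝ, EG) (𝓘(ℝ, EG).prod 𝓘(ℝ, EG)) (fun h : G => (id h, h⁻¹)) 1 ξ : EG × EG) =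
      ((ξ : EG), ν) := by
    rw [mfderiv_prodMk mdifferentiableAt_id (mdifferentiableAt_inv (EG := EG) (1 : G)), mfderiv_id]
    rfl
  have h7 : (0 : EG) = toModel ξ + ν := h5.trans ((congrArg (fun u : EG × EG =>
    (mfderiv (𝓘(ℝ, EG).prod 𝓘(ℝ, EG)) 𝓘(ℝ, EG) (fun p : G × G => p.1 * p.2)
      ((1 : G), (1 : G)⁻¹) : EG × EG →L[ℝ] EG) u) h6).trans h3)
  exact (neg_eq_of_add_eq_zero_right h7.symm).symm

theorem mfderiv_comp_inv_one {f : G → M} (hf : MDifferentiableAt 𝓘(ℝ, EG) 𝓘(ℝ, E) f 1)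
    (ξ : LieAlg EG G) : (mfderiv 𝓘(ℝ, EG) 𝓘(ℝ, E) (fun g => f g⁻¹) 1 ξ : E) =
      -(mfderiv 𝓘(ℝ, EG) 𝓘(ℝ, E) f 1 ξ : E) := by
  have h0 : ∀ g : G, g = 1 → MDifferentiableAt 𝓘(ℝ, EG) 𝓘(ℝ, E) f g := by rintro _ rfl; exact hf
  have h1 := mfderiv_comp (1 : G) (h0 _ inv_one) (mdifferentiableAt_inv (EG := EG) (1 : G))
  have h2 : ∀ g : G, g = 1 → ∀ w : EG, (mfderiv 𝓘(ℝ, EG) 𝓘(ℝ, E) f g w : E) =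
      mfderiv 𝓘(ℝ, EG) 𝓘(ℝ, E) f 1 w := by rintro _ rfl w; rfl
  refine (DFunLike.congr_fun h1 ξ).trans ((h2 _ inv_one _).trans ?_)
  exact (congrArg (fun w : EG => (mfderiv 𝓘(ℝ, EG) 𝓘(ℝ, E) f 1 : EG →L[ℝ] E) w)
    (mfderiv_inv_one ξ)).trans (map_neg (mfderiv 𝓘(ℝ, EG) 𝓘(ℝ, E) f 1 : EG →L[ℝ] E) (ξ : EG))

/-- A smooth function on `G` is differentiated along a left-invariant field by differentiating
its left translates at the identity. -/
theorem mfderiv_leftField {f : G → M} {g : G} (hf : MDifferentiableAt 𝓘(ℝ, EG) 𝓘(ℝ, E) f g)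
    (ξ : LieAlg EG G) : (mfderiv 𝓘(ℝ, EG) 𝓘(ℝ, E) f g (leftField ξ g) : E) =
      mfderiv 𝓘(ℝ, EG) 𝓘(ℝ, E) (fun h => f (g * h)) 1 ξ := by
  have h0 : ∀ g' : G, g' = g → MDifferentiableAt 𝓘(ℝ, EG) 𝓘(ℝ, E) f g' := by rintro _ rfl; exact hf
  have hl : MDifferentiableAt 𝓘(ℝ, EG) 𝓘(ℝ, EG) (fun x : G => g * x) 1 :=
    (contMDiff_mul_left (I := 𝓘(ℝ, EG)) (n := ∞)).contMDiffAt.mdifferentiableAt (by simp)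
  have h1 := mfderiv_comp (1 : G) (h0 _ (mul_one g)) hl
  have h2 : ∀ g' : G, g' = g → ∀ w : EG, (mfderiv 𝓘(ℝ, EG) 𝓘(ℝ, E) f g' w : E) =
      mfderiv 𝓘(ℝ, EG) 𝓘(ℝ, E) f g w := by rintro _ rfl w; rfl
  exact ((DFunLike.congr_fun h1 ξ).trans (h2 _ (mul_one g) _)).symm

variable {Φ : G → M → M}

theorem IsSmoothAction.contMDiff_orbit (hΦ : IsSmoothAction EG E Φ) (m : M) :
    ContMDiff 𝓘(ℝ, EG) 𝓘(ℝ, E) ∞ (fun g => Φ g m) :=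
  hΦ.smooth.comp (contMDiff_id.prodMk contMDiff_const :
    ContMDiff 𝓘(ℝ, EG) (𝓘(ℝ, EG).prod 𝓘(ℝ, E)) ∞ (fun g : G => (g, m)))

theorem IsSmoothAction.contMDiff_apply (hΦ : IsSmoothAction EG E Φ) (g : G) :
    ContMDiff 𝓘(ℝ, E) 𝓘(ℝ, E) ∞ (Φ g) :=
  hΦ.smooth.comp (contMDiff_const.prodMk contMDiff_id :
    ContMDiff 𝓘(ℝ, E) (𝓘(ℝ, EG).prod 𝓘(ℝ, E)) ∞ (fun m : M => (g, m)))

theorem IsSmoothAction.contMDiff_orbit_inv (hΦ : IsSmoothAction EG E Φ) (m : M) :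
    ContMDiff 𝓘(ℝ, EG) 𝓘(ℝ, E) ∞ (fun g => Φ g⁻¹ m) :=
  (hΦ.contMDiff_orbit m).comp (contMDiff_inv 𝓘(ℝ, EG) ∞)

theorem IsSmoothAction.generator_eq (hΦ : IsSmoothAction EG E Φ) (ξ : LieAlg EG G) (m : M) :
    (generator Φ ξ m : E) = mfderiv 𝓘(ℝ, EG) 𝓘(ℝ, E) (fun g : G => Φ g⁻¹ m) 1 ξ :=
  (mfderiv_comp_inv_one ((hΦ.contMDiff_orbit m).mdifferentiableAt (by simp)) ξ).symm

/-- As `Φ_{(gh)⁻¹} m = Φ_{h⁻¹}(Φ_{g⁻¹} m)`, the derivative at `g` along a left-invariant field is a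
derivative at the identity from the point `Φ_{g⁻¹} m`. With the sign convention for generators,
inverse orbits thus solve the invariant equation. -/
theorem IsSmoothAction.mfderiv_orbit_inv (hΦ : IsSmoothAction EG E Φ) (ξ : LieAlg EG G) (m : M)
    (g : G) : (mfderiv 𝓘(ℝ, EG) 𝓘(ℝ, E) (fun g : G => Φ g⁻¹ m) g (leftField ξ g) : E) =
      generator Φ ξ (Φ g⁻¹ m) := by
  refine (mfderiv_leftField ((hΦ.contMDiff_orbit_inv m).mdifferentiableAt (by simp)) ξ).trans ?_
  refine Eq.trans ?_ (hΦ.generator_eq ξ (Φ g⁻¹ m)).symm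
  have h1 : (fun h : G => Φ (g * h)⁻¹ m) = fun h : G => Φ h⁻¹ (Φ g⁻¹ m) := by
    funext h; rw [mul_inv_rev, hΦ.mul]
  have h2 : ∀ f₁ f₂ : G → M, f₁ = f₂ → (mfderiv 𝓘(ℝ, EG) 𝓘(ℝ, E) f₁ 1 ξ : E) =
    mfderiv 𝓘(ℝ, EG) 𝓘(ℝ, E) f₂ 1 ξ := by rintro _ _ rfl; rfl
  exact h2 _ _ h1

variable [FiniteDimensional ℝ EG] [IsManifold 𝓘(ℝ, E) ∞ M] {X : LieAlg EG G →ₗ[ℝ] VField E M}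

theorem IsSmoothAction.solvesAt (hΦ : IsSmoothAction EG E Φ)
    (h : ∀ ξ : LieAlg EG G, generator Φ ξ = X ξ) (m : M) (g : G) :
    SolvesAt (invariantEquation X) (fun g => Φ g⁻¹ m) g :=
  solvesAt_invariantEquation_iff.2 ⟨(hΦ.contMDiff_orbit_inv m).mdifferentiableAt (by simp),
    fun ξ => (hΦ.mfderiv_orbit_inv ξ m g).trans (congrFun (h ξ) _)⟩

/-- An action of a connected group is determined by its generators. -/
theorem IsSmoothAction.ext_generator [T2Space M] [ConnectedSpace G] {Φ' : G → M → M}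
    (hX : ∀ ξ, SmoothVField (X ξ))
    (hΦ : IsSmoothAction EG E Φ) (h : ∀ ξ : LieAlg EG G, generator Φ ξ = X ξ)
    (hΦ' : IsSmoothAction EG E Φ') (h' : ∀ ξ : LieAlg EG G, generator Φ' ξ = X ξ) : Φ = Φ' := by
  funext g m
  have := eqOn_of_solvesAt_invariantEquation hX isOpen_univ isPreconnected_univ
    (fun g _ => hΦ.solvesAt h m g) (fun g _ => hΦ'.solvesAt h' m g) (mem_univ 1)
    (by simp only [inv_one, hΦ.one, hΦ'.one]) (mem_univ g⁻¹)
  simpa using this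

/-- The Lie–Palais theorem on compact manifolds. -/
theorem exists_smoothAction [FiniteDimensional ℝ E] [T2Space M] [CompactSpace M]
    [SimplyConnectedSpace G] (hX : ∀ ξ, SmoothVField (X ξ))
    (hbr : ∀ ξ η : LieAlg EG G, X ⁅ξ, η⁆ = mlieBracket 𝓘(ℝ, E) (X ξ) (X η)) :
    ∃ Φ : G → M → M, IsSmoothAction EG E Φ ∧ ∀ ξ : LieAlg EG G, generator Φ ξ = X ξ := by
  obtain ⟨Ψ, h1, hmul, hs, hsm⟩ := exists_right_action hX hbr
  -- Inversion turns the right action into a left one; it also matches the minus sign in the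
  -- generator.
  have hΦ : IsSmoothAction EG E (fun g => Ψ g⁻¹) := by
    refine ⟨fun m => by simp [h1], fun g h m => by simp [hmul], ?_⟩
    exact hsm.comp (((contMDiff_inv 𝓘(ℝ, EG) ∞).comp contMDiff_fst).prodMk contMDiff_snd)
  refine ⟨_, hΦ, fun ξ => funext fun m => ?_⟩
  have h2 := (solvesAt_invariantEquation_iff.1 (hs 1 m)).2 ξ
  have h3 : (generator (fun g => Ψ g⁻¹) ξ m : E) =
      mfderiv 𝓘(ℝ, EG) 𝓘(ℝ, E) (fun g : G => Ψ g m) 1 ξ := by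
    have h5 : ∀ f₁ f₂ : G → M, f₁ = f₂ → (mfderiv 𝓘(ℝ, EG) 𝓘(ℝ, E) f₁ 1 ξ : E) =
      mfderiv 𝓘(ℝ, EG) 𝓘(ℝ, E) f₂ 1 ξ := by rintro _ _ rfl; rfl
    exact (hΦ.generator_eq ξ m).trans (h5 _ _ (by simp only [inv_inv]))
  have h4 : ∀ y, y = m → (X ξ y : E) = X ξ m := by rintro _ rfl; rfl
  refine h3.trans (Eq.trans ?_ (h2.trans (h4 _ (h1 m))))
  exact (congrArg (fun w : EG => (mfderiv 𝓘(ℝ, EG) 𝓘(ℝ, E) (fun g : G => Ψ g m) 1 : EG →L[ℝ] E) w)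
    (leftField_one ξ)).symm

end Generator

/-! ### One-forms in charts and extension of local data -/

section Forms

open Filter Topology

variable {E : Type*} [NormedAddCommGroup E] [NormedSpace ℝ E]
  {M : Type*} [TopologicalSpace M] [ChartedSpace E M] [IsManifold 𝓘(ℝ, E) ∞ M]

/-- The expression of a one-form in the chart at `x₀`. -/
def formInChart (x₀ : M) (α : OneForm E M) (v : E) : E →L[ℝ] ℝ :=
  (α ((extChartAt 𝓘(ℝ, E) x₀).symm v)).comp (chartInv x₀ ((extChartAt 𝓘(ℝ, E) x₀).symm v))

/-- The coordinates of a section of the bundle `Hom(TM, ℝ)` at `m` are the chart expression of the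
form, since the trivialization of the trivial target bundle is the identity. -/
theorem smoothOneForm_of_formInChart {α : OneForm E M}
    (h : ∀ m, ContDiffAt ℝ ∞ (formInChart m α) (extChartAt 𝓘(ℝ, E) m m)) : SmoothOneForm α := by
  intro m
  refine (contMDiffAt_hom_bundle _).2 ⟨contMDiffAt_id, ?_⟩
  refine (contMDiffAt_iff_inChart (mem_chart_source E m)).2 ?_
  refine (h m).congr_of_eventuallyEq (Filter.Eventually.of_forall fun v => ?_)
  refine ContinuousLinearMap.ext fun w => ?_
  exact DFunLike.congr_fun (Bundle.Trivial.continuousLinearMapAt_trivialization ℝ M ℝ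
    ((extChartAt 𝓘(ℝ, E) m).symm v)) (formInChart m α v w)

theorem contMDiffAt_form_apply {α : OneForm E M} (hα : SmoothOneForm α) {Y : VField E M} {m : M}
    (hY : SmoothVFieldAt Y m) : ContMDiffAt 𝓘(ℝ, E) 𝓘(ℝ, ℝ) ∞ (fun p => α p (Y p)) m := by
  have h := ContMDiffAt.clm_bundle_apply (E₂ := Bundle.Trivial M ℝ) (hα m) hY
  exact (contMDiffAt_totalSpace.1 h).2

/-- The coordinate vector fields of the chart at `x₀`. -/
def coordField (x₀ : M) (w : E) : VField E M := fun p => chartInv x₀ p w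

theorem fieldInChart_coordField {x₀ : M} {w v : E} (hv : v ∈ (extChartAt 𝓘(ℝ, E) x₀).target) :
    fieldInChart x₀ (coordField x₀ w) v = w :=
  chartDeriv_chartInv (symm_mem_source hv) w

theorem smoothVFieldAt_coordField {x₀ p : M} (hp : p ∈ (chartAt E x₀).source) (w : E) :
    SmoothVFieldAt (coordField x₀ w) p := by
  refine (smoothVFieldAt_iff hp).2 ((contDiffAt_const (c := w)).congr_of_eventuallyEq ?_)
  filter_upwards [(isOpen_chart_target x₀).mem_nhds (chart_mem_target hp)] with v hv
  exact fieldInChart_coordField hv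

theorem contDiffOn_formInChart [FiniteDimensional ℝ E] {α : OneForm E M} (hα : SmoothOneForm α)
    (x₀ : M) : ContDiffOn ℝ ∞ (formInChart x₀ α) (extChartAt 𝓘(ℝ, E) x₀).target := by
  refine contDiffOn_clm_apply.2 fun w v hv => ?_
  have h1 := contMDiffAt_form_apply hα (smoothVFieldAt_coordField (symm_mem_source hv) w)
  have h2 := (contMDiffAt_iff_inChart (symm_mem_source hv)).1 h1
  rw [chart_right_inv hv] at h2
  exact h2.contDiffWithinAt

theorem SmoothFun.mdifferentiableAt {f : M → ℝ} (hf : SmoothFun E f) (m : M) :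
    MDifferentiableAt 𝓘(ℝ, E) 𝓘(ℝ, ℝ) f m := ContMDiff.mdifferentiable hf (by simp) m

theorem formInChart_differential {f : M → ℝ} (hf : SmoothFun E f) {x₀ : M} {v : E}
    (hv : v ∈ (extChartAt 𝓘(ℝ, E) x₀).target) :
    formInChart x₀ (differential E f) v = fderiv ℝ (inChart E x₀ f) v :=
  ContinuousLinearMap.ext fun w => (fderiv_inChart hv (hf.mdifferentiableAt _) w).symm

theorem SmoothFun.contDiffOn_inChart {f : M → ℝ} (hf : SmoothFun E f) (x₀ : M) :
    ContDiffOn ℝ ∞ (inChart E x₀ f) (extChartAt 𝓘(ℝ, E) x₀).target := fun v hv => by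
  have h := (contMDiffAt_iff_inChart (symm_mem_source hv)).1
    (hf ((extChartAt 𝓘(ℝ, E) x₀).symm v))
  rw [chart_right_inv hv] at h
  exact h.contDiffWithinAt

/-- Differentials of smooth functions are smooth. -/
theorem SmoothFun.smoothOneForm_differential {f : M → ℝ} (hf : SmoothFun E f) :
    SmoothOneForm (differential E f) := by
  refine smoothOneForm_of_formInChart fun m => ?_
  have ht := (isOpen_chart_target (E := E) m).mem_nhds (chart_mem_target (mem_chart_source E m))
  refine (((hf.contDiffOn_inChart m).contDiffAt ht).fderiv_right (m := ∞)
    (by simp)).congr_of_eventuallyEq ?_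
  filter_upwards [ht] with v hv using formInChart_differential hf hv

theorem SmoothFun.form_apply {α : OneForm E M} (hα : SmoothOneForm α) {Y : VField E M}
    (hY : SmoothVField Y) : SmoothFun E (fun p => α p (Y p)) :=
  fun m => contMDiffAt_form_apply hα (hY m)

section Extension

variable [FiniteDimensional ℝ E] [T2Space M]

/-- Bump functions supported in a chart. -/
theorem exists_smoothFun_eq_one {U : Set M} {p : M} (hU : U ∈ 𝓝 p) :
    ∃ ρ : M → ℝ, SmoothFun E ρ ∧ (∀ᶠ q in 𝓝 p, ρ q = 1) ∧ tsupport ρ ⊆ U := by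
  obtain ⟨ρ, -, hρ⟩ := (SmoothBumpFunction.nhds_basis_tsupport (I := 𝓘(ℝ, E)) p).mem_iff.1 hU
  exact ⟨ρ, ρ.contMDiff, ρ.eventuallyEq_one, hρ⟩

theorem exists_smoothFun_eventuallyEq {f : M → ℝ} {U : Set M} {p : M} (hU : U ∈ 𝓝 p)
    (hf : ∀ q ∈ U, ContMDiffAt 𝓘(ℝ, E) 𝓘(ℝ, ℝ) ∞ f q) :
    ∃ g : M → ℝ, SmoothFun E g ∧ g =ᶠ[𝓝 p] f := by
  obtain ⟨ρ, hρ, h1, hs⟩ := exists_smoothFun_eq_one (E := E) hU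
  refine ⟨fun q => ρ q * f q, fun q => ?_, ?_⟩
  · by_cases hq : q ∈ tsupport ρ
    · exact (hρ q).mul (hf q (hs hq))
    · refine (contMDiffAt_const (c := (0 : ℝ))).congr_of_eventuallyEq ?_
      filter_upwards [notMem_tsupport_iff_eventuallyEq.1 hq] with y hy
      simp [hy]
  · filter_upwards [h1] with q hq
    rw [hq, one_mul]

/-- Closedness and the bracket of forms are tested on globally smooth vector fields, so local
coordinate fields must be extended; a bump function supported in the chart does this. -/
theorem exists_smoothVField_eventuallyEq {x₀ p : M} (hp : p ∈ (chartAt E x₀).source) (w : E) :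
    ∃ Y : VField E M, SmoothVField Y ∧ ∀ᶠ q in 𝓝 p, Y q = coordField x₀ w q := by
  obtain ⟨ρ, hρ, h1, hs⟩ := exists_smoothFun_eq_one (E := E) ((chartAt E x₀).open_source.mem_nhds hp)
  refine ⟨fun q => ρ q • coordField x₀ w q, fun q => ?_, ?_⟩
  · by_cases hq : q ∈ tsupport ρ
    · refine (smoothVFieldAt_iff (hs hq)).2 ?_
      have h2 : ContDiffAt ℝ ∞ (fun v => inChart E x₀ ρ v • w) (extChartAt 𝓘(ℝ, E) x₀ q) :=
        ((contMDiffAt_iff_inChart (hs hq)).1 (hρ q)).smul contDiffAt_const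
      refine h2.congr_of_eventuallyEq ?_
      filter_upwards [(isOpen_chart_target x₀).mem_nhds (chart_mem_target (hs hq))] with v hv
      refine (map_smul (chartDeriv x₀ ((extChartAt 𝓘(ℝ, E) x₀).symm v)) _ _).trans ?_
      exact congrArg (fun u : E => inChart E x₀ ρ v • u) (fieldInChart_coordField hv)
    · have hz : ContMDiffAt 𝓘(ℝ, E) (𝓘(ℝ, E).prod 𝓘(ℝ, E)) ∞
          (fun m : M => (⟨m, 0⟩ : TangentBundle 𝓘(ℝ, E) M)) q :=
        contMDiff_zeroSection ℝ (TangentSpace 𝓘(ℝ, E)) q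
      refine hz.congr_of_eventuallyEq ?_
      filter_upwards [notMem_tsupport_iff_eventuallyEq.1 hq] with y hy
      have : ρ y • coordField x₀ w y = 0 := by rw [hy]; exact zero_smul ℝ _
      rw [this]
  · filter_upwards [h1] with q hq
    rw [hq]
    exact one_smul ℝ _

/-- Tangent vectors extend to smooth vector fields. -/
theorem exists_smoothVField_apply_eq (m : M) (u : TangentSpace 𝓘(ℝ, E) m) :
    ∃ Y : VField E M, SmoothVField Y ∧ Y m = u := by
  obtain ⟨Y, hY, h⟩ := exists_smoothVField_eventuallyEq (mem_chart_source E m) (chartDeriv m m u)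
  exact ⟨Y, hY, h.self_of_nhds.trans (chartInv_chartDeriv (mem_chart_source E m) u)⟩

/-- Every covector is the differential of a smooth function which is affine in a given chart. -/
theorem exists_smoothFun_inChart {x₀ p : M} (hp : p ∈ (chartAt E x₀).source) (L : E →L[ℝ] ℝ) :
    ∃ f : M → ℝ, SmoothFun E f ∧ ∀ᶠ q in 𝓝 p, f q = L (extChartAt 𝓘(ℝ, E) x₀ q) :=
  exists_smoothFun_eventuallyEq ((chartAt E x₀).open_source.mem_nhds hp) fun q hq =>
    ContMDiffAt.comp q (contMDiffAt_iff_contDiffAt.2 L.contDiff.contDiffAt) (contMDiffAt_chart hq)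

theorem exists_differential_eq (m : M) (L : E →L[ℝ] ℝ) :
    ∃ f : M → ℝ, SmoothFun E f ∧ (differential E f m : E →L[ℝ] ℝ) = L := by
  have hm := mem_chart_source E m
  obtain ⟨f, hf, h⟩ := exists_smoothFun_inChart hm L
  refine ⟨f, hf, ContinuousLinearMap.ext fun w => ?_⟩
  refine (mvfderiv_eq_fderiv_inChart hm (hf.mdifferentiableAt m) w).trans ?_
  have h1 : inChart E m f =ᶠ[𝓝 (extChartAt 𝓘(ℝ, E) m m)] L := by
    filter_upwards [(tendsto_chart_symm hm).eventually h,
      (isOpen_chart_target m).mem_nhds (chart_mem_target hm)] with v h2 h3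
    rw [inChart, h2, chart_right_inv h3]
  have h2 : fderiv ℝ (inChart E m f) (extChartAt 𝓘(ℝ, E) m m) = L := by
    rw [h1.fderiv_eq, L.fderiv]
  exact congr (congrArg _ h2) (DFunLike.congr_fun (chartDeriv_self m) w)

/-- Tangent vectors are separated by smooth functions. -/
theorem tangent_ext {m : M} {u v : TangentSpace 𝓘(ℝ, E) m}
    (h : ∀ f : M → ℝ, SmoothFun E f → differential E f m u = differential E f m v) : u = v := by
  refine (SeparatingDual.eq_iff_forall_dual_eq (R := ℝ) (V := E)).2 fun L => ?_
  obtain ⟨f, hf, hL⟩ := exists_differential_eq m L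
  exact (DFunLike.congr_fun hL u).symm.trans ((h f hf).trans (DFunLike.congr_fun hL v))

end Extension

end Forms

/-! ### Functions with vanishing or equal differentials -/

section Constant

open Filter Topology

variable {E : Type*} [NormedAddCommGroup E] [NormedSpace ℝ E]
  {M : Type*} [TopologicalSpace M] [ChartedSpace E M] [IsManifold 𝓘(ℝ, E) ∞ M]
  {F : Type*} [NormedAddCommGroup F] [NormedSpace ℝ F]

/-- A function with zero differential and a constant solve the same total equation `df = 0`. Its
coefficient vanishes in every chart, so the uniqueness theorems give constancy. -/
theorem contDiffAt_equationInChart_zero (m : M) (y : F) (p : E × F) :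
    ContDiffAt ℝ 1 (equationInChart (fun (_ : M) (_ : F) => 0) m y) p := by
  have : equationInChart (V := E) (B := M) (F := F) (N := F) (fun _ _ => 0) m y =
      fun _ => (0 : E →L[ℝ] F) := by
    funext p
    refine ContinuousLinearMap.ext fun w => ?_
    exact map_zero (chartDeriv y ((extChartAt 𝓘(ℝ, F) y).symm p.2))
  rw [this]
  exact contDiffAt_const

theorem solvesAt_zero {f : M → F} {m : M} (hf : MDifferentiableAt 𝓘(ℝ, E) 𝓘(ℝ, F) f m)
    (h : ∀ w, mvfderiv 𝓘(ℝ, E) f m w = 0) : SolvesAt (V := E) (F := F) (fun (_ : M) (_ : F) => 0) f m :=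
  ⟨hf, fun w => h w⟩

theorem eventuallyEq_const_of_mvfderiv_eq_zero {f : M → F} {m : M}
    (hf : ∀ᶠ p in 𝓝 m, MDifferentiableAt 𝓘(ℝ, E) 𝓘(ℝ, F) f p ∧ ∀ w, mvfderiv 𝓘(ℝ, E) f p w = 0) :
    ∀ᶠ p in 𝓝 m, f p = f m :=
  eventuallyEq_of_solvesAt (f₁ := f) (f₂ := fun _ => f m) (contDiffAt_equationInChart_zero _ _ _)
    (hf.mono fun _ hp => solvesAt_zero hp.1 hp.2)
    (Filter.Eventually.of_forall fun p => solvesAt_zero mdifferentiableAt_const fun w => by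
      rw [mvfderiv_const]; rfl) rfl

theorem eq_of_mvfderiv_eq_zero [PreconnectedSpace M] {f : M → F}
    (hf : ∀ p, MDifferentiableAt 𝓘(ℝ, E) 𝓘(ℝ, F) f p) (h : ∀ p w, mvfderiv 𝓘(ℝ, E) f p w = 0)
    (p q : M) : f p = f q :=
  eqOn_of_solvesAt (f₁ := f) (f₂ := fun _ => f q) isOpen_univ isPreconnected_univ
    (fun _ _ _ => contDiffAt_equationInChart_zero _ _ _)
    (fun p _ => solvesAt_zero (hf p) (h p))
    (fun p _ => solvesAt_zero mdifferentiableAt_const fun w => by rw [mvfderiv_const]; rfl)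
    (mem_univ q) rfl (mem_univ p)

theorem differential_sub {f g : M → ℝ} (hf : SmoothFun E f) (hg : SmoothFun E g) :
    differential E (fun p => f p - g p) = differential E f - differential E g := by
  funext m
  exact mvfderiv_sub (hf.mdifferentiableAt m) (hg.mdifferentiableAt m)

/-- Functions with the same differential differ by a constant. -/
theorem sub_eq_sub_of_differential_eq [PreconnectedSpace M] {f g : M → ℝ} (hf : SmoothFun E f)
    (hg : SmoothFun E g) (h : differential E f = differential E g) (p q : M) :
    f p - g p = f q - g q := by
  refine eq_of_mvfderiv_eq_zero (E := E) (f := fun p => f p - g p)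
    (fun p => (ContMDiff.sub hf hg).mdifferentiable (by simp) p) (fun p w => ?_) p q
  have h1 := congrFun (differential_sub hf hg) p
  rw [h, sub_self] at h1
  exact DFunLike.congr_fun h1 w

end Constant

/-! ### Closed one-forms and their primitives -/

section Exact

open Filter Topology

variable {E : Type*} [NormedAddCommGroup E] [NormedSpace ℝ E] [FiniteDimensional ℝ E]
  {M : Type*} [TopologicalSpace M] [ChartedSpace E M] [IsManifold 𝓘(ℝ, E) ∞ M] [T2Space M]

/-- In the chart both fields are constant near the point. -/
theorem mlieBracket_coordField_eq_zero {x₀ p : M} (hp : p ∈ (chartAt E x₀).source) {c d : E}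
    {Y Z : VField E M} (hY : SmoothVField Y) (hZ : SmoothVField Z)
    (hYc : ∀ᶠ q in 𝓝 p, Y q = coordField x₀ c q) (hZd : ∀ᶠ q in 𝓝 p, Z q = coordField x₀ d q) :
    mlieBracket 𝓘(ℝ, E) Y Z p = 0 := by
  have : CompleteSpace E := FiniteDimensional.complete ℝ E
  have ht := (isOpen_chart_target (E := E) x₀).mem_nhds (chart_mem_target hp)
  have key : ∀ (W : VField E M) (w : E), (∀ᶠ q in 𝓝 p, W q = coordField x₀ w q) →
      fieldInChart x₀ W =ᶠ[𝓝 (extChartAt 𝓘(ℝ, E) x₀ p)] fun _ => w := fun W w hW => by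
    filter_upwards [ht, (tendsto_chart_symm hp).eventually hW] with v hv h1
    exact (congrArg _ h1).trans (fieldInChart_coordField hv)
  have h1 := fieldInChart_mlieBracket (X := Y) (Y := Z) (chart_mem_target hp) (hY _) (hZ _)
  have h2 : lieBracket ℝ (fieldInChart x₀ Y) (fieldInChart x₀ Z) (extChartAt 𝓘(ℝ, E) x₀ p) = 0 := by
    rw [lieBracket, (key Y c hYc).fderiv_eq, (key Z d hZd).fderiv_eq]
    simp
  rw [h2, fieldInChart_chart _ hp] at h1
  have h3 := congrArg (chartInv x₀ p) h1
  exact (chartInv_chartDeriv hp _).symm.trans (h3.trans (map_zero _))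

theorem differential_apply_coordField {α : OneForm E M} (hα : SmoothOneForm α) {x₀ p : M}
    (hp : p ∈ (chartAt E x₀).source) {c d : E} {Y Z : VField E M} (hZ : SmoothVField Z)
    (hYc : ∀ᶠ q in 𝓝 p, Y q = coordField x₀ c q) (hZd : ∀ᶠ q in 𝓝 p, Z q = coordField x₀ d q) :
    differential E (fun q => α q (Z q)) p (Y p) =
      fderiv ℝ (formInChart x₀ α) (extChartAt 𝓘(ℝ, E) x₀ p) c d := by
  have ht := (isOpen_chart_target (E := E) x₀).mem_nhds (chart_mem_target hp)
  refine (mvfderiv_eq_fderiv_inChart hp ((SmoothFun.form_apply hα hZ).mdifferentiableAt p)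
    (Y p)).trans ?_
  have h1 : inChart E x₀ (fun q => α q (Z q)) =ᶠ[𝓝 (extChartAt 𝓘(ℝ, E) x₀ p)]
      fun v => formInChart x₀ α v d := by
    filter_upwards [(tendsto_chart_symm hp).eventually hZd] with v hv
    exact congrArg (α ((extChartAt 𝓘(ℝ, E) x₀).symm v)) hv
  have h2 : (chartDeriv x₀ p (Y p) : E) = c :=
    (congrArg _ hYc.self_of_nhds).trans (chartDeriv_chartInv hp c)
  have hd : DifferentiableAt ℝ (formInChart x₀ α) (extChartAt 𝓘(ℝ, E) x₀ p) :=
    ((contDiffOn_formInChart hα x₀).contDiffAt ht).differentiableAt (by simp)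
  rw [h1.fderiv_eq, h2, (hd.hasFDerivAt.clm_apply (hasFDerivAt_const d _)).fderiv]
  simp

/-- A closed one-form has symmetric derivative in charts. -/
theorem fderiv_formInChart_symm {α : OneForm E M} (hα : SmoothOneForm α) (hc : IsClosedForm α)
    {x₀ : M} {v : E} (hv : v ∈ (extChartAt 𝓘(ℝ, E) x₀).target) (c d : E) :
    fderiv ℝ (formInChart x₀ α) v c d = fderiv ℝ (formInChart x₀ α) v d c := by
  have hp := symm_mem_source hv
  obtain ⟨Y, hY, hYc⟩ := exists_smoothVField_eventuallyEq hp c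
  obtain ⟨Z, hZ, hZd⟩ := exists_smoothVField_eventuallyEq hp d
  have h := hc Y Z hY hZ ((extChartAt 𝓘(ℝ, E) x₀).symm v)
  rw [differential_apply_coordField hα hp hZ hYc hZd,
    differential_apply_coordField hα hp hY hZd hYc, chart_right_inv hv,
    mlieBracket_coordField_eq_zero hp hY hZ hYc hZd] at h
  have h0 : α ((extChartAt 𝓘(ℝ, E) x₀).symm v) 0 = 0 := map_zero _
  rw [h0, sub_zero] at h
  exact sub_eq_zero.1 h

/-- The Poincaré lemma as a case of the Frobenius theorem: the coefficient does not involve the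
unknown function, so integrability is the symmetry of the derivative of the form. The initial value
`0` is arbitrary. -/
theorem exists_local_primitive {α : OneForm E M} (hα : SmoothOneForm α) (hc : IsClosedForm α)
    (x₀ : M) : ∃ h : M → ℝ, ∀ᶠ p in 𝓝 x₀, MDifferentiableAt 𝓘(ℝ, E) 𝓘(ℝ, ℝ) h p ∧
      differential E h p = α p := by
  have : CompleteSpace E := FiniteDimensional.complete ℝ E
  have hx := mem_chart_source E x₀
  have ht := (isOpen_chart_target (E := E) x₀).mem_nhds (chart_mem_target hx)
  have ht' : ∀ᶠ q : E × ℝ in 𝓝 (extChartAt 𝓘(ℝ, E) x₀ x₀, (0 : ℝ)),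
      q.1 ∈ (extChartAt 𝓘(ℝ, E) x₀).target :=
    (continuousAt_fst (p := (extChartAt 𝓘(ℝ, E) x₀ x₀, (0 : ℝ)))).tendsto.eventually ht
  have hs : ∀ v ∈ (extChartAt 𝓘(ℝ, E) x₀).target, ContDiffAt ℝ ∞ (formInChart x₀ α) v :=
    fun v hv => (contDiffOn_formInChart hα x₀).contDiffAt ((isOpen_chart_target x₀).mem_nhds hv)
  obtain ⟨φ, -, hφ⟩ := exists_local_solution (Z := fun p : E × ℝ => formInChart x₀ α p.1)
    (v₀ := extChartAt 𝓘(ℝ, E) x₀ x₀) (x₀ := (0 : ℝ))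
    (ht'.mono fun q hq => (hs _ hq).comp q contDiffAt_fst)
    (ht'.mono fun q hq => by
      have h1 : ∀ (b : E) (k : ℝ), fderiv ℝ (fun p : E × ℝ => formInChart x₀ α p.1) q (b, k) =
          fderiv ℝ (formInChart x₀ α) q.1 b := fun b k => by
        have h2 := HasFDerivAt.comp q (f := Prod.fst)
          ((hs _ hq).differentiableAt (by simp)).hasFDerivAt hasFDerivAt_fst
        have h3 := DFunLike.congr_fun h2.fderiv (b, k)
        exact h3
      intro b c
      rw [h1, h1]
      exact fderiv_formInChart_symm hα hc hq b c)
  have hcurve : Tendsto (fun p : M => (extChartAt 𝓘(ℝ, E) x₀ p, (0 : ℝ))) (𝓝 x₀)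
      (𝓝 (extChartAt 𝓘(ℝ, E) x₀ x₀, (0 : ℝ))) :=
    Tendsto.prodMk_nhds (contMDiffAt_chart hx).continuousAt.tendsto tendsto_const_nhds
  refine ⟨fun p => φ (extChartAt 𝓘(ℝ, E) x₀ p, 0), ?_⟩
  filter_upwards [hcurve.eventually hφ, (chartAt E x₀).open_source.mem_nhds hx] with p hp hps
  have hd : HasFDerivAt (fun v => φ (v, 0)) (formInChart x₀ α (extChartAt 𝓘(ℝ, E) x₀ p))
      (extChartAt 𝓘(ℝ, E) x₀ p) := hp.2
  have hm : MDifferentiableAt 𝓘(ℝ, E) 𝓘(ℝ, ℝ) (fun p => φ (extChartAt 𝓘(ℝ, E) x₀ p, 0)) p :=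
    MDifferentiableAt.comp p (g := fun v => φ (v, 0)) hd.differentiableAt.mdifferentiableAt
      ((contMDiffAt_chart hps).mdifferentiableAt (by simp))
  refine ⟨hm, ContinuousLinearMap.ext fun w => ?_⟩
  refine (mvfderiv_eq_fderiv_inChart hps hm w).trans ?_
  have h1 : inChart E x₀ (fun p => φ (extChartAt 𝓘(ℝ, E) x₀ p, 0))
      =ᶠ[𝓝 (extChartAt 𝓘(ℝ, E) x₀ p)] fun v => φ (v, 0) := by
    filter_upwards [(isOpen_chart_target x₀).mem_nhds (chart_mem_target hps)] with v hv
    rw [inChart, chart_right_inv hv]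
  rw [h1.fderiv_eq, hd.fderiv]
  have h2 : ∀ q, q = p → α q (chartInv x₀ q (chartDeriv x₀ p w)) = α p w := by
    rintro _ rfl
    exact congrArg (α _) (chartInv_chartDeriv hps w)
  exact h2 _ (chart_symm_mem hps)

/-- Closed one-forms on simply connected manifolds are exact. -/
theorem exists_primitive [SimplyConnectedSpace M] {α : OneForm E M} (hα : SmoothOneForm α)
    (hc : IsClosedForm α) (m₀ : M) :
    ∃ H : M → ℝ, SmoothFun E H ∧ differential E H = α ∧ H m₀ = 0 := by
  have : LocallyPathConnectedSpace M := ChartedSpace.locallyPathConnectedSpace E M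
  choose h hh using exists_local_primitive hα hc
  choose U hU hUo hUx using fun x => mem_nhds_iff.1 (hh x)
  -- Local primitives up to constants are the flat sections of a bundle with fibre `ℝ`. On overlaps
  -- two of them differ by a locally constant function, so the transitions are locally constant.
  let τ : M → M → Equiv.Perm ℝ := fun i y => Equiv.addRight (h i y)
  obtain ⟨H, hH₀, hH⟩ := exists_flat_section U hUo hUx τ (by
    rintro i j v x ⟨hxi, hxj⟩
    have h1 : ∀ᶠ y in 𝓝 x, h i y - h j y = h i x - h j x := by
      refine eventuallyEq_const_of_mvfderiv_eq_zero (E := E) (f := fun y => h i y - h j y) ?_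
      filter_upwards [(hUo i).mem_nhds hxi, (hUo j).mem_nhds hxj] with y hi hj
      have h2 := hU i hi
      have h3 := hU j hj
      refine ⟨h2.1.sub h3.1, fun w => ?_⟩
      have h4 : mvfderiv 𝓘(ℝ, E) (fun y => h i y - h j y) y =
          differential E (h i) y - differential E (h j) y := mvfderiv_sub h2.1 h3.1
      rw [h2.2, h3.2, sub_self] at h4
      exact DFunLike.congr_fun h4 w
    filter_upwards [h1] with y hy
    simp only [τ, Equiv.addRight_symm, Equiv.coe_addRight]
    linarith) m₀ 0
  have hloc : ∀ x, ∀ᶠ y in 𝓝 x, H y = h x y + (H x - h x x) := by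
    intro x
    filter_upwards [hH x x (hUx x)] with y hy
    simp only [τ, Equiv.addRight_symm, Equiv.coe_addRight] at hy
    linarith
  have hHd : ∀ x, MDifferentiableAt 𝓘(ℝ, E) 𝓘(ℝ, ℝ) H x ∧ differential E H x = α x := by
    intro x
    have h1 := hU x (hUx x)
    have h2 : MDifferentiableAt 𝓘(ℝ, E) 𝓘(ℝ, ℝ) (fun y => h x y + (H x - h x x)) x :=
      h1.1.add mdifferentiableAt_const
    refine ⟨h2.congr_of_eventuallyEq (hloc x), ?_⟩
    have h3 : differential E H x = differential E (fun y => h x y + (H x - h x x)) x :=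
      Filter.EventuallyEq.mfderiv_eq (hloc x)
    have h4 : differential E (fun y => h x y + (H x - h x x)) x =
        differential E (h x) x + mvfderiv 𝓘(ℝ, E) (fun _ : M => H x - h x x) x :=
      mvfderiv_add h1.1 mdifferentiableAt_const
    rw [h3, h4, mvfderiv_const, h1.2]
    exact add_zero _
  refine ⟨H, fun m => ?_, funext fun x => (hHd x).2, hH₀⟩
  have hm := mem_chart_source E m
  refine (contMDiffAt_iff_inChart hm).2 ?_
  have hdiff : ∀ v ∈ (extChartAt 𝓘(ℝ, E) m).target,
      HasFDerivAt (inChart E m H) (formInChart m α v) v := fun v hv => by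
    have h1 : DifferentiableAt ℝ (inChart E m H) v :=
      ((hHd _).1.comp v ((contMDiffAt_chart_symm hv).mdifferentiableAt
        (by simp))).differentiableAt
    refine h1.hasFDerivAt.congr_fderiv (ContinuousLinearMap.ext fun w => ?_)
    exact (fderiv_inChart hv (hHd _).1 w).trans (DFunLike.congr_fun (hHd _).2 _)
  -- So far `H` is only differentiable; its derivative in the chart is the smooth form, hence `H` is
  -- smooth.
  have h5 : ContDiffOn ℝ ∞ (inChart E m H) (extChartAt 𝓘(ℝ, E) m).target := by
    refine (contDiffOn_infty_iff_fderiv_of_isOpen (isOpen_chart_target m)).2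
      ⟨fun v hv => (hdiff v hv).differentiableAt.differentiableWithinAt, ?_⟩
    exact (contDiffOn_formInChart hα m).congr fun v hv => (hdiff v hv).fderiv
  exact h5.contDiffAt ((isOpen_chart_target m).mem_nhds (chart_mem_target hm))

end Exact

/-! ### Hamiltonian vector fields and the bracket of exact forms -/

section Poisson

open Filter Topology

variable {E : Type*} [NormedAddCommGroup E] [NormedSpace ℝ E]
  {M : Type*} [TopologicalSpace M] [ChartedSpace E M] [IsManifold 𝓘(ℝ, E) ∞ M]
  (P : PoissonStructure E M) {f g h : M → ℝ}

namespace PoissonStructure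

theorem bracket_apply (f g : M → ℝ) (m : M) :
    P.bracket f g m = differential E g m (P.sharp m (differential E f m)) := rfl

theorem bracket_skew (f g : M → ℝ) (m : M) : P.bracket f g m = -P.bracket g f m :=
  P.skew m _ _

theorem bracket_self (f : M → ℝ) (m : M) : P.bracket f f m = 0 := by
  have := P.bracket_skew f f m
  linarith

theorem smoothVField_hamiltonian (hf : SmoothFun E f) :
    SmoothVField (P.sharpField (differential E f)) :=
  P.smooth _ hf.smoothOneForm_differential

theorem smoothFun_bracket (hf : SmoothFun E f) (hg : SmoothFun E g) :
    SmoothFun E (P.bracket f g) :=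
  SmoothFun.form_apply hg.smoothOneForm_differential (P.smoothVField_hamiltonian hf)

theorem bracket_jacobi (hf : SmoothFun E f) (hg : SmoothFun E g) (hh : SmoothFun E h) (m : M) :
    P.bracket (P.bracket f g) h m + P.bracket (P.bracket g h) f m +
      P.bracket (P.bracket h f) g m = 0 := P.jacobi f g h hf hg hh m

theorem differential_neg (f : M → ℝ) : differential E (fun p => -f p) = -differential E f :=
  funext fun _ => mvfderiv_neg

/-- The bracket of hamiltonian fields is hamiltonian. -/
theorem mlieBracket_hamiltonian [FiniteDimensional ℝ E] [T2Space M] (hf : SmoothFun E f)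
    (hg : SmoothFun E g) :
    mlieBracket 𝓘(ℝ, E) (P.sharpField (differential E f)) (P.sharpField (differential E g)) =
      P.sharpField (differential E (P.bracket f g)) := by
  have : CompleteSpace E := FiniteDimensional.complete ℝ E
  funext m
  refine tangent_ext fun h hh => ?_
  have h1 := mvfderiv_mlieBracket (P.smoothVField_hamiltonian hf m)
    (P.smoothVField_hamiltonian hg m) (hh m)
  refine h1.trans ?_
  -- Tested on a function `h`, the commutator of the two derivations is compared with the
  -- hamiltonian field of `{f, g}`; this is the Jacobi identity.
  change P.bracket f (P.bracket g h) m - P.bracket g (P.bracket f h) m =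
    P.bracket (P.bracket f g) h m
  have h2 := P.bracket_jacobi hf hg hh m
  have h3 : P.bracket (P.bracket h f) g m = P.bracket g (P.bracket f h) m := by
    rw [P.bracket_skew _ g]
    have : P.bracket h f = fun p => -P.bracket f h p := funext fun p => P.bracket_skew h f p
    rw [this, bracket_apply, differential_neg, bracket_apply]
    exact neg_neg _
  rw [P.bracket_skew (P.bracket g h) f, h3] at h2
  linarith

/-- For hamiltonian fields `L_{X_f} dg = d{f, g}` and `L_{X_g} df = -d{f, g}`, so the three terms
add up to `1 + 1 - 1` copies of `d{f, g}`. -/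
theorem formBracket_differential [FiniteDimensional ℝ E] (hf : SmoothFun E f)
    (hg : SmoothFun E g) {Y : VField E M} (hY : SmoothVField Y) (m : M) :
    P.formBracket (differential E f) (differential E g) Y m =
      differential E (P.bracket f g) m (Y m) := by
  have : CompleteSpace E := FiniteDimensional.complete ℝ E
  have key : ∀ f g : M → ℝ, SmoothFun E f → SmoothFun E g →
      lieDerivOneForm (P.sharpField (differential E f)) (differential E g) Y m =
        differential E (P.bracket f g) m (Y m) := by
    intro f g hf hg
    have h1 := mvfderiv_mlieBracket (P.smoothVField_hamiltonian hf m) (hY m) (hg m)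
    refine (congrArg (fun t => differential E (fun p => differential E g p (Y p)) m
      (P.sharpField (differential E f) m) - t) h1).trans ?_
    exact sub_sub_cancel _ _
  have h2 : P.bracket g f = fun p => -P.bracket f g p := funext fun p => P.bracket_skew g f p
  have h3 : differential E (P.bracket g f) m (Y m) = -differential E (P.bracket f g) m (Y m) := by
    rw [h2, differential_neg]
    rfl
  rw [formBracket, key f g hf hg, key g f hg hf, h3]
  change _ - _ - differential E (P.bracket f g) m (Y m) = _
  ring

end PoissonStructure

theorem SmoothFun.isClosedForm_differential [FiniteDimensional ℝ E] (hf : SmoothFun E f) :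
    IsClosedForm (differential E f) := by
  have : CompleteSpace E := FiniteDimensional.complete ℝ E
  intro Y Z hY hZ m
  have h1 := mvfderiv_mlieBracket (hY m) (hZ m) (hf m)
  exact sub_eq_zero.2 h1.symm

theorem form_ext [FiniteDimensional ℝ E] [T2Space M] {α β : OneForm E M}
    (h : ∀ Y : VField E M, SmoothVField Y → ∀ m, α m (Y m) = β m (Y m)) : α = β := by
  funext m
  refine ContinuousLinearMap.ext fun u => ?_
  obtain ⟨Y, hY, rfl⟩ := exists_smoothVField_apply_eq m u
  exact h Y hY m

theorem differential_add (hf : SmoothFun E f) (hg : SmoothFun E g) :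
    differential E (fun p => f p + g p) = differential E f + differential E g :=
  funext fun m => mvfderiv_add (hf.mdifferentiableAt m) (hg.mdifferentiableAt m)

theorem differential_const_mul (c : ℝ) (hf : SmoothFun E f) :
    differential E (fun p => c * f p) = c • differential E f := by
  funext m
  refine ContinuousLinearMap.ext fun w => ?_
  have h1 := mvfderiv_mul (I := 𝓘(ℝ, E)) (f := fun _ : M => c) mdifferentiableAt_const
    (hf.mdifferentiableAt m)
  refine (DFunLike.congr_fun h1 w).trans ?_
  rw [mvfderiv_const]
  simp only [smul_zero, add_zero]
  rfl

end Poisson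

/-! ### Hamiltonians of infinitesimal momentum maps and their cocycle -/

section MomentumMap

open Filter Topology

variable {EG : Type*} [NormedAddCommGroup EG] [NormedSpace ℝ EG] [FiniteDimensional ℝ EG]
  {G : Type*} [TopologicalSpace G] [ChartedSpace EG G] [Group G] [LieGroup 𝓘(ℝ, EG) ∞ G]
  {E : Type*} [NormedAddCommGroup E] [NormedSpace ℝ E] [FiniteDimensional ℝ E]
  {M : Type*} [TopologicalSpace M] [ChartedSpace E M] [IsManifold 𝓘(ℝ, E) ∞ M] [T2Space M]
  {P : PoissonStructure E M} {α : LieAlg EG G →ₗ[ℝ] OneForm E M}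
  {H : LieAlg EG G →ₗ[ℝ] C^∞⟮𝓘(ℝ, E), M; 𝓘(ℝ, ℝ), ℝ⟯}

theorem smoothFun_coe (f : C^∞⟮𝓘(ℝ, E), M; 𝓘(ℝ, ℝ), ℝ⟯) : SmoothFun E f := f.contMDiff

theorem IsInfinitesimalMomentumMap.differential_bracket (hα : IsInfinitesimalMomentumMap P α)
    (hH : ∀ ξ, α ξ = differential E (H ξ)) (ξ η : LieAlg EG G) :
    differential E (P.bracket (H ξ) (H η)) = differential E (H ⁅ξ, η⁆) := by
  refine form_ext fun Y hY m => ?_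
  rw [← hH, hα.map_bracket ξ η Y hY m, hH, hH,
    P.formBracket_differential (smoothFun_coe _) (smoothFun_coe _) hY]

theorem isInfinitesimalMomentumMap_of_hamiltonian (hH : ∀ ξ, α ξ = differential E (H ξ))
    (hb : ∀ ξ η : LieAlg EG G,
      differential E (P.bracket (H ξ) (H η)) = differential E (H ⁅ξ, η⁆)) :
    IsInfinitesimalMomentumMap P α where
  smooth ξ := by
    rw [hH]
    exact (smoothFun_coe _).smoothOneForm_differential
  closed ξ := by
    rw [hH]
    exact (smoothFun_coe _).isClosedForm_differential
  map_bracket ξ η Y hY m := by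
    rw [hH, hH, hH, P.formBracket_differential (smoothFun_coe _) (smoothFun_coe _) hY, hb]

/-- Primitives exist because `M` is simply connected. Requiring all of them to vanish at one point
removes the constants, and then linearity in `ξ` follows from uniqueness. -/
theorem IsInfinitesimalMomentumMap.exists_hamiltonian [SimplyConnectedSpace M]
    (hα : IsInfinitesimalMomentumMap P α) :
    ∃ H : LieAlg EG G →ₗ[ℝ] C^∞⟮𝓘(ℝ, E), M; 𝓘(ℝ, ℝ), ℝ⟯, ∀ ξ, α ξ = differential E (H ξ) := by
  obtain ⟨m₀⟩ : Nonempty M := inferInstance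
  choose h hs hd h0 using fun ξ => exists_primitive (hα.smooth ξ) (hα.closed ξ) m₀
  have huniq : ∀ f g : M → ℝ, SmoothFun E f → SmoothFun E g → differential E f = differential E g →
      f m₀ = 0 → g m₀ = 0 → ∀ m, f m = g m := by
    intro f g hf hg hfg h1 h2 m
    have := sub_eq_sub_of_differential_eq hf hg hfg m m₀
    rw [h1, h2] at this
    linarith
  refine ⟨{ toFun := fun ξ => ⟨h ξ, hs ξ⟩
            map_add' := fun ξ η => ?_
            map_smul' := fun c ξ => ?_ }, fun ξ => (hd ξ).symm⟩
  · refine DFunLike.ext _ _ fun m => ?_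
    refine huniq _ (fun m => h ξ m + h η m) (hs _) (ContMDiff.add (hs ξ) (hs η)) ?_ (h0 _) ?_ m
    · rw [hd, map_add, differential_add (hs ξ) (hs η), hd, hd]
    · simp [h0]
  · refine DFunLike.ext _ _ fun m => ?_
    refine huniq _ (fun m => c * h ξ m) (hs _) (ContMDiff.mul contMDiff_const (hs ξ)) ?_ (h0 _) ?_ m
    · rw [hd, map_smul, differential_const_mul c (hs ξ), hd]
    · simp [h0]

/-- Infinitesimal momentum maps on simply connected manifolds are hamiltonian. -/
theorem isInfinitesimalMomentumMap_iff [SimplyConnectedSpace M] :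
    IsInfinitesimalMomentumMap P α ↔
      ∃ H : LieAlg EG G →ₗ[ℝ] C^∞⟮𝓘(ℝ, E), M; 𝓘(ℝ, ℝ), ℝ⟯,
        (∀ ξ, α ξ = differential E (H ξ)) ∧
        ∀ ξ η, differential E (P.bracket (H ξ) (H η)) = differential E (H ⁅ξ, η⁆) := by
  constructor
  · intro hα
    obtain ⟨H, hH⟩ := hα.exists_hamiltonian
    exact ⟨H, hH, hα.differential_bracket hH⟩
  · rintro ⟨H, hH, hb⟩
    exact isInfinitesimalMomentumMap_of_hamiltonian hH hb

theorem IsInfinitesimalMomentumMap.sharpField_bracket (hα : IsInfinitesimalMomentumMap P α)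
    (hH : ∀ ξ, α ξ = differential E (H ξ)) (ξ η : LieAlg EG G) :
    P.sharpField (α ⁅ξ, η⁆) =
      mlieBracket 𝓘(ℝ, E) (P.sharpField (α ξ)) (P.sharpField (α η)) := by
  rw [hH ξ, hH η, P.mlieBracket_hamiltonian (smoothFun_coe _) (smoothFun_coe _),
    hα.differential_bracket hH, hH]

variable (P) in
/-- The generating vector fields `π♯(α_ξ)`. -/
def momentumField (α : LieAlg EG G →ₗ[ℝ] OneForm E M) : LieAlg EG G →ₗ[ℝ] VField E M where
  toFun ξ := P.sharpField (α ξ)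
  map_add' ξ η := by
    rw [map_add]
    exact funext fun m => map_add (P.sharp m) _ _
  map_smul' c ξ := by
    rw [map_smul]
    exact funext fun m => map_smul (P.sharp m) _ _

theorem bracket_eq_of_differential_eq {f f' g g' : M → ℝ} (hf : differential E f = differential E f')
    (hg : differential E g = differential E g') : P.bracket f g = P.bracket f' g' := by
  funext m
  rw [P.bracket_apply, P.bracket_apply, hf, hg]

/-- The defect `{H_ξ, H_η} - H_{[ξ, η]}` is a constant two-cocycle. -/
theorem IsInfinitesimalMomentumMap.exists_cocycle [SimplyConnectedSpace M]
    (hα : IsInfinitesimalMomentumMap P α) (hH : ∀ ξ, α ξ = differential E (H ξ)) :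
    ∃ c : LieAlg EG G →ₗ[ℝ] LieAlg EG G →ₗ[ℝ] ℝ,
      (∀ ξ η m, P.bracket (H ξ) (H η) m - H ⁅ξ, η⁆ m = c ξ η) ∧ IsTwoCocycle c := by
  have := lieGroup_minSmoothness (EG := EG) (G := G) 3
  have : CompleteSpace EG := FiniteDimensional.complete ℝ EG
  obtain ⟨m₀⟩ : Nonempty M := inferInstance
  have hbr : ∀ ξ η m, P.bracket (H ξ) (H η) m = α η m (P.sharp m (α ξ m)) := fun ξ η m => by
    rw [hH, hH]
    rfl
  have hd := hα.differential_bracket hH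
  -- The defect is evaluated at one point, where the bracket is visibly bilinear through `α`;
  -- independence of the point follows from equality of the differentials.
  let c : LieAlg EG G →ₗ[ℝ] LieAlg EG G →ₗ[ℝ] ℝ :=
    LinearMap.mk₂ ℝ (fun ξ η => P.bracket (H ξ) (H η) m₀ - H ⁅ξ, η⁆ m₀)
      (fun ξ ξ' η => by
        rw [hbr, hbr, hbr, add_lie, map_add, map_add, ContMDiffMap.coe_add]
        have : P.sharp m₀ ((α ξ + α ξ') m₀) = P.sharp m₀ (α ξ m₀) + P.sharp m₀ (α ξ' m₀) :=
          map_add _ _ _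
        rw [this, map_add, Pi.add_apply]
        ring)
      (fun a ξ η => by
        rw [hbr, hbr, smul_lie, map_smul, map_smul, ContMDiffMap.coe_smul]
        have : P.sharp m₀ ((a • α ξ) m₀) = a • P.sharp m₀ (α ξ m₀) :=
          map_smul (P.sharp m₀) a (α ξ m₀)
        rw [this, map_smul, Pi.smul_apply, smul_sub])
      (fun ξ η η' => by
        rw [hbr, hbr, hbr, lie_add, map_add, map_add, ContMDiffMap.coe_add, Pi.add_apply,
          Pi.add_apply, add_apply]
        ring)
      (fun a ξ η => by
        rw [hbr, hbr, lie_smul, map_smul, map_smul, ContMDiffMap.coe_smul, Pi.smul_apply,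
          Pi.smul_apply, smul_apply, smul_sub])
  have hc : ∀ ξ η m, P.bracket (H ξ) (H η) m - H ⁅ξ, η⁆ m = c ξ η := fun ξ η m =>
    sub_eq_sub_of_differential_eq (P.smoothFun_bracket (smoothFun_coe _) (smoothFun_coe _))
      (smoothFun_coe _) (hd ξ η) m m₀
  refine ⟨c, hc, fun ξ => ?_, fun ξ η ζ => ?_⟩
  · rw [← hc ξ ξ m₀, P.bracket_self, lie_self, map_zero]
    simp
  -- The bracket sees only differentials, so `H_{[ξ, η]}` may be replaced by `{H_ξ, H_η}` inside it.
  -- The cyclic sum is then the difference of the Jacobi identities of the Poisson bracket and of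
  -- the Lie algebra.
  · have h1 : ∀ ξ η ζ : LieAlg EG G, P.bracket (H ⁅ξ, η⁆) (H ζ) m₀ =
        P.bracket (P.bracket (H ξ) (H η)) (H ζ) m₀ := fun ξ η ζ =>
      congrFun (bracket_eq_of_differential_eq (hd ξ η).symm rfl) m₀
    have h2 := P.bracket_jacobi (smoothFun_coe (H ξ)) (smoothFun_coe (H η)) (smoothFun_coe (H ζ)) m₀
    have h3 : H ⁅⁅ξ, η⁆, ζ⁆ m₀ + H ⁅⁅η, ζ⁆, ξ⁆ m₀ + H ⁅⁅ζ, ξ⁆, η⁆ m₀ = 0 := by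
      have h4 : ⁅⁅ξ, η⁆, ζ⁆ + ⁅⁅η, ζ⁆, ξ⁆ + ⁅⁅ζ, ξ⁆, η⁆ = (0 : LieAlg EG G) := by
        have h6 := lie_jacobi ξ η ζ
        rw [← lie_skew ⁅ξ, η⁆ ζ, ← lie_skew ⁅η, ζ⁆ ξ, ← lie_skew ⁅ζ, ξ⁆ η, ← neg_eq_zero, ← h6]
        abel
      have h5 := congrArg (fun x => H x m₀) h4
      simpa using h5
    rw [← hc _ _ m₀, ← hc _ _ m₀, ← hc _ _ m₀, h1, h1, h1]
    linarith

end MomentumMap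

/-! ### Mixed derivatives on products of manifolds -/

section MixedPartials

open Filter Topology

variable {V : Type*} [NormedAddCommGroup V] [NormedSpace ℝ V]
  {B : Type*} [TopologicalSpace B] [ChartedSpace V B] [IsManifold 𝓘(ℝ, V) ∞ B]
  {E : Type*} [NormedAddCommGroup E] [NormedSpace ℝ E]
  {M : Type*} [TopologicalSpace M] [ChartedSpace E M] [IsManifold 𝓘(ℝ, E) ∞ M]
  {F : Type*} [NormedAddCommGroup F] [NormedSpace ℝ F]
  {κ : B × M → F} {x : B} {m : M}

/-- The derivative of a function on a product along the second factor. -/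
def fiberDeriv (E : Type*) [NormedAddCommGroup E] [NormedSpace ℝ E]
    {M : Type*} [TopologicalSpace M] [ChartedSpace E M]
    {B : Type*} (κ : B × M → F) (m : M) (b : B) : E →L[ℝ] F :=
  mvfderiv 𝓘(ℝ, E) (fun p => κ (b, p)) m

/-- A function on a product in charts. -/
def inProdChart (V E : Type*) [NormedAddCommGroup V] [NormedSpace ℝ V]
    [NormedAddCommGroup E] [NormedSpace ℝ E] {B : Type*} [TopologicalSpace B] [ChartedSpace V B]
    {M : Type*} [TopologicalSpace M] [ChartedSpace E M] (κ : B × M → F) (x : B) (m : M) :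
    V × E → F :=
  fun q => κ ((extChartAt 𝓘(ℝ, V) x).symm q.1, (extChartAt 𝓘(ℝ, E) m).symm q.2)

theorem contDiffAt_inProdChart
    (hκ : ContMDiffAt (𝓘(ℝ, V).prod 𝓘(ℝ, E)) 𝓘(ℝ, F) ∞ κ (x, m)) :
    ContDiffAt ℝ ∞ (inProdChart V E κ x m)
      (extChartAt 𝓘(ℝ, V) x x, extChartAt 𝓘(ℝ, E) m m) := by
  have hx := mem_chart_source V x
  have hm := mem_chart_source E m
  refine contMDiffAt_iff_contDiffAt.1 ?_
  refine ContMDiffAt.comp_of_eq (y := (x, m)) hκ ?_ (by simp)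
  exact ((contMDiffAt_chart_symm (chart_mem_target hx)).comp
      (extChartAt 𝓘(ℝ, V) x x, extChartAt 𝓘(ℝ, E) m m) contDiffAt_fst.contMDiffAt).prodMk
    ((contMDiffAt_chart_symm (chart_mem_target hm)).comp
      (extChartAt 𝓘(ℝ, V) x x, extChartAt 𝓘(ℝ, E) m m) contDiffAt_snd.contMDiffAt)

theorem eventually_mdifferentiableAt_prod
    (hκ : ContMDiffAt (𝓘(ℝ, V).prod 𝓘(ℝ, E)) 𝓘(ℝ, F) ∞ κ (x, m)) :
    ∀ᶠ q in 𝓝 (x, m), MDifferentiableAt (𝓘(ℝ, V).prod 𝓘(ℝ, E)) 𝓘(ℝ, F) κ q := by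
  have h1 : ContMDiffAt (𝓘(ℝ, V).prod 𝓘(ℝ, E)) 𝓘(ℝ, F) 1 κ (x, m) := hκ.of_le (by simp)
  filter_upwards [(contMDiffAt_iff_contMDiffAt_nhds (by simp)).1 h1] with p hp
  exact hp.mdifferentiableAt (by simp)

theorem mdifferentiableAt_snd_of_prod {q : B × M}
    (h : MDifferentiableAt (𝓘(ℝ, V).prod 𝓘(ℝ, E)) 𝓘(ℝ, F) κ q) :
    MDifferentiableAt 𝓘(ℝ, E) 𝓘(ℝ, F) (fun p => κ (q.1, p)) q.2 :=
  h.comp q.2 (f := fun p => (q.1, p)) (mdifferentiableAt_const.prodMk mdifferentiableAt_id)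

theorem mdifferentiableAt_fst_of_prod {q : B × M}
    (h : MDifferentiableAt (𝓘(ℝ, V).prod 𝓘(ℝ, E)) 𝓘(ℝ, F) κ q) :
    MDifferentiableAt 𝓘(ℝ, V) 𝓘(ℝ, F) (fun b => κ (b, q.2)) q.1 :=
  h.comp q.1 (f := fun b => (b, q.2)) (mdifferentiableAt_id.prodMk mdifferentiableAt_const)

theorem differentiableAt_inProdChart {q : B × M}
    (hκ : MDifferentiableAt (𝓘(ℝ, V).prod 𝓘(ℝ, E)) 𝓘(ℝ, F) κ q)
    (h₁ : q.1 ∈ (chartAt V x).source) (h₂ : q.2 ∈ (chartAt E m).source) :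
    DifferentiableAt ℝ (inProdChart V E κ x m)
      (extChartAt 𝓘(ℝ, V) x q.1, extChartAt 𝓘(ℝ, E) m q.2) := by
  refine MDifferentiableAt.differentiableAt ?_
  have h3 : MDifferentiableAt 𝓘(ℝ, V × E) (𝓘(ℝ, V).prod 𝓘(ℝ, E))
      (fun p : V × E => ((extChartAt 𝓘(ℝ, V) x).symm p.1, (extChartAt 𝓘(ℝ, E) m).symm p.2))
      (extChartAt 𝓘(ℝ, V) x q.1, extChartAt 𝓘(ℝ, E) m q.2) :=
    (((contMDiffAt_chart_symm (chart_mem_target h₁)).comp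
      (extChartAt 𝓘(ℝ, V) x q.1, extChartAt 𝓘(ℝ, E) m q.2) contDiffAt_fst.contMDiffAt).prodMk
    ((contMDiffAt_chart_symm (chart_mem_target h₂)).comp
      (extChartAt 𝓘(ℝ, V) x q.1, extChartAt 𝓘(ℝ, E) m q.2)
        contDiffAt_snd.contMDiffAt)).mdifferentiableAt (n := ∞) (by simp)
  have h4 : ((extChartAt 𝓘(ℝ, V) x).symm (extChartAt 𝓘(ℝ, V) x q.1),
      (extChartAt 𝓘(ℝ, E) m).symm (extChartAt 𝓘(ℝ, E) m q.2)) = q :=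
    Prod.ext (chart_symm_mem h₁) (chart_symm_mem h₂)
  exact MDifferentiableAt.comp (I' := 𝓘(ℝ, V).prod 𝓘(ℝ, E))
    (extChartAt 𝓘(ℝ, V) x q.1, extChartAt 𝓘(ℝ, E) m q.2) (h4.symm ▸ hκ) h3

theorem fiberDeriv_eq {q : B × M}
    (hκ : MDifferentiableAt (𝓘(ℝ, V).prod 𝓘(ℝ, E)) 𝓘(ℝ, F) κ q)
    (h₁ : q.1 ∈ (chartAt V x).source) (h₂ : q.2 ∈ (chartAt E m).source) (w : E) :
    fiberDeriv E κ q.2 q.1 w = fderiv ℝ (inProdChart V E κ x m)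
      (extChartAt 𝓘(ℝ, V) x q.1, extChartAt 𝓘(ℝ, E) m q.2) (0, chartDeriv m q.2 w) := by
  have h3 := differentiableAt_inProdChart hκ h₁ h₂
  have h4 : inChart E m (fun p => κ (q.1, p)) =
      fun v => inProdChart V E κ x m (extChartAt 𝓘(ℝ, V) x q.1, v) := by
    funext v
    rw [inChart, inProdChart, chart_symm_mem h₁]
  have h5 := h3.hasFDerivAt.comp (extChartAt 𝓘(ℝ, E) m q.2)
    (hasFDerivAt_prodMk_right (extChartAt 𝓘(ℝ, V) x q.1) (extChartAt 𝓘(ℝ, E) m q.2))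
  refine (mvfderiv_eq_fderiv_inChart h₂ (mdifferentiableAt_snd_of_prod hκ) w).trans ?_
  rw [h4]
  exact DFunLike.congr_fun h5.fderiv _

theorem baseDeriv_eq {q : B × M}
    (hκ : MDifferentiableAt (𝓘(ℝ, V).prod 𝓘(ℝ, E)) 𝓘(ℝ, F) κ q)
    (h₁ : q.1 ∈ (chartAt V x).source) (h₂ : q.2 ∈ (chartAt E m).source)
    (w : TangentSpace 𝓘(ℝ, V) q.1) :
    mvfderiv 𝓘(ℝ, V) (fun b => κ (b, q.2)) q.1 w = fderiv ℝ (inProdChart V E κ x m)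
      (extChartAt 𝓘(ℝ, V) x q.1, extChartAt 𝓘(ℝ, E) m q.2) (chartDeriv x q.1 w, 0) := by
  have h3 := differentiableAt_inProdChart hκ h₁ h₂
  have h4 : inChart V x (fun b => κ (b, q.2)) =
      fun v => inProdChart V E κ x m (v, extChartAt 𝓘(ℝ, E) m q.2) := by
    funext v
    rw [inChart, inProdChart, chart_symm_mem h₂]
  have h5 := h3.hasFDerivAt.comp (extChartAt 𝓘(ℝ, V) x q.1)
    (f := fun v => (v, extChartAt 𝓘(ℝ, E) m q.2)) (hasFDerivAt_prodMk_left (extChartAt 𝓘(ℝ, V) x q.1) (extChartAt 𝓘(ℝ, E) m q.2))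
  refine (mvfderiv_eq_fderiv_inChart h₁ (mdifferentiableAt_fst_of_prod hκ) w).trans ?_
  rw [h4]
  exact DFunLike.congr_fun h5.fderiv _

/-- With `m` fixed, the fibre derivative takes values in the fixed space `E →L[ℝ] F`. The chart at
`m` has identity derivative there, so the fibre derivative is a plain partial derivative in product
charts. -/
theorem inChart_fiberDeriv_eventuallyEq
    (hκ : ContMDiffAt (𝓘(ℝ, V).prod 𝓘(ℝ, E)) 𝓘(ℝ, F) ∞ κ (x, m)) :
    inChart V x (fiberDeriv E κ m) =ᶠ[𝓝 (extChartAt 𝓘(ℝ, V) x x)]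
      fun v => (fderiv ℝ (inProdChart V E κ x m) (v, extChartAt 𝓘(ℝ, E) m m)).comp
        (ContinuousLinearMap.inr ℝ V E) := by
  have hx := mem_chart_source V x
  have hm := mem_chart_source E m
  have h1 : ∀ᶠ b in 𝓝 x, MDifferentiableAt (𝓘(ℝ, V).prod 𝓘(ℝ, E)) 𝓘(ℝ, F) κ (b, m) :=
    (Continuous.prodMk_left m).continuousAt.tendsto.eventually (eventually_mdifferentiableAt_prod hκ)
  filter_upwards [(tendsto_chart_symm hx).eventually h1,
    (isOpen_chart_target x).mem_nhds (chart_mem_target hx)] with v h2 h3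
  refine ContinuousLinearMap.ext fun w => ?_
  refine (fiberDeriv_eq (x := x) (m := m) h2 (symm_mem_source h3) hm w).trans ?_
  have h4 : (chartDeriv m m w : E) = w := DFunLike.congr_fun (chartDeriv_self m) w
  change fderiv ℝ (inProdChart V E κ x m) (extChartAt 𝓘(ℝ, V) x ((extChartAt 𝓘(ℝ, V) x).symm v),
    extChartAt 𝓘(ℝ, E) m m) (0, chartDeriv m m w) = _
  rw [chart_right_inv h3, h4]
  simp

theorem differentiableAt_fderiv_inProdChart
    (hκ : ContMDiffAt (𝓘(ℝ, V).prod 𝓘(ℝ, E)) 𝓘(ℝ, F) ∞ κ (x, m)) :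
    DifferentiableAt ℝ (fderiv ℝ (inProdChart V E κ x m))
      (extChartAt 𝓘(ℝ, V) x x, extChartAt 𝓘(ℝ, E) m m) :=
  ((contDiffAt_inProdChart hκ).fderiv_right (m := ∞) (by simp)).differentiableAt (by simp)

theorem hasFDerivAt_inChart_fiberDeriv
    (hκ : ContMDiffAt (𝓘(ℝ, V).prod 𝓘(ℝ, E)) 𝓘(ℝ, F) ∞ κ (x, m)) :
    HasFDerivAt (inChart V x (fiberDeriv E κ m))
      (((ContinuousLinearMap.compL ℝ E (V × E) F).flip (ContinuousLinearMap.inr ℝ V E)).comp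
        ((fderiv ℝ (fderiv ℝ (inProdChart V E κ x m))
          (extChartAt 𝓘(ℝ, V) x x, extChartAt 𝓘(ℝ, E) m m)).comp
            (ContinuousLinearMap.inl ℝ V E))) (extChartAt 𝓘(ℝ, V) x x) := by
  refine HasFDerivAt.congr_of_eventuallyEq ?_ (inChart_fiberDeriv_eventuallyEq hκ)
  exact ((ContinuousLinearMap.compL ℝ E (V × E) F).flip
    (ContinuousLinearMap.inr ℝ V E)).hasFDerivAt.comp _
    ((differentiableAt_fderiv_inProdChart hκ).hasFDerivAt.comp (extChartAt 𝓘(ℝ, V) x x)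
      (f := fun v => (v, extChartAt 𝓘(ℝ, E) m m)) (hasFDerivAt_prodMk_left (extChartAt 𝓘(ℝ, V) x x) (extChartAt 𝓘(ℝ, E) m m)))

theorem mdifferentiableAt_of_inChart {f : M → F}
    (h : DifferentiableAt ℝ (inChart E m f) (extChartAt 𝓘(ℝ, E) m m)) :
    MDifferentiableAt 𝓘(ℝ, E) 𝓘(ℝ, F) f m := by
  have hm := mem_chart_source E m
  have h1 := MDifferentiableAt.comp m h.mdifferentiableAt
    ((contMDiffAt_chart hm).mdifferentiableAt (by simp))
  refine h1.congr_of_eventuallyEq ?_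
  filter_upwards [(chartAt E m).open_source.mem_nhds hm] with y hy
  simp only [Function.comp, inChart, chart_symm_mem hy]

theorem mdifferentiableAt_fiberDeriv
    (hκ : ContMDiffAt (𝓘(ℝ, V).prod 𝓘(ℝ, E)) 𝓘(ℝ, F) ∞ κ (x, m)) :
    MDifferentiableAt 𝓘(ℝ, V) 𝓘(ℝ, E →L[ℝ] F) (fiberDeriv E κ m) x :=
  mdifferentiableAt_of_inChart (hasFDerivAt_inChart_fiberDeriv hκ).differentiableAt

/-- Symmetry of mixed derivatives on a product of manifolds. -/
theorem mvfderiv_fiberDeriv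
    (hκ : ContMDiffAt (𝓘(ℝ, V).prod 𝓘(ℝ, E)) 𝓘(ℝ, F) ∞ κ (x, m)) (ξ : TangentSpace 𝓘(ℝ, V) x)
    (w : TangentSpace 𝓘(ℝ, E) m) :
    mvfderiv 𝓘(ℝ, V) (fiberDeriv E κ m) x ξ w =
      mvfderiv 𝓘(ℝ, E) (fun p => mvfderiv 𝓘(ℝ, V) (fun b => κ (b, p)) x ξ) m w := by
  have hx := mem_chart_source V x
  have hm := mem_chart_source E m
  have hξ : (chartDeriv x x ξ : V) = ξ := DFunLike.congr_fun (chartDeriv_self x) ξ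
  have hw : (chartDeriv m m w : E) = w := DFunLike.congr_fun (chartDeriv_self m) w
  set κ' := inProdChart V E κ x m with hκ'
  have h1 : inChart E m (fun p => mvfderiv 𝓘(ℝ, V) (fun b => κ (b, p)) x ξ)
      =ᶠ[𝓝 (extChartAt 𝓘(ℝ, E) m m)]
        fun v => fderiv ℝ κ' (extChartAt 𝓘(ℝ, V) x x, v) (chartDeriv x x ξ, 0) := by
    have h2 : ∀ᶠ p in 𝓝 m, MDifferentiableAt (𝓘(ℝ, V).prod 𝓘(ℝ, E)) 𝓘(ℝ, F) κ (x, p) :=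
      (Continuous.prodMk_right x).continuousAt.tendsto.eventually
        (eventually_mdifferentiableAt_prod hκ)
    filter_upwards [(tendsto_chart_symm hm).eventually h2,
      (isOpen_chart_target m).mem_nhds (chart_mem_target hm)] with v h3 h4
    refine (baseDeriv_eq (x := x) (m := m) h3 hx (symm_mem_source h4) ξ).trans ?_
    change fderiv ℝ κ' (extChartAt 𝓘(ℝ, V) x x,
      extChartAt 𝓘(ℝ, E) m ((extChartAt 𝓘(ℝ, E) m).symm v)) (chartDeriv x x ξ, 0) = _
    rw [chart_right_inv h4]
  have h5 : HasFDerivAt (fun v => fderiv ℝ κ' (extChartAt 𝓘(ℝ, V) x x, v) (chartDeriv x x ξ, 0))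
      (((fderiv ℝ (fderiv ℝ κ') (extChartAt 𝓘(ℝ, V) x x, extChartAt 𝓘(ℝ, E) m m)).comp
        (ContinuousLinearMap.inr ℝ V E)).flip (chartDeriv x x ξ, 0)) (extChartAt 𝓘(ℝ, E) m m) := by
    have h6 := (differentiableAt_fderiv_inProdChart hκ).hasFDerivAt.comp (extChartAt 𝓘(ℝ, E) m m)
      (hasFDerivAt_prodMk_right (extChartAt 𝓘(ℝ, V) x x) (extChartAt 𝓘(ℝ, E) m m))
    have h7 := h6.clm_apply
      (hasFDerivAt_const ((chartDeriv x x ξ, 0) : V × E) (extChartAt 𝓘(ℝ, E) m m))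
    simpa using h7
  have h8 := h5.congr_of_eventuallyEq h1
  have h9 : mvfderiv 𝓘(ℝ, V) (fiberDeriv E κ m) x ξ w = fderiv ℝ (fderiv ℝ κ')
      (extChartAt 𝓘(ℝ, V) x x, extChartAt 𝓘(ℝ, E) m m) (chartDeriv x x ξ, 0) (0, (w : E)) := by
    have h10 := mvfderiv_eq_fderiv_inChart hx (mdifferentiableAt_fiberDeriv hκ) ξ
    rw [(hasFDerivAt_inChart_fiberDeriv hκ).fderiv] at h10
    exact DFunLike.congr_fun h10 (w : E)
  have h11 := mvfderiv_eq_fderiv_inChart hm (mdifferentiableAt_of_inChart h8.differentiableAt) w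
  rw [h8.fderiv, hw] at h11
  -- Both sides are now the same second derivative with its two arguments exchanged.
  have hsym : IsSymmSndFDerivAt ℝ κ' (extChartAt 𝓘(ℝ, V) x x, extChartAt 𝓘(ℝ, E) m m) :=
    (contDiffAt_inProdChart hκ).isSymmSndFDerivAt (minSmoothness_le_infty 2)
  exact h9.trans ((hsym.eq _ _).trans h11.symm)

end MixedPartials

/-! ### Poisson brackets depending on a parameter -/

section JointBracket

open Filter Topology

variable {V : Type*} [NormedAddCommGroup V] [NormedSpace ℝ V]
  {B : Type*} [TopologicalSpace B] [ChartedSpace V B] [IsManifold 𝓘(ℝ, V) ∞ B]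
  {E : Type*} [NormedAddCommGroup E] [NormedSpace ℝ E]
  {M : Type*} [TopologicalSpace M] [ChartedSpace E M] [IsManifold 𝓘(ℝ, E) ∞ M]
  {F : Type*} [NormedAddCommGroup F] [NormedSpace ℝ F]
  {κ : B × M → F} {x : B} {m : M}

theorem mdifferentiableAt_fiberDeriv_apply
    (hκ : ContMDiffAt (𝓘(ℝ, V).prod 𝓘(ℝ, E)) 𝓘(ℝ, F) ∞ κ (x, m)) {Y : VField E M}
    (hY : SmoothVFieldAt Y m) :
    MDifferentiableAt (𝓘(ℝ, V).prod 𝓘(ℝ, E)) 𝓘(ℝ, F)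
      (fun q => fiberDeriv E κ q.2 q.1 (Y q.2)) (x, m) := by
  have hx := mem_chart_source V x
  have hm := mem_chart_source E m
  have h1 : DifferentiableAt ℝ
      (fun q : V × E => fderiv ℝ (inProdChart V E κ x m) q (0, fieldInChart m Y q.2))
      (extChartAt 𝓘(ℝ, V) x x, extChartAt 𝓘(ℝ, E) m m) := by
    have h2 : DifferentiableAt ℝ (fieldInChart m Y) (extChartAt 𝓘(ℝ, E) m m) :=
      ((smoothVFieldAt_iff hm).1 hY).differentiableAt (by simp)
    refine (differentiableAt_fderiv_inProdChart hκ).clm_apply ?_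
    exact (differentiableAt_const _).prodMk (DifferentiableAt.comp (g := fieldInChart m Y)
      (f := Prod.snd) (extChartAt 𝓘(ℝ, V) x x, extChartAt 𝓘(ℝ, E) m m) h2 differentiableAt_snd)
  have h3 : MDifferentiableAt (𝓘(ℝ, V).prod 𝓘(ℝ, E)) 𝓘(ℝ, V × E)
      (fun q : B × M => (extChartAt 𝓘(ℝ, V) x q.1, extChartAt 𝓘(ℝ, E) m q.2)) (x, m) :=
    (((contMDiffAt_chart hx).comp (x, m) contMDiffAt_fst).prodMk_space
      ((contMDiffAt_chart hm).comp (x, m) contMDiffAt_snd)).mdifferentiableAt (n := ∞) (by simp)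
  refine (MDifferentiableAt.comp (x, m) h1.mdifferentiableAt h3).congr_of_eventuallyEq ?_
  filter_upwards [eventually_mdifferentiableAt_prod hκ,
    (continuousAt_fst (p := (x, m))).tendsto.eventually ((chartAt V x).open_source.mem_nhds hx),
    (continuousAt_snd (p := (x, m))).tendsto.eventually ((chartAt E m).open_source.mem_nhds hm)]
    with q h4 h5 h6
  refine (fiberDeriv_eq h4 h5 h6 (Y q.2)).trans ?_
  rw [Function.comp, fieldInChart_chart Y h6]

theorem differential_apply_of_eventuallyEq_chart {f : M → ℝ} (hf : SmoothFun E f) {x₀ p : M}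
    (hp : p ∈ (chartAt E x₀).source) {L : E →L[ℝ] ℝ}
    (h : ∀ᶠ q in 𝓝 p, f q = L (extChartAt 𝓘(ℝ, E) x₀ q)) (w : TangentSpace 𝓘(ℝ, E) p) :
    differential E f p w = L (chartDeriv x₀ p w) := by
  refine (mvfderiv_eq_fderiv_inChart hp (hf.mdifferentiableAt p) w).trans ?_
  have h1 : inChart E x₀ f =ᶠ[𝓝 (extChartAt 𝓘(ℝ, E) x₀ p)] L := by
    filter_upwards [(tendsto_chart_symm hp).eventually h,
      (isOpen_chart_target x₀).mem_nhds (chart_mem_target hp)] with v hv hv'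
    rw [inChart, hv, chart_right_inv hv']
  rw [h1.fderiv_eq, L.fderiv]

/-- Local frames of smooth vector fields with dual coframes of differentials. -/
theorem exists_coframe [FiniteDimensional ℝ E] [T2Space M] (m : M) :
    ∃ (X : Fin (Module.finrank ℝ E) → VField E M) (f : Fin (Module.finrank ℝ E) → M → ℝ),
      (∀ i, SmoothVField (X i)) ∧ (∀ i, SmoothFun E (f i)) ∧
      ∀ᶠ p in 𝓝 m, ∀ L : TangentSpace 𝓘(ℝ, E) p →L[ℝ] ℝ,
        L = ∑ i, L (X i p) • differential E (f i) p := by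
  have hm := mem_chart_source E m
  let b := Module.finBasis ℝ E
  choose X hX hXb using fun i => exists_smoothVField_eventuallyEq hm (b i)
  choose f hf hfb using fun i => exists_smoothFun_inChart hm (b.coord i).toContinuousLinearMap
  refine ⟨X, f, hX, hf, ?_⟩
  filter_upwards [eventually_all.2 hXb, eventually_all.2 fun i => eventually_eventually_nhds.2 (hfb i),
    (chartAt E m).open_source.mem_nhds hm] with p h1 h2 hp L
  refine ContinuousLinearMap.ext fun w => ?_
  have h3 : ∀ i, differential E (f i) p w = b.coord i (chartDeriv m p w) := fun i =>
    differential_apply_of_eventuallyEq_chart (hf i) hp (h2 i) w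
  have h4 := congrArg (fun u : E => L (chartInv m p u)) (b.sum_repr (chartDeriv m p w))
  have h5 : L (chartInv m p (chartDeriv m p w)) = L w := congrArg L (chartInv_chartDeriv hp w)
  refine (h4.trans h5).symm.trans ?_
  have h6 : (∑ i, L (X i p) • differential E (f i) p) w =
      ∑ i, L (X i p) * differential E (f i) p w :=
    sum_apply (F := E →L[ℝ] ℝ) _ _ _
  refine Eq.trans ?_ h6.symm
  refine (map_sum ((L : E →L[ℝ] ℝ).comp (chartInv m p : E →L[ℝ] E)) _ _).trans ?_
  refine Finset.sum_congr rfl fun i _ => ?_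
  refine (map_smul ((L : E →L[ℝ] ℝ).comp (chartInv m p : E →L[ℝ] E)) _ _).trans ?_
  rw [h3 i]
  refine (mul_comm _ _).trans ?_
  exact congrArg (fun u : TangentSpace 𝓘(ℝ, E) p => L u * b.coord i (chartDeriv m p w)) (h1 i).symm

/-- The bracket of two families of functions is differentiable jointly in the parameter and the
point. -/
theorem mdifferentiableAt_bracket [FiniteDimensional ℝ E] [T2Space M] (P : PoissonStructure E M)
    {κ l : B × M → ℝ} (hκ : ContMDiffAt (𝓘(ℝ, V).prod 𝓘(ℝ, E)) 𝓘(ℝ, ℝ) ∞ κ (x, m))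
    (hl : ContMDiffAt (𝓘(ℝ, V).prod 𝓘(ℝ, E)) 𝓘(ℝ, ℝ) ∞ l (x, m)) :
    MDifferentiableAt (𝓘(ℝ, V).prod 𝓘(ℝ, E)) 𝓘(ℝ, ℝ)
      (fun q => P.bracket (fun p => κ (q.1, p)) (fun p => l (q.1, p)) q.2) (x, m) := by
  obtain ⟨X, f, hX, hf, h⟩ := exists_coframe (E := E) m
  -- Expanding `dκ` in the coframe gives `{κ_b, l_b} = ∑ dκ_b(X_i) dl_b(π♯ df_i)`. Only derivatives
  -- along smooth fields not depending on the parameter occur.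
  have h1 : MDifferentiableAt (𝓘(ℝ, V).prod 𝓘(ℝ, E)) 𝓘(ℝ, ℝ)
      (∑ i, (fun q : B × M => fiberDeriv E κ q.2 q.1 (X i q.2)) *
        fun q => fiberDeriv E l q.2 q.1 (P.sharpField (differential E (f i)) q.2)) (x, m) :=
    MDifferentiableAt.sum fun i _ => (mdifferentiableAt_fiberDeriv_apply hκ (hX i m)).mul
      (mdifferentiableAt_fiberDeriv_apply hl (P.smoothVField_hamiltonian (hf i) m))
  refine h1.congr_of_eventuallyEq ?_
  filter_upwards [(continuousAt_snd (p := (x, m))).tendsto.eventually h] with q hq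
  have h2 : P.sharp q.2 (fiberDeriv E κ q.2 q.1) =
      ∑ i, fiberDeriv E κ q.2 q.1 (X i q.2) • P.sharp q.2 (differential E (f i) q.2) := by
    refine (congrArg (P.sharp q.2) (hq (fiberDeriv E κ q.2 q.1))).trans ?_
    rw [map_sum]
    exact Finset.sum_congr rfl fun i _ => map_smul _ _ _
  refine (congrArg (fiberDeriv E l q.2 q.1) h2).trans ?_
  refine (map_sum (fiberDeriv E l q.2 q.1) _ _).trans ?_
  rw [Finset.sum_apply]
  exact Finset.sum_congr rfl fun i _ => map_smul (fiberDeriv E l q.2 q.1) _ _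

/-- The derivative of the bracket of two families of functions with respect to the parameter. -/
theorem mvfderiv_bracket_fst [FiniteDimensional ℝ E] (P : PoissonStructure E M)
    {κ l : B × M → ℝ} (hκ : ContMDiffAt (𝓘(ℝ, V).prod 𝓘(ℝ, E)) 𝓘(ℝ, ℝ) ∞ κ (x, m))
    (hl : ContMDiffAt (𝓘(ℝ, V).prod 𝓘(ℝ, E)) 𝓘(ℝ, ℝ) ∞ l (x, m)) (ξ : TangentSpace 𝓘(ℝ, V) x) :
    mvfderiv 𝓘(ℝ, V) (fun b => P.bracket (fun p => κ (b, p)) (fun p => l (b, p)) m) x ξ =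
      P.bracket (fun p => mvfderiv 𝓘(ℝ, V) (fun b => κ (b, p)) x ξ) (fun p => l (x, p)) m +
      P.bracket (fun p => κ (x, p)) (fun p => mvfderiv 𝓘(ℝ, V) (fun b => l (b, p)) x ξ) m := by
  -- At fixed `m` the bracket is a bilinear expression in the two differentials with constant
  -- coefficient `π♯`. The Leibniz rule applies, and exchanging derivatives turns each term back
  -- into a bracket.
  let S : (E →L[ℝ] ℝ) →L[ℝ] E := LinearMap.toContinuousLinearMap (P.sharp m : (E →L[ℝ] ℝ) →ₗ[ℝ] E)
  have hk := (hasFDerivAt_inChart_fiberDeriv hκ).differentiableAt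
  have hl' := (hasFDerivAt_inChart_fiberDeriv hl).differentiableAt
  have hx := mem_chart_source V x
  have h1 : HasFDerivAt (fun v => inChart V x (fiberDeriv E l m) v
      (S (inChart V x (fiberDeriv E κ m) v))) _ (extChartAt 𝓘(ℝ, V) x x) :=
    hl'.hasFDerivAt.clm_apply (S.hasFDerivAt.comp (extChartAt 𝓘(ℝ, V) x x) hk.hasFDerivAt)
  have h2 := mvfderiv_eq_fderiv_inChart hx (mdifferentiableAt_of_inChart
    (f := fun b => P.bracket (fun p => κ (b, p)) (fun p => l (b, p)) m) h1.differentiableAt) ξ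
  have h3 := DFunLike.congr_fun h1.fderiv (chartDeriv x x ξ)
  have h4 := mvfderiv_eq_fderiv_inChart hx (mdifferentiableAt_fiberDeriv hκ) ξ
  have h5 := mvfderiv_eq_fderiv_inChart hx (mdifferentiableAt_fiberDeriv hl) ξ
  refine (h2.trans h3).trans ?_
  have hκ' : (mvfderiv 𝓘(ℝ, V) (fiberDeriv E κ m) x ξ : E →L[ℝ] ℝ) =
      differential E (fun p => mvfderiv 𝓘(ℝ, V) (fun b => κ (b, p)) x ξ) m :=
    ContinuousLinearMap.ext fun w => mvfderiv_fiberDeriv hκ ξ w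
  have hl'' : (mvfderiv 𝓘(ℝ, V) (fiberDeriv E l m) x ξ : E →L[ℝ] ℝ) =
      differential E (fun p => mvfderiv 𝓘(ℝ, V) (fun b => l (b, p)) x ξ) m :=
    ContinuousLinearMap.ext fun w => mvfderiv_fiberDeriv hl ξ w
  have h6 : ∀ y : B, y = x → ∀ v : V,
    (fiberDeriv E l m y) (S (fderiv ℝ (inChart V x (fiberDeriv E κ m)) (extChartAt 𝓘(ℝ, V) x x) v))
      + (fderiv ℝ (inChart V x (fiberDeriv E l m)) (extChartAt 𝓘(ℝ, V) x x) v)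
        (S (fiberDeriv E κ m y)) =
    (fiberDeriv E l m x) (S (fderiv ℝ (inChart V x (fiberDeriv E κ m)) (extChartAt 𝓘(ℝ, V) x x) v))
      + (fderiv ℝ (inChart V x (fiberDeriv E l m)) (extChartAt 𝓘(ℝ, V) x x) v)
        (S (fiberDeriv E κ m x)) := by rintro _ rfl _; rfl
  refine (h6 _ (chart_symm_mem hx) _).trans ?_
  exact congrArg₂ (· + ·) (congrArg (fun L : E →L[ℝ] ℝ => fiberDeriv E l m x (S L))
    (h4.symm.trans hκ')) (congrArg (fun L : E →L[ℝ] ℝ => L (S (fiberDeriv E κ m x)))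
    (h5.symm.trans hl''))

end JointBracket

/-! ### Actions with hamiltonian generators are Poisson -/

section PoissonActions

open Filter Topology

variable {EG : Type*} [NormedAddCommGroup EG] [NormedSpace ℝ EG]
  {G : Type*} [TopologicalSpace G] [ChartedSpace EG G] [Group G] [LieGroup 𝓘(ℝ, EG) ∞ G]
  {E : Type*} [NormedAddCommGroup E] [NormedSpace ℝ E]
  {M : Type*} [TopologicalSpace M] [ChartedSpace E M] [IsManifold 𝓘(ℝ, E) ∞ M]
  {F : Type*} [NormedAddCommGroup F] [NormedSpace ℝ F]
  {P : PoissonStructure E M} {Φ : G → M → M}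

theorem IsSmoothAction.contMDiff_comp (hΦ : IsSmoothAction EG E Φ) {u : M → F}
    (hu : ContMDiff 𝓘(ℝ, E) 𝓘(ℝ, F) ∞ u) :
    ContMDiff (𝓘(ℝ, EG).prod 𝓘(ℝ, E)) 𝓘(ℝ, F) ∞ (fun q : G × M => u (Φ q.1 q.2)) :=
  hu.comp hΦ.smooth

/-- The minus sign comes from the definition of the generator: the orbit map itself has derivative
`-ξ_M`. -/
theorem IsSmoothAction.mvfderiv_comp_orbit (hΦ : IsSmoothAction EG E Φ) {u : M → F} {m : M}
    (hu : MDifferentiableAt 𝓘(ℝ, E) 𝓘(ℝ, F) u m) (ξ : LieAlg EG G) :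
    mvfderiv 𝓘(ℝ, EG) (fun h => u (Φ h m)) 1 ξ = -mvfderiv 𝓘(ℝ, E) u m (generator Φ ξ m) := by
  have h1 := mfderiv_comp_apply_of_eq (f := fun h => Φ h m) (1 : G) hu
    ((hΦ.contMDiff_orbit m).mdifferentiableAt (by simp)) (hΦ.one m) ξ
  refine h1.trans ?_
  refine Eq.trans ?_ (map_neg (mvfderiv 𝓘(ℝ, E) u m : E →L[ℝ] F) (generator Φ ξ m))
  exact congrArg (mvfderiv 𝓘(ℝ, E) u m : E →L[ℝ] F) (neg_neg (_ : E)).symm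

theorem PoissonStructure.bracket_neg_left (f g : M → ℝ) (m : M) :
    P.bracket (fun p => -f p) g m = -P.bracket f g m := by
  rw [P.bracket_apply, differential_neg]
  refine (congrArg (differential E g m) (map_neg (P.sharp m) (differential E f m))).trans ?_
  exact map_neg (differential E g m) _

theorem PoissonStructure.bracket_neg_right (f g : M → ℝ) (m : M) :
    P.bracket f (fun p => -g p) m = -P.bracket f g m := by
  rw [P.bracket_skew, P.bracket_neg_left, ← P.bracket_skew]

variable [FiniteDimensional ℝ E] [T2Space M]

theorem IsSmoothAction.mdifferentiableAt_bracket (hΦ : IsSmoothAction EG E Φ) {u v : M → ℝ}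
    (hu : SmoothFun E u) (hv : SmoothFun E v) (g : G) (m : M) :
    MDifferentiableAt (𝓘(ℝ, EG).prod 𝓘(ℝ, E)) 𝓘(ℝ, ℝ)
      (fun q : G × M => P.bracket (fun p => u (Φ q.1 p)) (fun p => v (Φ q.1 p)) q.2) (g, m) :=
  PoissonMomentum.mdifferentiableAt_bracket P (hΦ.contMDiff_comp hu (g, m))
    (hΦ.contMDiff_comp hv (g, m))

theorem IsSmoothAction.mdifferentiableAt_bracket_orbit (hΦ : IsSmoothAction EG E Φ) {u v : M → ℝ}
    (hu : SmoothFun E u) (hv : SmoothFun E v) (g : G) (m : M) :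
    MDifferentiableAt 𝓘(ℝ, EG) 𝓘(ℝ, ℝ)
      (fun h => P.bracket (fun p => u (Φ h p)) (fun p => v (Φ h p)) (Φ h⁻¹ m)) g :=
  (hΦ.mdifferentiableAt_bracket hu hv g (Φ g⁻¹ m)).comp g (f := fun h => (h, Φ h⁻¹ m))
    (mdifferentiableAt_id.prodMk ((hΦ.contMDiff_orbit_inv m).mdifferentiableAt (by simp)))

/-- Actions with hamiltonian generators preserve the Poisson bracket infinitesimally. -/
theorem IsSmoothAction.mvfderiv_bracket_orbit (hΦ : IsSmoothAction EG E Φ) {u v k : M → ℝ}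
    (hu : SmoothFun E u) (hv : SmoothFun E v) (hk : SmoothFun E k) {ξ : LieAlg EG G}
    (hξ : generator Φ ξ = P.sharpField (differential E k)) (m : M) :
    mvfderiv 𝓘(ℝ, EG)
      (fun h => P.bracket (fun p => u (Φ h p)) (fun p => v (Φ h p)) (Φ h⁻¹ m)) 1 ξ = 0 := by
  let R : G × M → ℝ := fun q => P.bracket (fun p => u (Φ q.1 p)) (fun p => v (Φ q.1 p)) q.2
  have h1m : Φ (1 : G)⁻¹ m = m := by rw [inv_one, hΦ.one]
  have hR : MDifferentiableAt (𝓘(ℝ, EG).prod 𝓘(ℝ, E)) 𝓘(ℝ, ℝ) R (1, m) :=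
    hΦ.mdifferentiableAt_bracket hu hv 1 m
  have ho : MDifferentiableAt 𝓘(ℝ, EG) 𝓘(ℝ, E) (fun h => Φ h⁻¹ m) (1 : G) :=
    (hΦ.contMDiff_orbit_inv m).mdifferentiableAt (by simp)
  have h1 := mvfderiv_comp_apply_of_eq (I := 𝓘(ℝ, EG).prod 𝓘(ℝ, E)) (I' := 𝓘(ℝ, EG))
    (f := fun h : G => (h, Φ h⁻¹ m)) (1 : G) hR (mdifferentiableAt_id.prodMk ho)
    (Prod.ext rfl h1m) ξ
  have h2 : (mfderiv 𝓘(ℝ, EG) (𝓘(ℝ, EG).prod 𝓘(ℝ, E)) (fun h : G => (h, Φ h⁻¹ m)) 1 ξ : EG × E) =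
      ((ξ : EG), (generator Φ ξ m : E)) := by
    have h3 := DFunLike.congr_fun (mfderiv_prodMk (mdifferentiableAt_id (I := 𝓘(ℝ, EG))) ho) ξ
    have h4 : (mfderiv 𝓘(ℝ, EG) 𝓘(ℝ, EG) (id : G → G) 1 ξ : EG) = ξ := by rw [mfderiv_id]; rfl
    exact h3.trans (Prod.ext h4 (hΦ.generator_eq ξ m).symm)
  have h5 := mfderiv_prod_eq_add_apply (I := 𝓘(ℝ, EG)) (I' := 𝓘(ℝ, E)) (I'' := 𝓘(ℝ, ℝ))
    (f := R) (v := ((ξ : EG), (generator Φ ξ m : E))) hR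
  refine h1.trans ((congrArg (fun w : EG × E => (mvfderiv (𝓘(ℝ, EG).prod 𝓘(ℝ, E)) R (1, m) :
    EG × E →L[ℝ] ℝ) w) h2).trans (h5.trans ?_))
  have hone : ∀ w : M → ℝ, (fun p => w (Φ (1 : G) p)) = w := fun w => funext fun p => by rw [hΦ.one]
  -- The group variable contributes `-{{k, u}, v} - {u, {k, v}}` and the point variable contributes
  -- `{k, {u, v}}`; the sum vanishes by the Jacobi identity.
  have h6 : mvfderiv 𝓘(ℝ, EG) (fun z => R (z, m)) 1 ξ =
      -P.bracket (P.bracket k u) v m - P.bracket u (P.bracket k v) m := by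
    refine (mvfderiv_bracket_fst P (hΦ.contMDiff_comp hu (1, m)) (hΦ.contMDiff_comp hv (1, m))
      ξ).trans ?_
    have h7 : ∀ w : M → ℝ, SmoothFun E w →
        (fun p => mvfderiv 𝓘(ℝ, EG) (fun h => w (Φ h p)) 1 ξ) = fun p => -P.bracket k w p :=
      fun w hw => funext fun p => by
        refine (hΦ.mvfderiv_comp_orbit (hw.mdifferentiableAt p) ξ).trans ?_
        rw [hξ]
        rfl
    change P.bracket (fun p => mvfderiv 𝓘(ℝ, EG) (fun h => u (Φ h p)) 1 ξ) (fun p => v (Φ 1 p)) m +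
      P.bracket (fun p => u (Φ 1 p)) (fun p => mvfderiv 𝓘(ℝ, EG) (fun h => v (Φ h p)) 1 ξ) m = _
    rw [h7 u hu, h7 v hv, hone, hone, P.bracket_neg_left, P.bracket_neg_right, sub_eq_add_neg]
  have h8 : mvfderiv 𝓘(ℝ, E) (fun z => R (1, z)) m (generator Φ ξ m) =
      P.bracket k (P.bracket u v) m := by
    have h9 : (fun z => R (1, z)) = P.bracket u v := by
      funext z
      change P.bracket (fun p => u (Φ 1 p)) (fun p => v (Φ 1 p)) z = _
      rw [hone, hone]
    rw [h9, hξ]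
    rfl
  refine (congrArg₂ (fun a b : ℝ => a + b) h6 h8).trans ?_
  have h10 := P.bracket_jacobi hk hu hv m
  have h11 := P.bracket_skew (P.bracket u v) k m
  have h12 : P.bracket (P.bracket v k) u m = P.bracket u (P.bracket k v) m := by
    have h13 : P.bracket v k = fun p => -P.bracket k v p := funext fun p => P.bracket_skew v k p
    rw [h13, P.bracket_neg_left, P.bracket_skew, neg_neg]
  linarith

/-- Actions of connected groups with hamiltonian generators are Poisson. -/
theorem IsSmoothAction.isPoissonAction [ConnectedSpace G] [FiniteDimensional ℝ EG]
    (hΦ : IsSmoothAction EG E Φ) {k : LieAlg EG G → M → ℝ} (hk : ∀ ξ, SmoothFun E (k ξ))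
    (hgen : ∀ ξ, generator Φ ξ = P.sharpField (differential E (k ξ))) : IsPoissonAction P Φ := by
  intro g u v hu hv m
  -- Its value at `g` is the bracket of the pulled back functions at `m`, and its value at the
  -- identity is the bracket at `Φ g m`. It suffices that `f` is constant.
  let f : G → ℝ := fun h => P.bracket (fun p => u (Φ h p)) (fun p => v (Φ h p)) (Φ h⁻¹ (Φ g m))
  have hf : ∀ h, MDifferentiableAt 𝓘(ℝ, EG) 𝓘(ℝ, ℝ) f h := fun h =>
    hΦ.mdifferentiableAt_bracket_orbit hu hv h _
  have hd : ∀ h w, mvfderiv 𝓘(ℝ, EG) f h w = 0 := fun h w => by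
    -- Left translation by `h` moves the derivative to the identity, at the cost of replacing `u`,
    -- `v` by `u ∘ Φ_h`, `v ∘ Φ_h`.
    have h1 := mfderiv_leftField (hf h) (maurerCartan h w)
    rw [leftField_maurerCartan] at h1
    refine h1.trans ?_
    have h2 : ∀ u : M → ℝ, SmoothFun E u → SmoothFun E (fun p => u (Φ h p)) := fun u hu =>
      ContMDiff.comp hu (hΦ.contMDiff_apply h)
    have h3 : (fun x => f (h * x)) = fun x => P.bracket (fun p => u (Φ h (Φ x p)))
        (fun p => v (Φ h (Φ x p))) (Φ x⁻¹ (Φ h⁻¹ (Φ g m))) := by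
      funext x
      simp only [f, mul_inv_rev, hΦ.mul]
    rw [h3]
    exact hΦ.mvfderiv_bracket_orbit (h2 u hu) (h2 v hv) (hk _) (hgen _) _
  have h4 := eq_of_mvfderiv_eq_zero hf hd g 1
  simpa only [f, ← hΦ.mul, inv_mul_cancel, inv_one, one_mul, hΦ.one] using h4

end PoissonActions

/-! ### Derivatives of compositions with continuous linear maps -/

section

variable {E : Type*} [NormedAddCommGroup E] [NormedSpace ℝ E]
  {M : Type*} [TopologicalSpace M] [ChartedSpace E M]
  {F : Type*} [NormedAddCommGroup F] [NormedSpace ℝ F]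
  {F' : Type*} [NormedAddCommGroup F'] [NormedSpace ℝ F']

theorem mdifferentiableAt_clm (L : F →L[ℝ] F') {f : M → F} {m : M}
    (hf : MDifferentiableAt 𝓘(ℝ, E) 𝓘(ℝ, F) f m) :
    MDifferentiableAt 𝓘(ℝ, E) 𝓘(ℝ, F') (fun p => L (f p)) m :=
  MDifferentiableAt.comp m L.mdifferentiableAt hf

theorem mvfderiv_clm (L : F →L[ℝ] F') {f : M → F} {m : M}
    (hf : MDifferentiableAt 𝓘(ℝ, E) 𝓘(ℝ, F) f m) (w : TangentSpace 𝓘(ℝ, E) m) :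
    mvfderiv 𝓘(ℝ, E) (fun p => L (f p)) m w = L (mvfderiv 𝓘(ℝ, E) f m w) := by
  have h := mfderiv_comp_apply m (L.mdifferentiableAt (x := f m)) hf w
  rw [L.mfderiv_eq] at h
  exact h

end

/-! ### The adjoint action and its derivative -/

section Adjoint

open Filter Topology

variable {EG : Type*} [NormedAddCommGroup EG] [NormedSpace ℝ EG]
  {G : Type*} [TopologicalSpace G] [ChartedSpace EG G] [Group G] [LieGroup 𝓘(ℝ, EG) ∞ G]

variable (EG) in
/-- The adjoint action as a continuous linear map on the model space. -/
def adjointCLM (g : G) : EG →L[ℝ] EG :=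
  mfderiv 𝓘(ℝ, EG) 𝓘(ℝ, EG) (fun h : G => g * h * g⁻¹) 1

theorem contMDiff_conj (g : G) : ContMDiff 𝓘(ℝ, EG) 𝓘(ℝ, EG) ∞ (fun h : G => g * h * g⁻¹) :=
  (contMDiff_mul_right (I := 𝓘(ℝ, EG)) (n := ∞) (a := g⁻¹)).comp
    (contMDiff_mul_left (I := 𝓘(ℝ, EG)) (n := ∞) (a := g))

theorem adjointCLM_mul (g h : G) :
    adjointCLM EG (g * h) = (adjointCLM EG g).comp (adjointCLM EG h) := by
  refine ContinuousLinearMap.ext fun ξ => ?_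
  have h1 := mfderiv_comp_apply_of_eq (f := fun k : G => h * k * h⁻¹) (1 : G)
    ((contMDiff_conj (EG := EG) g).mdifferentiableAt (x := 1) (by simp))
    ((contMDiff_conj (EG := EG) h).mdifferentiableAt (x := 1) (by simp)) (by simp) ξ
  refine Eq.trans ?_ h1
  have h2 : (fun k : G => g * h * k * (g * h)⁻¹) =
      (fun k : G => g * k * g⁻¹) ∘ fun k : G => h * k * h⁻¹ := by
    funext k; simp [mul_assoc]
  have h3 : ∀ f₁ f₂ : G → G, f₁ = f₂ → (mfderiv 𝓘(ℝ, EG) 𝓘(ℝ, EG) f₁ 1 ξ : EG) =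
    mfderiv 𝓘(ℝ, EG) 𝓘(ℝ, EG) f₂ 1 ξ := by rintro _ _ rfl; rfl
  exact h3 _ _ h2

theorem adjointCLM_one : adjointCLM EG (1 : G) = ContinuousLinearMap.id ℝ EG := by
  refine ContinuousLinearMap.ext fun ξ => ?_
  have h2 : ∀ f : G → G, f = id → (mfderiv 𝓘(ℝ, EG) 𝓘(ℝ, EG) f 1 ξ : EG) = ξ := by
    rintro _ rfl
    rw [mfderiv_id]
    rfl
  exact h2 _ (by funext k; simp)

variable (EG) in
/-- Conjugation, read in the chart at the identity. -/
def conjInChart (q : G × G) : EG := extChartAt 𝓘(ℝ, EG) (1 : G) (q.1 * q.2 * q.1⁻¹)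

theorem contMDiffAt_conjInChart (g : G) :
    ContMDiffAt (𝓘(ℝ, EG).prod 𝓘(ℝ, EG)) 𝓘(ℝ, EG) ∞ (conjInChart EG (G := G)) (g, 1) := by
  have h1 : ContMDiff (𝓘(ℝ, EG).prod 𝓘(ℝ, EG)) 𝓘(ℝ, EG) ∞
      (fun q : G × G => q.1 * q.2 * q.1⁻¹) :=
    (contMDiff_fst.mul contMDiff_snd).mul ((contMDiff_inv 𝓘(ℝ, EG) ∞).comp contMDiff_fst)
  exact ContMDiffAt.comp_of_eq (contMDiffAt_chart (mem_chart_source EG (1 : G))) (h1 _) (by simp)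

/-- Conjugation fixes the identity, where the chart has identity derivative, so composing with the
chart does not change the derivative. This presents `Ad` as a partial derivative of a function with
values in a vector space. -/
theorem adjointCLM_eq_fiberDeriv (g : G) :
    adjointCLM EG g = fiberDeriv EG (conjInChart EG) (1 : G) g := by
  refine ContinuousLinearMap.ext fun ξ => ?_
  have h1 := mfderiv_comp_apply_of_eq (f := fun k : G => g * k * g⁻¹) (1 : G)
    ((contMDiffAt_chart (mem_chart_source EG (1 : G))).mdifferentiableAt (by simp))
    ((contMDiff_conj (EG := EG) g).mdifferentiableAt (x := 1) (by simp)) (by simp) ξ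
  rw [← chartDeriv_eq_mfderiv (mem_chart_source EG (1 : G)), chartDeriv_self] at h1
  exact h1.symm

theorem mdifferentiableAt_adjointCLM (g : G) :
    MDifferentiableAt 𝓘(ℝ, EG) 𝓘(ℝ, EG →L[ℝ] EG) (adjointCLM EG (G := G)) g := by
  have h : adjointCLM EG (G := G) = fiberDeriv EG (conjInChart EG) (1 : G) :=
    funext adjointCLM_eq_fiberDeriv
  rw [h]
  exact mdifferentiableAt_fiberDeriv (contMDiffAt_conjInChart g)

/-- The derivative of a function on the group along a conjugation orbit. -/
theorem mvfderiv_conj {F : Type*} [NormedAddCommGroup F] [NormedSpace ℝ F] {f : G → F} {k : G}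
    (hf : MDifferentiableAt 𝓘(ℝ, EG) 𝓘(ℝ, F) f k) (η : LieAlg EG G) :
    mvfderiv 𝓘(ℝ, EG) (fun h => f (h * k * h⁻¹)) 1 η =
      mvfderiv 𝓘(ℝ, EG) (fun h => f (h * k)) 1 η - mvfderiv 𝓘(ℝ, EG) f k (leftField η k) := by
  have h0 : ∀ l, l = k → MDifferentiableAt 𝓘(ℝ, EG) 𝓘(ℝ, F) f l := by rintro _ rfl; exact hf
  have hm : ContMDiff (𝓘(ℝ, EG).prod 𝓘(ℝ, EG)) 𝓘(ℝ, EG) ∞ (fun q : G × G => q.1 * k * q.2) :=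
    (contMDiff_fst.mul contMDiff_const).mul contMDiff_snd
  let φ : G × G → F := fun q => f (q.1 * k * q.2)
  have hφ : ∀ q : G × G, q = 1 → MDifferentiableAt (𝓘(ℝ, EG).prod 𝓘(ℝ, EG)) 𝓘(ℝ, F) φ q := by
    rintro _ rfl
    exact MDifferentiableAt.comp (1 : G × G) (f := fun q : G × G => q.1 * k * q.2)
      (h0 _ (by simp)) (hm.mdifferentiableAt (by simp))
  have h1 := mfderiv_comp_apply_of_eq (I := 𝓘(ℝ, EG)) (I' := 𝓘(ℝ, EG).prod 𝓘(ℝ, EG))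
    (f := fun h : G => (h, h⁻¹)) (1 : G) (hφ 1 rfl)
    (mdifferentiableAt_id.prodMk (mdifferentiableAt_inv (EG := EG) 1)) (Prod.ext rfl inv_one) η
  have h2 : (mfderiv 𝓘(ℝ, EG) (𝓘(ℝ, EG).prod 𝓘(ℝ, EG)) (fun h : G => (h, h⁻¹)) 1 η : EG × EG) =
      ((η : EG), -(toModel η)) := by
    have h3 := DFunLike.congr_fun (mfderiv_prodMk (mdifferentiableAt_id (I := 𝓘(ℝ, EG)))
      (mdifferentiableAt_inv (EG := EG) (1 : G))) η
    have h4 : (mfderiv 𝓘(ℝ, EG) 𝓘(ℝ, EG) (id : G → G) 1 η : EG) = η := by rw [mfderiv_id]; rfl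
    exact h3.trans (Prod.ext h4 (mfderiv_inv_one η))
  have h5 := mfderiv_prod_eq_add_apply (I := 𝓘(ℝ, EG)) (I' := 𝓘(ℝ, EG)) (I'' := 𝓘(ℝ, F))
    (f := φ) (v := ((η : EG), -(toModel η))) (hφ 1 rfl)
  refine h1.trans ((congrArg (fun w : EG × EG => (mfderiv (𝓘(ℝ, EG).prod 𝓘(ℝ, EG)) 𝓘(ℝ, F) φ 1 :
    EG × EG →L[ℝ] F) w) h2).trans (h5.trans ?_))
  have h6 : (fun z => φ (z, (1 : G × G).2)) = fun h => f (h * k) := by funext z; simp [φ]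
  have h7 : (fun z => φ ((1 : G × G).1, z)) = fun h => f (k * h) := by funext z; simp [φ]
  have h8 : ∀ f₁ f₂ : G → F, f₁ = f₂ → ∀ w : EG, (mfderiv 𝓘(ℝ, EG) 𝓘(ℝ, F) f₁ 1 w : F) =
    mfderiv 𝓘(ℝ, EG) 𝓘(ℝ, F) f₂ 1 w := by rintro _ _ rfl _; rfl
  rw [sub_eq_add_neg]
  refine congrArg₂ (fun a b : F => a + b) (h8 _ _ h6 η) ((h8 _ _ h7 _).trans ?_)
  refine (map_neg (mfderiv 𝓘(ℝ, EG) 𝓘(ℝ, F) (fun h => f (k * h)) 1 : EG →L[ℝ] F) _).trans ?_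
  exact congrArg Neg.neg (mfderiv_leftField hf η).symm

/-- The derivative of the adjoint action is the Lie bracket. -/
theorem mvfderiv_adjointCLM [CompleteSpace EG] (η ξ : LieAlg EG G) :
    mvfderiv 𝓘(ℝ, EG) (adjointCLM EG (G := G)) 1 η ξ = (⁅η, ξ⁆ : LieAlg EG G) := by
  have h : adjointCLM EG (G := G) = fiberDeriv EG (conjInChart EG) (1 : G) :=
    funext adjointCLM_eq_fiberDeriv
  rw [h]
  have hm := mem_chart_source EG (1 : G)
  let e : G → EG := extChartAt 𝓘(ℝ, EG) (1 : G)
  have he : ∀ k ∈ (chartAt EG (1 : G)).source, ContMDiffAt 𝓘(ℝ, EG) 𝓘(ℝ, EG) ∞ e k :=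
    fun k hk => contMDiffAt_chart hk
  -- Exchanging derivatives, one first differentiates `h ↦ e (h k h⁻¹)` in direction `η`; this is a
  -- derivative of `h ↦ e (h k)` minus the left-invariant one.
  refine (mvfderiv_fiberDeriv (contMDiffAt_conjInChart 1) η ξ).trans ?_
  have hκ : ContMDiffAt (𝓘(ℝ, EG).prod 𝓘(ℝ, EG)) 𝓘(ℝ, EG) ∞ (fun q : G × G => e (q.1 * q.2))
      (1, 1) :=
    ContMDiffAt.comp_of_eq (he 1 hm) (contMDiff_mul 𝓘(ℝ, EG) ∞ _) (by simp)
  have hev : (fun k => mvfderiv 𝓘(ℝ, EG) (fun h => conjInChart EG (h, k)) 1 η) =ᶠ[𝓝 (1 : G)]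
      fun k => mvfderiv 𝓘(ℝ, EG) (fun h => e (h * k)) 1 η -
        mvfderiv 𝓘(ℝ, EG) e k (leftField η k) := by
    filter_upwards [(chartAt EG (1 : G)).open_source.mem_nhds hm] with k hk
    exact mvfderiv_conj ((he k hk).mdifferentiableAt (by simp)) η
  have hκ' : ContMDiffAt (𝓘(ℝ, EG).prod 𝓘(ℝ, EG)) 𝓘(ℝ, EG) ∞ (fun q : G × G => e (q.2 * q.1))
      (1, 1) :=
    ContMDiffAt.comp_of_eq (f := fun q : G × G => q.2 * q.1) (he 1 hm)
      ((contMDiff_snd.mul contMDiff_fst) _) (by simp)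
  let D : G → EG →L[ℝ] EG := fiberDeriv EG (fun q : G × G => e (q.1 * q.2)) 1
  have hD : MDifferentiableAt 𝓘(ℝ, EG) 𝓘(ℝ, EG →L[ℝ] EG) D 1 := mdifferentiableAt_fiberDeriv hκ
  have hDζ : ∀ ζ : LieAlg EG G, (fun k => mvfderiv 𝓘(ℝ, EG) e k (leftField ζ k)) =ᶠ[𝓝 (1 : G)]
      fun k => ContinuousLinearMap.apply ℝ EG (toModel ζ) (D k) := fun ζ => by
    filter_upwards [(chartAt EG (1 : G)).open_source.mem_nhds hm] with k hk
    exact mfderiv_leftField ((he k hk).mdifferentiableAt (by simp)) ζ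
  have hB : ∀ ζ : LieAlg EG G, MDifferentiableAt 𝓘(ℝ, EG) 𝓘(ℝ, EG)
      (fun k => mvfderiv 𝓘(ℝ, EG) e k (leftField ζ k)) 1 := fun ζ =>
    (mdifferentiableAt_clm _ hD).congr_of_eventuallyEq (hDζ ζ)
  have hA : MDifferentiableAt 𝓘(ℝ, EG) 𝓘(ℝ, EG)
      (fun k => mvfderiv 𝓘(ℝ, EG) (fun h => e (h * k)) 1 η) 1 :=
    mdifferentiableAt_clm (ContinuousLinearMap.apply ℝ EG (toModel η))
      (mdifferentiableAt_fiberDeriv hκ')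
  -- A second exchange of derivatives turns the first term into `η(ξ^L e)`. The total is `η(ξ^L e) -
  -- ξ(η^L e)`, the bracket as a commutator applied to the chart `e`.
  have h1 : mvfderiv 𝓘(ℝ, EG) (fun k => mvfderiv 𝓘(ℝ, EG) (fun h => e (h * k)) 1 η) 1 ξ =
      mvfderiv 𝓘(ℝ, EG) (fun k => mvfderiv 𝓘(ℝ, EG) e k (leftField ξ k)) 1 η := by
    refine (mvfderiv_fiberDeriv hκ η ξ).symm.trans ?_
    refine (mvfderiv_clm (ContinuousLinearMap.apply ℝ EG (toModel ξ)) hD η).symm.trans ?_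
    exact congrArg (fun L : EG →L[ℝ] EG => L η) (hDζ ξ).mfderiv_eq.symm
  have h2 : mvfderiv 𝓘(ℝ, EG) (fun k => mvfderiv 𝓘(ℝ, EG) (fun h => conjInChart EG (h, k)) 1 η)
      1 ξ = mvfderiv 𝓘(ℝ, EG) (fun k => mvfderiv 𝓘(ℝ, EG) (fun h => e (h * k)) 1 η) 1 ξ -
        mvfderiv 𝓘(ℝ, EG) (fun k => mvfderiv 𝓘(ℝ, EG) e k (leftField η k)) 1 ξ :=
    (congrArg (fun L : EG →L[ℝ] EG => L ξ) hev.mfderiv_eq).trans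
      (congrArg (fun L : EG →L[ℝ] EG => L ξ) (mvfderiv_sub hA (hB η)))
  have h3 := mvfderiv_mlieBracket (smoothVField_leftField η 1) (smoothVField_leftField ξ 1) (he 1 hm)
  rw [← leftField_bracket, leftField_one, leftField_one, leftField_one] at h3
  refine h2.trans (Eq.trans ?_ (h3.symm.trans ?_))
  · rw [h1]
  · have h4 : mvfderiv 𝓘(ℝ, EG) e 1 = ContinuousLinearMap.id ℝ EG :=
      (chartDeriv_eq_mfderiv hm).symm.trans (chartDeriv_self 1)
    rw [h4]
    rfl

end Adjoint

/-! ### Equivariance and the coadjoint equation -/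

section Equivariance

open Filter Topology

theorem smoothVField_clm {W : Type*} [NormedAddCommGroup W] [NormedSpace ℝ W] (L : W →L[ℝ] W) :
    SmoothVField (E := W) (M := W) (fun z => (L z : W)) :=
  contMDiff_vectorSpace_iff_contDiff.2 L.contDiff

variable {EG : Type*} [NormedAddCommGroup EG] [NormedSpace ℝ EG] [FiniteDimensional ℝ EG]
  {G : Type*} [TopologicalSpace G] [ChartedSpace EG G] [Group G] [LieGroup 𝓘(ℝ, EG) ∞ G]
  {E : Type*} [NormedAddCommGroup E] [NormedSpace ℝ E]
  {M : Type*} [TopologicalSpace M] [ChartedSpace E M] [IsManifold 𝓘(ℝ, E) ∞ M]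
  {P : PoissonStructure E M} {Φ : G → M → M} {μ : M → LieDual EG}

variable (EG G) in
/-- The derivative of the adjoint action. -/
def adCLM : EG →L[ℝ] EG →L[ℝ] EG := mvfderiv 𝓘(ℝ, EG) (adjointCLM EG (G := G)) 1

theorem adCLM_apply (η ξ : LieAlg EG G) :
    adCLM EG G (toModel η) (toModel ξ) = toModel (⁅η, ξ⁆ : LieAlg EG G) := by
  have : CompleteSpace EG := FiniteDimensional.complete ℝ EG
  exact mvfderiv_adjointCLM η ξ

variable (EG G) in
/-- The linear vector fields `z ↦ z ∘ ad_η` on the dual of the Lie algebra. -/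
def coadjointField : LieAlg EG G →ₗ[ℝ] VField (LieDual EG) (LieDual EG) where
  toFun η z := ((z : LieDual EG).comp (adCLM EG G (toModel η)) : LieDual EG)
  map_add' η ζ := funext fun z =>
    (congrArg (fun A => (z : LieDual EG).comp A) (map_add (adCLM EG G) (toModel η) (toModel ζ))).trans
      (ContinuousLinearMap.comp_add _ _ _)
  map_smul' c η := funext fun z =>
    (congrArg (fun A => (z : LieDual EG).comp A) (map_smul (adCLM EG G) c (toModel η))).trans
      (ContinuousLinearMap.comp_smul _ _ _)

theorem smoothVField_coadjointField (η : LieAlg EG G) : SmoothVField (coadjointField EG G η) :=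
  smoothVField_clm ((ContinuousLinearMap.compL ℝ EG EG ℝ).flip (adCLM EG G (toModel η)))

/-- Coadjoint orbits solve the coadjoint equation. -/
theorem solvesAt_coadjoint (z : LieDual EG) (g : G) :
    SolvesAt (invariantEquation (coadjointField EG G)) (fun h => z.comp (adjointCLM EG h)) g := by
  let L : ∀ z : LieDual EG, (EG →L[ℝ] EG) →L[ℝ] LieDual EG := ContinuousLinearMap.compL ℝ EG EG ℝ
  have hd : ∀ z : LieDual EG, ∀ g : G, MDifferentiableAt 𝓘(ℝ, EG) 𝓘(ℝ, LieDual EG)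
      (fun h => z.comp (adjointCLM EG h)) g := fun z g =>
    mdifferentiableAt_clm (L z) (mdifferentiableAt_adjointCLM g)
  refine solvesAt_invariantEquation_iff.2 ⟨hd z g, fun η => ?_⟩
  refine (mfderiv_leftField (hd z g) η).trans ?_
  have h1 : (fun h : G => z.comp (adjointCLM EG (g * h))) =
      fun h => L (z.comp (adjointCLM EG g)) (adjointCLM EG h) := by
    funext h
    rw [adjointCLM_mul]
    rfl
  rw [h1]
  exact mvfderiv_clm (L (z.comp (adjointCLM EG g))) (mdifferentiableAt_adjointCLM 1) η

/-- Replacing `g` by its inverse puts both sides in the form of solutions of an invariant equation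
on `G`. -/
theorem isEquivariant_iff : IsEquivariant Φ μ ↔
    ∀ (m : M) (g : G), μ (Φ g⁻¹ m) = (μ m).comp (adjointCLM EG g) := by
  constructor
  · intro h m g
    refine ContinuousLinearMap.ext fun ξ => ?_
    have := h g⁻¹ m ξ
    rwa [inv_inv] at this
  · intro h g m ξ
    have := h m g⁻¹
    rw [inv_inv] at this
    exact DFunLike.congr_fun this (toModel ξ)

theorem differential_pairing (hμ : ContMDiff 𝓘(ℝ, E) 𝓘(ℝ, LieDual EG) ∞ μ) (ξ : LieAlg EG G) :
    differential E (fun p => pairing (μ p) ξ) = pullbackTheta μ ξ :=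
  funext fun m => ContinuousLinearMap.ext fun w =>
    mvfderiv_clm (ContinuousLinearMap.apply ℝ ℝ (toModel ξ)) (hμ.mdifferentiable (by simp) m) w

theorem smoothFun_pairing (hμ : ContMDiff 𝓘(ℝ, E) 𝓘(ℝ, LieDual EG) ∞ μ) (ξ : LieAlg EG G) :
    SmoothFun E (fun p => pairing (μ p) ξ) :=
  (ContinuousLinearMap.apply ℝ ℝ (toModel ξ)).contMDiff.comp hμ

/-- The generator is the hamiltonian field of `μ^η`, so differentiating `μ^ξ` along it gives the
bracket. This is how brackets enter the equation for `g ↦ μ(Φ_{g⁻¹} m)`. -/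
theorem IsMomentumMap.mvfderiv_generator (hμ : IsMomentumMap P Φ μ) (η ξ : LieAlg EG G) (m : M) :
    mvfderiv 𝓘(ℝ, E) μ m (generator Φ η m) (toModel ξ) =
      P.bracket (fun p => pairing (μ p) η) (fun p => pairing (μ p) ξ) m := by
  rw [P.bracket_apply, differential_pairing hμ.smooth, differential_pairing hμ.smooth,
    hμ.generator_eq η]
  rfl

theorem IsSmoothAction.mvfderiv_comp_orbit_inv {F : Type*} [NormedAddCommGroup F] [NormedSpace ℝ F]
    {f : M → F} (hΦ : IsSmoothAction EG E Φ) (hf : ContMDiff 𝓘(ℝ, E) 𝓘(ℝ, F) ∞ f)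
    (η : LieAlg EG G) (m : M) (g : G) :
    mvfderiv 𝓘(ℝ, EG) (fun h => f (Φ h⁻¹ m)) g (leftField η g) =
      mvfderiv 𝓘(ℝ, E) f (Φ g⁻¹ m) (generator Φ η (Φ g⁻¹ m)) := by
  refine (mfderiv_comp_apply (f := fun h => Φ h⁻¹ m) g (hf.mdifferentiable (by simp) _)
    ((hΦ.contMDiff_orbit_inv m).mdifferentiableAt (by simp)) (leftField η g)).trans ?_
  exact congrArg (fun w : E => (mvfderiv 𝓘(ℝ, E) f (Φ g⁻¹ m) : E →L[ℝ] F) w)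
    (hΦ.mfderiv_orbit_inv η m g)

/-- A momentum map for an action of a connected group is equivariant if and only if it is a
Poisson map to the dual of the Lie algebra. -/
theorem IsMomentumMap.isEquivariant_iff [ConnectedSpace G] (hΦ : IsSmoothAction EG E Φ)
    (hμ : IsMomentumMap P Φ μ) :
    IsEquivariant Φ μ ↔ ∀ (ξ η : LieAlg EG G) (m : M),
      P.bracket (fun p => pairing (μ p) ξ) (fun p => pairing (μ p) η) m =
        pairing (μ m) ⁅ξ, η⁆ := by
  rw [PoissonMomentum.isEquivariant_iff]
  have hd : ∀ (m : M) (g : G), MDifferentiableAt 𝓘(ℝ, EG) 𝓘(ℝ, LieDual EG)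
      (fun h : G => μ (Φ h⁻¹ m)) g := fun m g =>
    (hμ.smooth.comp (hΦ.contMDiff_orbit_inv m)).mdifferentiable (by simp) g
  constructor
  · intro h ξ η m
    have h1 := hΦ.mvfderiv_comp_orbit_inv hμ.smooth ξ m 1
    have h2 := (solvesAt_invariantEquation_iff.1 (solvesAt_coadjoint (μ m) (1 : G))).2 ξ
    have h3 : (fun h : G => μ (Φ h⁻¹ m)) = fun h => (μ m).comp (adjointCLM EG h) := funext (h m)
    rw [h3] at h1
    have h4 : ∀ y, y = m → ∀ z, z = μ m →
        (mvfderiv 𝓘(ℝ, E) μ y (generator Φ ξ y) : LieDual EG) = coadjointField EG G ξ z →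
        (mvfderiv 𝓘(ℝ, E) μ m (generator Φ ξ m) : LieDual EG) = coadjointField EG G ξ (μ m) := by
      rintro _ rfl _ rfl h; exact h
    -- Equality of the two maps on `G` gives equality of their derivatives at the identity, which is
    -- the bracket relation.
    have h5 := h4 (Φ (1 : G)⁻¹ m) (by rw [inv_one, hΦ.one]) _
      (by rw [adjointCLM_one]; rfl) (h1.symm.trans h2)
    refine (hμ.mvfderiv_generator ξ η m).symm.trans ?_
    refine (DFunLike.congr_fun h5 (toModel η)).trans ?_
    exact congrArg (μ m) (adCLM_apply ξ η)
  · intro h m g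
    -- Conversely, the bracket relation at every point of the orbit makes `g ↦ μ(Φ_{g⁻¹} m)` a
    -- solution of the coadjoint equation. It agrees at the identity with `μ(m) ∘ Ad_g`, hence
    -- everywhere.
    have h1 : ∀ g, SolvesAt (invariantEquation (coadjointField EG G)) (fun h => μ (Φ h⁻¹ m)) g := by
      intro g
      refine solvesAt_invariantEquation_iff.2 ⟨hd m g, fun η => ?_⟩
      refine (hΦ.mvfderiv_comp_orbit_inv hμ.smooth η m g).trans ?_
      refine ContinuousLinearMap.ext fun ξ => ?_
      refine (hμ.mvfderiv_generator η ξ (Φ g⁻¹ m)).trans ((h η ξ _).trans ?_)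
      exact (congrArg (μ (Φ g⁻¹ m)) (adCLM_apply η ξ)).symm
    exact eqOn_of_solvesAt_invariantEquation smoothVField_coadjointField isOpen_univ
      isPreconnected_univ (fun g _ => h1 g) (fun g _ => solvesAt_coadjoint (μ m) g) (mem_univ 1)
      (by rw [inv_one, hΦ.one, adjointCLM_one]; rfl) (mem_univ g)

end Equivariance

/-! ### Classification of equivariant momentum maps -/

section MomentumMaps

variable {EG : Type*} [NormedAddCommGroup EG] [NormedSpace ℝ EG] [FiniteDimensional ℝ EG]
  {G : Type*} [TopologicalSpace G] [ChartedSpace EG G] [Group G] [LieGroup 𝓘(ℝ, EG) ∞ G]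
  {E : Type*} [NormedAddCommGroup E] [NormedSpace ℝ E] [FiniteDimensional ℝ E]
  {M : Type*} [TopologicalSpace M] [ChartedSpace E M] [IsManifold 𝓘(ℝ, E) ∞ M] [T2Space M]
  {P : PoissonStructure E M} {α : LieAlg EG G →ₗ[ℝ] OneForm E M}
  {H : LieAlg EG G →ₗ[ℝ] C^∞⟮𝓘(ℝ, E), M; 𝓘(ℝ, ℝ), ℝ⟯} {Φ : G → M → M} {μ : M → LieDual EG}

/-- A linear form on the Lie algebra as an element of the dual. -/
def dualOfLinear (f : LieAlg EG G →ₗ[ℝ] ℝ) : LieDual EG :=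
  LinearMap.toContinuousLinearMap (f : EG →ₗ[ℝ] ℝ)

theorem pairing_add (z w : LieDual EG) (ξ : LieAlg EG G) :
    pairing (z + w) ξ = pairing z ξ + pairing w ξ := rfl

theorem pairing_ext {z w : LieDual EG} (h : ∀ ξ : LieAlg EG G, pairing z ξ = pairing w ξ) :
    z = w := ContinuousLinearMap.ext h

/-- The map `M → 𝔤*` with components `H_ξ`. -/
def momentumOfHamiltonian (H : LieAlg EG G →ₗ[ℝ] C^∞⟮𝓘(ℝ, E), M; 𝓘(ℝ, ℝ), ℝ⟯) (m : M) :
    LieDual EG :=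
  dualOfLinear ({
    toFun := fun ξ => H ξ m
    map_add' := fun ξ η => by rw [map_add]; rfl
    map_smul' := fun r ξ => by rw [map_smul]; rfl } : LieAlg EG G →ₗ[ℝ] ℝ)

theorem contMDiff_momentumOfHamiltonian :
    ContMDiff 𝓘(ℝ, E) 𝓘(ℝ, LieDual EG) ∞ (momentumOfHamiltonian H) := fun m => by
  have hm := mem_chart_source E m
  have h : ContDiffOn ℝ ∞ (inChart E m (momentumOfHamiltonian H)) (extChartAt 𝓘(ℝ, E) m).target :=
    contDiffOn_clm_apply.2 fun ξ =>
      (smoothFun_coe (H (ξ : LieAlg EG G))).contDiffOn_inChart m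
  exact (contMDiffAt_iff_inChart hm).2
    (h.contDiffAt ((isOpen_chart_target m).mem_nhds (chart_mem_target hm)))

theorem contMDiff_add_const (hμ : ContMDiff 𝓘(ℝ, E) 𝓘(ℝ, LieDual EG) ∞ μ) (z : LieDual EG) :
    ContMDiff 𝓘(ℝ, E) 𝓘(ℝ, LieDual EG) ∞ (fun m => μ m + z) :=
  hμ.add contMDiff_const

/-- Since the generators are `π♯(α_ξ)`, the momentum map equation follows from the pullback
equation, and equivariance may be traded for the bracket relation. -/
theorem generates_iff [ConnectedSpace G] (hΦ : IsSmoothAction EG E Φ)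
    (hgen : ∀ ξ : LieAlg EG G, generator Φ ξ = P.sharpField (α ξ)) :
    Generates P Φ α μ ↔ ContMDiff 𝓘(ℝ, E) 𝓘(ℝ, LieDual EG) ∞ μ ∧
      (∀ ξ : LieAlg EG G, pullbackTheta μ ξ = α ξ) ∧ ∀ (ξ η : LieAlg EG G) (m : M),
        P.bracket (fun p => pairing (μ p) ξ) (fun p => pairing (μ p) η) m =
          pairing (μ m) ⁅ξ, η⁆ := by
  constructor
  · exact fun h => ⟨h.momentum.smooth, h.pullback_eq,
      (h.momentum.isEquivariant_iff hΦ).1 h.equivariant⟩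
  · rintro ⟨h1, h2, h3⟩
    have hm : IsMomentumMap P Φ μ := ⟨h1, fun ξ => by rw [h2, hgen]⟩
    exact ⟨hm, (hm.isEquivariant_iff hΦ).2 h3, h2⟩

/-- The equivariant momentum maps generating `α = dH` are the translates of `H` by the primitives
of the cocycle of `H`. -/
theorem generates_iff_exists [ConnectedSpace G] [ConnectedSpace M] (hΦ : IsSmoothAction EG E Φ)
    (hgen : ∀ ξ : LieAlg EG G, generator Φ ξ = P.sharpField (α ξ))
    (hH : ∀ ξ, α ξ = differential E (H ξ)) {c : LieAlg EG G →ₗ[ℝ] LieAlg EG G →ₗ[ℝ] ℝ}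
    (hc : ∀ ξ η m, P.bracket (H ξ) (H η) m - H ⁅ξ, η⁆ m = c ξ η) :
    Generates P Φ α μ ↔ ∃ z : LieDual EG,
      (∀ ξ η : LieAlg EG G, c ξ η = pairing z ⁅ξ, η⁆) ∧
        ∀ m, μ m = momentumOfHamiltonian H m + z := by
  obtain ⟨m₀⟩ : Nonempty M := inferInstance
  rw [generates_iff hΦ hgen]
  have hbr : ∀ (ν : M → LieDual EG), (∀ ξ : LieAlg EG G,
      differential E (fun p => pairing (ν p) ξ) = differential E (H ξ)) → ∀ (ξ η : LieAlg EG G) m,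
      P.bracket (fun p => pairing (ν p) ξ) (fun p => pairing (ν p) η) m = c ξ η + H ⁅ξ, η⁆ m := by
    intro ν hν ξ η m
    rw [bracket_eq_of_differential_eq (hν ξ) (hν η), ← hc ξ η m, sub_add_cancel]
  constructor
  · rintro ⟨hs, hp, hb⟩
    have hd : ∀ ξ : LieAlg EG G, differential E (fun p => pairing (μ p) ξ) = differential E (H ξ) :=
      fun ξ => (differential_pairing hs ξ).trans ((hp ξ).trans (hH ξ))
    -- The components of `μ` and `H` have the same differentials, so on the connected `M` they
    -- differ by the constant read off at `m₀`.
    have hz : ∀ m, μ m = momentumOfHamiltonian H m + (μ m₀ - momentumOfHamiltonian H m₀) := by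
      intro m
      refine pairing_ext (G := G) fun ξ => ?_
      have h1 : pairing (μ m) ξ - H ξ m = pairing (μ m₀) ξ - H ξ m₀ :=
        sub_eq_sub_of_differential_eq (smoothFun_pairing hs ξ) (smoothFun_coe (H ξ)) (hd ξ) m m₀
      change pairing (μ m) ξ = H ξ m + (pairing (μ m₀) ξ - H ξ m₀)
      linarith
    refine ⟨_, fun ξ η => ?_, hz⟩
    have h1 := hbr μ hd ξ η m₀
    rw [hb ξ η m₀] at h1
    change c ξ η = pairing (μ m₀) ⁅ξ, η⁆ - H ⁅ξ, η⁆ m₀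
    linarith
  · rintro ⟨z, hz, hμ⟩
    obtain rfl : μ = fun m => momentumOfHamiltonian H m + z := funext hμ
    have hs := contMDiff_add_const (contMDiff_momentumOfHamiltonian (H := H)) z
    have hd : ∀ ξ : LieAlg EG G, differential E
        (fun p => pairing (momentumOfHamiltonian H p + z) ξ) = differential E (H ξ) := by
      intro ξ
      have h1 := differential_add (smoothFun_coe (H ξ))
        (contMDiff_const : SmoothFun E fun _ : M => pairing z ξ)
      refine h1.trans ?_
      have h2 : differential E (fun _ : M => pairing z ξ) = 0 := funext fun m => mvfderiv_const _
      rw [h2, add_zero]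
    refine ⟨hs, fun ξ => ((differential_pairing hs ξ).symm.trans (hd ξ)).trans (hH ξ).symm,
      fun ξ η m => ?_⟩
    rw [hbr _ hd ξ η m, hz, add_comm]
    rfl

/-- A proper subspace lies in the kernel of a nonzero linear form. -/
theorem exists_ne_zero_of_span_ne_top
    (h : Submodule.span ℝ {x : LieAlg EG G | ∃ ξ η : LieAlg EG G, x = ⁅ξ, η⁆} ≠ ⊤) :
    ∃ z : LieDual EG, z ≠ 0 ∧ ∀ ξ η : LieAlg EG G, pairing z ⁅ξ, η⁆ = 0 := by
  obtain ⟨f, hf, hle⟩ := Submodule.exists_le_ker_of_lt_top _ (lt_top_iff_ne_top.2 h)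
  refine ⟨dualOfLinear f, fun h0 => hf (LinearMap.ext fun ξ => ?_), fun ξ η =>
    LinearMap.mem_ker.1 (hle (Submodule.subset_span ⟨ξ, η, rfl⟩))⟩
  exact DFunLike.congr_fun h0 (toModel ξ)

theorem eq_zero_of_span_eq_top
    (h : Submodule.span ℝ {x : LieAlg EG G | ∃ ξ η : LieAlg EG G, x = ⁅ξ, η⁆} = ⊤)
    {z : LieDual EG} (hz : ∀ ξ η : LieAlg EG G, pairing z ⁅ξ, η⁆ = 0) : z = 0 := by
  let f : LieAlg EG G →ₗ[ℝ] ℝ := z.toLinearMap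
  have hle : Submodule.span ℝ {x : LieAlg EG G | ∃ ξ η : LieAlg EG G, x = ⁅ξ, η⁆} ≤
      LinearMap.ker f := by
    refine Submodule.span_le.2 ?_
    rintro _ ⟨ξ, η, rfl⟩
    exact hz ξ η
  rw [h] at hle
  exact pairing_ext (G := G) fun ξ => hle (Submodule.mem_top (x := ξ))

end MomentumMaps

end PoissonMomentum

end

/-! ### The main theorem -/

theorem mainTheorem5
    {EG : Type*} [NormedAddCommGroup EG] [NormedSpace ℝ EG] [FiniteDimensional ℝ EG]
    {G : Type*} [TopologicalSpace G] [ChartedSpace EG G] [Group G] [LieGroup 𝓘(ℝ, EG) ∞ G]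
    [SimplyConnectedSpace G]
    {E : Type*} [NormedAddCommGroup E] [NormedSpace ℝ E] [FiniteDimensional ℝ E]
    {M : Type*} [TopologicalSpace M] [ChartedSpace E M] [IsManifold 𝓘(ℝ, E) ∞ M]
    [T2Space M] [CompactSpace M] [SimplyConnectedSpace M]
    (P : PoissonMomentum.PoissonStructure E M) :
    -- infinitesimal momentum maps are the maps `ξ ↦ dH_ξ` with `d{H_ξ, H_η} = dH_{[ξ, η]}`
    (∀ α : PoissonMomentum.LieAlg EG G →ₗ[ℝ] PoissonMomentum.OneForm E M,
      PoissonMomentum.IsInfinitesimalMomentumMap P α ↔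
        ∃ H : PoissonMomentum.LieAlg EG G →ₗ[ℝ] C^∞⟮𝓘(ℝ, E), M; 𝓘(ℝ, ℝ), ℝ⟯,
          (∀ ξ, α ξ = PoissonMomentum.differential E (H ξ)) ∧
          ∀ ξ η, PoissonMomentum.differential E (P.bracket (H ξ) (H η)) =
            PoissonMomentum.differential E (H ⁅ξ, η⁆)) ∧
    -- for any such choice of functions `H_ξ`:
    (∀ (α : PoissonMomentum.LieAlg EG G →ₗ[ℝ] PoissonMomentum.OneForm E M)
      (H : PoissonMomentum.LieAlg EG G →ₗ[ℝ] C^∞⟮𝓘(ℝ, E), M; 𝓘(ℝ, ℝ), ℝ⟯),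
      PoissonMomentum.IsInfinitesimalMomentumMap P α →
      (∀ ξ, α ξ = PoissonMomentum.differential E (H ξ)) →
      -- the defect `c` is constant on `M` and is a 2-cocycle
      ∃ c : PoissonMomentum.LieAlg EG G →ₗ[ℝ] PoissonMomentum.LieAlg EG G →ₗ[ℝ] ℝ,
        (∀ ξ η m, P.bracket (H ξ) (H η) m - H ⁅ξ, η⁆ m = c ξ η) ∧
        PoissonMomentum.IsTwoCocycle c ∧
        -- the vector fields `π♯(α_ξ)` integrate to a unique action of `G`, which is Poisson
        ∃ Φ : G → M → M,
          PoissonMomentum.IsSmoothAction EG E Φ ∧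
          (∀ ξ : PoissonMomentum.LieAlg EG G,
            PoissonMomentum.generator Φ ξ = P.sharpField (α ξ)) ∧
          (∀ Ψ : G → M → M, PoissonMomentum.IsSmoothAction EG E Ψ →
            (∀ ξ : PoissonMomentum.LieAlg EG G,
              PoissonMomentum.generator Ψ ξ = P.sharpField (α ξ)) → Ψ = Φ) ∧
          PoissonMomentum.IsPoissonAction P Φ ∧
          -- if `c = 0`, there is a unique momentum map generating `α` with components `H_ξ`
          (c = 0 → ∃! μ : M → PoissonMomentum.LieDual EG,
            PoissonMomentum.Generates P Φ α μ ∧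
            ∀ (ξ : PoissonMomentum.LieAlg EG G) (m : M),
              PoissonMomentum.pairing (μ m) ξ = H ξ m) ∧
          -- a momentum map generating `α` exists iff the class of `c` vanishes
          ((∃ μ : M → PoissonMomentum.LieDual EG, PoissonMomentum.Generates P Φ α μ) ↔
            ∃ z : PoissonMomentum.LieDual EG, ∀ ξ η : PoissonMomentum.LieAlg EG G,
              c ξ η = PoissonMomentum.pairing z ⁅ξ, η⁆) ∧
          -- the momentum maps generating `α` form an affine space over the annihilator of `[𝔤, 𝔤]`
          (∀ μ ν : M → PoissonMomentum.LieDual EG, PoissonMomentum.Generates P Φ α μ →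
            (PoissonMomentum.Generates P Φ α ν ↔
              ∃ z : PoissonMomentum.LieDual EG,
                (∀ ξ η : PoissonMomentum.LieAlg EG G,
                  PoissonMomentum.pairing z ⁅ξ, η⁆ = 0) ∧
                ∀ m, ν m = μ m + z)) ∧
          -- so, when one exists, it is unique exactly when `[𝔤, 𝔤] = 𝔤`
          ((∃ μ : M → PoissonMomentum.LieDual EG, PoissonMomentum.Generates P Φ α μ) →
            ((∃! μ : M → PoissonMomentum.LieDual EG, PoissonMomentum.Generates P Φ α μ) ↔
              Submodule.span ℝ
                {x : PoissonMomentum.LieAlg EG G |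
                  ∃ ξ η : PoissonMomentum.LieAlg EG G, x = ⁅ξ, η⁆} = ⊤)) ∧
          -- among the maps integrating `α`, equivariance is the same as being a Poisson map
          (∀ μ : M → PoissonMomentum.LieDual EG,
            ContMDiff 𝓘(ℝ, E) 𝓘(ℝ, PoissonMomentum.LieDual EG) ∞ μ →
            (∀ ξ : PoissonMomentum.LieAlg EG G, PoissonMomentum.pullbackTheta μ ξ = α ξ) →
            (PoissonMomentum.IsEquivariant Φ μ ↔
              ∀ (ξ η : PoissonMomentum.LieAlg EG G) (m : M),
                P.bracket (fun p => PoissonMomentum.pairing (μ p) ξ)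
                    (fun p => PoissonMomentum.pairing (μ p) η) m =
                  PoissonMomentum.pairing (μ m) ⁅ξ, η⁆))) := by
  refine ⟨fun α => PoissonMomentum.isInfinitesimalMomentumMap_iff, fun α H hα hH => ?_⟩
  obtain ⟨c, hc, hcoc⟩ := hα.exists_cocycle hH
  have hX : ∀ ξ, PoissonMomentum.SmoothVField (PoissonMomentum.momentumField P α ξ) := fun ξ =>
    P.smooth (α ξ) (hα.smooth ξ)
  obtain ⟨Φ, hΦ, hgen⟩ := PoissonMomentum.exists_smoothAction hX (hα.sharpField_bracket hH)
  have hgen' : ∀ ξ : PoissonMomentum.LieAlg EG G,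
      PoissonMomentum.generator Φ ξ = P.sharpField (α ξ) := hgen
  -- The momentum maps are `H + z` with `z` running over the primitives of `c`. Two primitives
  -- differ by a form vanishing on brackets, and `z = 0` is allowed when `c = 0`.
  have key : ∀ μ : M → PoissonMomentum.LieDual EG, PoissonMomentum.Generates P Φ α μ ↔ _ :=
    fun μ => PoissonMomentum.generates_iff_exists hΦ hgen' hH hc
  have haff : ∀ μ ν : M → PoissonMomentum.LieDual EG, PoissonMomentum.Generates P Φ α μ →
      (PoissonMomentum.Generates P Φ α ν ↔ ∃ z : PoissonMomentum.LieDual EG,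
        (∀ ξ η : PoissonMomentum.LieAlg EG G, PoissonMomentum.pairing z ⁅ξ, η⁆ = 0) ∧
          ∀ m, ν m = μ m + z) := by
    intro μ ν hμ
    obtain ⟨z₀, hz₀, hμz⟩ := (key μ).1 hμ
    rw [key ν]
    constructor
    · rintro ⟨z, hz, hν⟩
      refine ⟨z - z₀, fun ξ η => ?_, fun m => by rw [hν, hμz]; abel⟩
      exact sub_eq_zero.2 ((hz ξ η).symm.trans (hz₀ ξ η))
    · rintro ⟨z, hz, hν⟩
      refine ⟨z₀ + z, fun ξ η => ?_, fun m => by rw [hν, hμz]; abel⟩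
      rw [PoissonMomentum.pairing_add, hz, add_zero, hz₀]
  refine ⟨c, hc, hcoc, Φ, hΦ, hgen', fun Ψ hΨ hΨgen => hΨ.ext_generator hX hΨgen hΦ hgen,
    hΦ.isPoissonAction (fun ξ => PoissonMomentum.smoothFun_coe (H ξ))
      (fun ξ => by rw [hgen', hH]), ?_, ?_, haff, ?_, ?_⟩
  · rintro rfl
    refine ⟨PoissonMomentum.momentumOfHamiltonian H,
      ⟨(key _).2 ⟨0, fun ξ η => rfl, fun m => (add_zero _).symm⟩, fun ξ m => rfl⟩, ?_⟩
    rintro ν ⟨-, hν⟩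
    exact funext fun m => PoissonMomentum.pairing_ext (G := G) fun ξ => hν ξ m
  · constructor
    · rintro ⟨μ, hμ⟩
      obtain ⟨z, hz, -⟩ := (key μ).1 hμ
      exact ⟨z, hz⟩
    · rintro ⟨z, hz⟩
      exact ⟨_, (key _).2 ⟨z, hz, fun m => rfl⟩⟩
  · rintro ⟨μ, hμ⟩
    constructor
    · intro hu
      by_contra hne
      obtain ⟨z, hz0, hz⟩ := PoissonMomentum.exists_ne_zero_of_span_ne_top hne
      obtain ⟨m₀⟩ : Nonempty M := inferInstance
      -- Translating `μ` by a nonzero form that kills all brackets gives a second momentum map.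
      have h := hu.unique ((haff μ _ hμ).2 ⟨z, hz, fun m => rfl⟩) hμ
      exact hz0 (left_eq_add.1 (congrFun h m₀).symm)
    · intro htop
      refine ⟨μ, hμ, fun ν hν => funext fun m => ?_⟩
      obtain ⟨z, hz, h⟩ := (haff μ ν hμ).1 hν
      rw [h, PoissonMomentum.eq_zero_of_span_eq_top htop hz, add_zero]
  · intro μ hs hp
    have hm : PoissonMomentum.IsMomentumMap P Φ μ := ⟨hs, fun ξ => by rw [hp, hgen']⟩
    exact hm.isEquivariant_iff hΦ
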